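/- An $n$-variable randomized decision tree (RDT) $R$ is a binary tree whose leaves are labelled $0$ or $1$ and whose internal nodes are either decision nodes, which branch on the value of one of the boolean variables $x_1,\dots,x_n$, or stochastic nodes, which branch on an independent fair coin. Its query complexity (respectively randomness complexity $m$) is the maximum number of decision (respectively stochastic) nodes on a root-to-leaf path; a $q$-query tree is one of query complexity $q$. $R(x,r)$ is its output on $x\in\{0,1\}^n$ with coin outcomes $r\in\{0,1\}^m$. $R$ computes $f:\{0,1\}^n\to\{0,1\}$ with bounded error if for every $x$, with $r$ uniform in $\{0,1\}^m$, $\mathbb{E}_{r}[R(x,r)]$ lies in $[2/3,1]$ if $f(x)=1$ and in $[0,1/3]$ if $f(x)=0$. A deterministic decision tree (DDT) is an RDT with no stochastic nodes. Trees are described by listing their nodes in preorder over a fixed finite alphabet, with variable indices in binary; the description length is the length of this string. **Theorem** (instance-optimal constructivization of Nisan's theorem). There are a deterministic algorithm $\mathcal{A}$ (a deterministic multi-stack Turing machine), a polynomial $p$ and a constant $C$ such that the following holds for all $n\ge 0$, $q\ge 0$ and $N$. Given as input the description, of length $N$, of a $q$-query $n$-variable RDT $R$ that computes a function $f:\{0,1\}^n\to\{0,1\}$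 with bounded error, $\mathcal{A}$ runs in time at most $$p(N)\cdot n^{C q^3}$$ (with the convention $0^0=1$) and returns the description of a DDT $D$ that computes $f$ exactly, i.e. $D(x)=f(x)$ for all $x\in\{0,1\}^n$, and whose query complexity is $$q^\star_R=\min\{q' : \text{there is a } q'\text{-query DDT } D' \text{ with } D'(x)=f(x)\text{ for all }x\}.$$ -/

import Mathlib

/-- An `n`-variable randomized decision tree with `{0,1}`-valued leaves: `query i t₀ t₁` is a decision
node, which continues in `t₀` if `x i = 0` and in `t₁` if `x i = 1`, and `coin t₀ t₁` is a
stochastic node, which continues in `t₀` or in `t₁` according to a fair coin. -/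
inductive RDT (n : ℕ) : Type
  | leaf (b : Bool) : RDT n
  | query (i : Fin n) (t₀ t₁ : RDT n) : RDT n
  | coin (t₀ t₁ : RDT n) : RDT n

/-- The symbols in which the description of a decision tree is written. -/
inductive TreeSymbol : Type
  | leaf (b : Bool)
  | query
  | coin
  | bit (b : Bool)
  | endIndex
  deriving DecidableEq, Fintype

namespace RDT

variable {n : ℕ}

/-- The maximum number of decision nodes on a root-to-leaf path. -/
def queryComplexity : RDT n → ℕ
  | leaf _ => 0
  | query _ t₀ t₁ => max t₀.queryComplexity t₁.queryComplexity + 1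
  | coin t₀ t₁ => max t₀.queryComplexity t₁.queryComplexity

/-- The maximum number of stochastic nodes on a root-to-leaf path. -/
def randomnessComplexity : RDT n → ℕ
  | leaf _ => 0
  | query _ t₀ t₁ => max t₀.randomnessComplexity t₁.randomnessComplexity
  | coin t₀ t₁ => max t₀.randomnessComplexity t₁.randomnessComplexity + 1

/-- The output `R(x, r)` on input `x` when the successive stochastic nodes met on the path branch on
the successive bits of `r`. (If `r` is too short, zeros are used; this never happens when `r` has
length at least the randomness complexity.) -/
def eval : RDT n → (Fin n → Bool) → List Bool → Bool
  | leaf b, _, _ => b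
  | query i t₀ t₁, x, r => if x i then t₁.eval x r else t₀.eval x r
  | coin t₀ _, x, [] => t₀.eval x []
  | coin t₀ t₁, x, b :: r => if b then t₁.eval x r else t₀.eval x r

/-- The mean function `μ_R(x) = 𝔼_r [R(x, r)]`, for `r` uniform in `{0,1}^m`, where `m` is the
randomness complexity of `R`. -/
noncomputable def mean (R : RDT n) (x : Fin n → Bool) : ℝ :=
  (∑ r : Fin R.randomnessComplexity → Bool, if R.eval x (List.ofFn r) then (1 : ℝ) else 0) /
    2 ^ R.randomnessComplexity

/-- `R` computes `f` with bounded error: `μ_R(x)` lies in `[2/3, 1]` if `f x = 1` and in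
`[0, 1/3]` if `f x = 0`. -/
def ComputesWithBoundedError (R : RDT n) (f : (Fin n → Bool) → Bool) : Prop :=
  ∀ x, (f x = true → R.mean x ∈ Set.Icc (2 / 3 : ℝ) 1) ∧
    (f x = false → R.mean x ∈ Set.Icc (0 : ℝ) (1 / 3))

/-- A deterministic decision tree is a tree with no stochastic nodes. -/
def IsDeterministic : RDT n → Prop
  | leaf _ => True
  | query _ t₀ t₁ => t₀.IsDeterministic ∧ t₁.IsDeterministic
  | coin _ _ => False

/-- `D` is a deterministic decision tree with `D(x) = f(x)` for all `x`. -/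
def ComputesExactly (D : RDT n) (f : (Fin n → Bool) → Bool) : Prop :=
  D.IsDeterministic ∧ ∀ x, D.eval x [] = f x

/-- The description of a tree: its nodes in preorder, where a decision node is followed by the
index of its variable in binary (least significant bit first) and an end-of-index symbol. -/
def describe : RDT n → List TreeSymbol
  | leaf b => [TreeSymbol.leaf b]
  | query i t₀ t₁ => TreeSymbol.query :: ((Nat.bits (i : ℕ)).map TreeSymbol.bit ++
      TreeSymbol.endIndex :: (t₀.describe ++ t₁.describe))
  | coin t₀ t₁ => TreeSymbol.coin :: (t₀.describe ++ t₁.describe)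

end RDT

/-- The minimum query complexity of a deterministic decision tree that computes `f` exactly. -/
noncomputable def minDeterministicQueries {n : ℕ} (f : (Fin n → Bool) → Bool) : ℕ :=
  sInf {q' | ∃ D : RDT n, D.ComputesExactly f ∧ D.queryComplexity = q'}

/-! The proof has a combinatorial half and an algorithmic half.

Nisan's bound. Run `R` on two inputs with the same coins: the outputs differ only if `R` queries a
variable on which the inputs differ. So a block whose flipping changes `f` is hit with probability
at least 1/3, and since at most `q` queries are made, a point has at most `3q` disjoint sensitive
blocks (`card_le`). In a minimal sensitive block every variable is sensitive by itself at the
flipped point, so the block has at most `3q` variables (`exists_block`); the union of a maximal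
disjoint family of such blocks is a certificate of at most `9q²` variables (`exists_certificate`).
Now query certificates of ones of `f` repeatedly. Where a zero disagrees with a certified one, it
has a sensitive block disjoint from all earlier ones (`exists_insert_block`), so after `3q` rounds
`f` is constant (`computableOn`). Hence the optimum is at most `27q³`, and also at most the number
`v` of variables occurring in `R`.

The algorithm. The values of `f` are read off `R` by averaging over the coins in integer arithmetic
with controlled rounding (`decideTokens_eq`). Whether `f` is constant on a subcube is decided from
one point of it: a failure of constancy gives a sensitive block there, hence one of at most `3q`
free variables, so about `v^(3q)` evaluations suffice (`constantLeaf_sound`). For `d = 0, 1, 2,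
...`, dynamic programming over the assignments of at most `d` variables looks for a tree of depth
`d`; the first success is optimal (`exists_first_search`). Everything is polynomial in `N`, `v^(3q)`
and `(2v)^d` with `d ≤ min (27q³) v`, which gives `p(N) * n^(C q³)`.

The machine. Structured programs on four stacks compile to a Turing machine, and `PT`, the class of
functions they compute in polynomial time, is closed under pairing, branching, folds and so on. The
two outer loops are not polynomial in `N`; they are timed by `computes_whileCons` with bounds on the
states actually visited. -/

/-! ### Structured programs and their compilation to a multi-stack machine -/

section
open Turing Function

/-- The stacks of the machine. -/
inductive Stk : Type
  | main | aux | buf | cnt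
  deriving DecidableEq

instance : Fintype Stk :=
  ⟨{.main, .aux, .buf, .cnt}, fun k => by cases k <;> decide⟩

/-- Structured programs acting on the stacks. -/
inductive Prog : Type
  | push (k : Stk) (s : TreeSymbol) : Prog
  | pop (k : Stk) : Prog
  | seq (p q : Prog) : Prog
  | cond (k : Stk) (c : Option TreeSymbol → Bool) (p q : Prog) : Prog
  | loop (k : Stk) (c : Option TreeSymbol → Bool) (p : Prog) : Prog

/-- The contents of the stacks. -/
abbrev Stacks : Type := Stk → List TreeSymbol

namespace Prog

/-- `Run p S S' t`: the program `p` transforms `S` into `S'` in `t` steps. -/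
inductive Run : Prog → Stacks → Stacks → ℕ → Prop
  | push (k : Stk) (s : TreeSymbol) (S : Stacks) : Run (push k s) S (update S k (s :: S k)) 1
  | pop (k : Stk) (S : Stacks) : Run (pop k) S (update S k (S k).tail) 1
  | seq {p q : Prog} {S S' S'' : Stacks} {t t' : ℕ} :
      Run p S S' t → Run q S' S'' t' → Run (seq p q) S S'' (t + t')
  | cond_true {k : Stk} {c : Option TreeSymbol → Bool} {p q : Prog} {S S' : Stacks} {t : ℕ} :
      c (S k).head? = true → Run p S S' t → Run (cond k c p q) S S' (t + 1)
  | cond_false {k : Stk} {c : Option TreeSymbol → Bool} {p q : Prog} {S S' : Stacks} {t : ℕ} :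
      c (S k).head? = false → Run q S S' t → Run (cond k c p q) S S' (t + 1)
  | loop_true {k : Stk} {c : Option TreeSymbol → Bool} {p : Prog} {S S' S'' : Stacks} {t t' : ℕ} :
      c (S k).head? = true → Run p S S' t → Run (loop k c p) S' S'' t' →
        Run (loop k c p) S S'' (t + t' + 1)
  | loop_false {k : Stk} {c : Option TreeSymbol → Bool} {p : Prog} {S : Stacks} :
      c (S k).head? = false → Run (loop k c p) S S 1

/-- The labels of the machine that executes a program. -/
def Lab : Prog → Type
  | push _ _ => Unit
  | pop _ => Unit
  | seq p q => p.Lab ⊕ q.Lab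
  | cond _ _ p q => Option (p.Lab ⊕ q.Lab)
  | loop _ _ p => Option p.Lab

/-- The set of labels is finite. -/
@[reducible] def labFintype : (p : Prog) → Fintype p.Lab
  | push _ _ => inferInstanceAs (Fintype Unit)
  | pop _ => inferInstanceAs (Fintype Unit)
  | seq p q =>
    letI := p.labFintype; letI := q.labFintype; inferInstanceAs (Fintype (p.Lab ⊕ q.Lab))
  | cond _ _ p q =>
    letI := p.labFintype; letI := q.labFintype; inferInstanceAs (Fintype (Option (p.Lab ⊕ q.Lab)))
  | loop _ _ p => letI := p.labFintype; inferInstanceAs (Fintype (Option p.Lab))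

/-- The label at which the execution starts. -/
def entry : (p : Prog) → p.Lab
  | push _ _ => ()
  | pop _ => ()
  | seq p _ => Sum.inl p.entry
  | cond _ _ _ _ => none
  | loop _ _ _ => none

/-- The statements that execute a program, with its labels embedded by `emb` into those of the whole
machine, and with a final jump to `exit`. -/
def code {Λ : Type} : (p : Prog) → (p.Lab → Λ) → Λ → p.Lab →
    TM2.Stmt (fun _ : Stk => TreeSymbol) Λ (Option TreeSymbol)
  | push k s, _, exit, _ => .push k (fun _ => s) (.goto fun _ => exit)
  | pop k, _, exit, _ => .pop k (fun v _ => v) (.goto fun _ => exit)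
  | seq p q, emb, _, Sum.inl l => p.code (fun l => emb (Sum.inl l)) (emb (Sum.inr q.entry)) l
  | seq _ q, emb, exit, Sum.inr l => q.code (fun l => emb (Sum.inr l)) exit l
  | cond k c p q, emb, _, none => .peek k (fun _ o => o) (.branch c
      (.load (fun _ => none) (.goto fun _ => emb (some (Sum.inl p.entry))))
      (.load (fun _ => none) (.goto fun _ => emb (some (Sum.inr q.entry)))))
  | cond _ _ p _, emb, exit, some (Sum.inl l) => p.code (fun l => emb (some (Sum.inl l))) exit l
  | cond _ _ _ q, emb, exit, some (Sum.inr l) => q.code (fun l => emb (some (Sum.inr l))) exit l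
  | loop k c p, emb, exit, none => .peek k (fun _ o => o) (.branch c
      (.load (fun _ => none) (.goto fun _ => emb (some p.entry)))
      (.load (fun _ => none) (.goto fun _ => exit)))
  | loop _ _ p, emb, _, some l => p.code (fun l => emb (some l)) (emb none) l

theorem iterate_bind_add {σ : Type*} (f : σ → Option σ) {a b c : σ} {s t : ℕ}
    (h : (flip bind f)^[s] (some a) = some b) (h' : (flip bind f)^[t] (some b) = some c) :
    (flip bind f)^[s + t] (some a) = some c := by
  rw [add_comm, Function.iterate_add_apply, h, h']

/-- Every label carries one statement ending in a jump, so a unit of cost is one machine step. The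
register is `none` at each label because every test resets it; the state is then determined by the
label and the stacks, and runs can be concatenated. -/
theorem Run.iterate {p : Prog} {S S' : Stacks} {t : ℕ} (h : Run p S S' t) {Λ : Type}
    (M : Λ → TM2.Stmt (fun _ : Stk => TreeSymbol) Λ (Option TreeSymbol)) (emb : p.Lab → Λ)
    (exit : Λ) (hM : ∀ l, M (emb l) = p.code emb exit l) :
    (flip bind (TM2.step M))^[t] (some ⟨some (emb p.entry), none, S⟩) =
      some ⟨some exit, none, S'⟩ := by
  induction h generalizing exit with
  | push k s S =>
    have := hM ()
    simp [flip, entry, this, code]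
  | pop k S =>
    have := hM ()
    simp [flip, entry, this, code]
  | @seq p q _ _ _ _ _ _ _ ih ih' =>
    exact iterate_bind_add _ (ih (fun l => emb (Sum.inl l)) _ fun l => hM (Sum.inl l))
      (ih' (fun l => emb (Sum.inr l)) _ fun l => hM (Sum.inr l))
  | @cond_true k c p q _ _ t hc _ ih =>
    rw [add_comm]
    refine iterate_bind_add _ ?_ (ih (fun l => emb (some (Sum.inl l))) _
      fun l => hM (some (Sum.inl l)))
    have := hM none
    simp [flip, entry, this, code, hc]
  | @cond_false k c p q _ _ t hc _ ih =>
    rw [add_comm]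
    refine iterate_bind_add _ ?_ (ih (fun l => emb (some (Sum.inr l))) _
      fun l => hM (some (Sum.inr l)))
    have := hM none
    simp [flip, entry, this, code, hc]
  | @loop_true k c p _ _ _ t t' hc _ _ ih ih' =>
    rw [add_comm]
    refine iterate_bind_add _ ?_ (iterate_bind_add _ (ih (fun l => emb (some l)) _
      fun l => hM (some l)) (ih' emb _ hM))
    have := hM none
    simp [flip, entry, this, code, hc]
  | loop_false hc =>
    have := hM none
    simp [flip, entry, this, code, hc]

/-- The Turing machine that executes a program, with input and output on the stack `aux`. -/
def machine (p : Prog) : FinTM2 where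
  K := Stk
  k₀ := Stk.aux
  k₁ := Stk.aux
  Γ _ := TreeSymbol
  Λ := Option p.Lab
  main := some p.entry
  ΛFin := letI := p.labFintype; inferInstance
  σ := Option TreeSymbol
  initialState := none
  Γk₀Fin := inferInstanceAs (Fintype TreeSymbol)
  m
    | none => .halt
    | some l => p.code some none l

/-- The contents of the stacks, listed. -/
def config (m a b c : List TreeSymbol) : Stacks
  | .main => m
  | .aux => a
  | .buf => b
  | .cnt => c

@[simp] theorem config_main (m a b c : List TreeSymbol) : config m a b c .main = m := rfl
@[simp] theorem config_aux (m a b c : List TreeSymbol) : config m a b c .aux = a := rfl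
@[simp] theorem config_buf (m a b c : List TreeSymbol) : config m a b c .buf = b := rfl
@[simp] theorem config_cnt (m a b c : List TreeSymbol) : config m a b c .cnt = c := rfl

@[simp] theorem update_config_main (m a b c l : List TreeSymbol) :
    update (config m a b c) .main l = config l a b c := by
  funext k; cases k <;> rfl
@[simp] theorem update_config_aux (m a b c l : List TreeSymbol) :
    update (config m a b c) .aux l = config m l b c := by
  funext k; cases k <;> rfl
@[simp] theorem update_config_buf (m a b c l : List TreeSymbol) :
    update (config m a b c) .buf l = config m a l c := by
  funext k; cases k <;> rfl
@[simp] theorem update_config_cnt (m a b c l : List TreeSymbol) :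
    update (config m a b c) .cnt l = config m a b l := by
  funext k; cases k <;> rfl

theorem Run.outputsInTime {p : Prog} {i o : List TreeSymbol} {t T : ℕ}
    (h : Run p (config [] i [] []) (config [] o [] []) t) (hT : t + 1 ≤ T) :
    Nonempty (TM2OutputsInTime p.machine i (some o) T) := by
  -- The additional step executes `halt` at the exit label `none`.
  refine ⟨⟨⟨t + 1, ?_⟩, hT⟩⟩
  have hi : initList p.machine i = ⟨some (some p.entry), none, config [] i [] []⟩ := by
    unfold initList
    congr 1
    funext k
    cases k <;> rfl
  have ho : haltList p.machine o = ⟨none, none, config [] o [] []⟩ := by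
    unfold haltList
    congr 1
    funext k
    cases k <;> rfl
  rw [hi]
  exact (iterate_bind_add _ (h.iterate p.machine.m some none fun l => rfl) rfl).trans
    (congrArg some ho.symm)

/-- The number of symbols on the stacks. -/
def total (S : Stacks) : ℕ := ∑ k, (S k).length

theorem total_config (m a b c : List TreeSymbol) :
    total (config m a b c) = m.length + a.length + b.length + c.length := by
  simp [total, show (Finset.univ : Finset Stk) = {.main, .aux, .buf, .cnt} from rfl, add_assoc]

theorem total_update (S : Stacks) (k : Stk) (l : List TreeSymbol) :
    total (update S k l) + (S k).length = total S + l.length := by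
  unfold total
  rw [← Finset.add_sum_erase _ _ (Finset.mem_univ k), ← Finset.add_sum_erase _ (fun k => (S k).length) (Finset.mem_univ k),
    Finset.sum_congr rfl (g := fun k => (S k).length)]
  · simp only [update_self]; omega
  · intro j hj
    rw [update_of_ne (Finset.ne_of_mem_erase hj)]

/-- Each step pushes at most one symbol. Consequently every time bound is also a bound on the size
of the output. -/
theorem Run.total_le {p : Prog} {S S' : Stacks} {t : ℕ} (h : Run p S S' t) :
    total S' ≤ total S + t := by
  induction h with
  | push k s S => have := total_update S k (s :: S k); simp at this; omega
  | pop k S => have := total_update S k (S k).tail; simp at this; omega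
  | _ => omega

end Prog

end

/-! ### Values as self-delimiting bit strings, and basic programs on them -/

section
open Turing Function

/-- Binary trees, the values on which the programs operate. -/
inductive V : Type
  | nil : V
  | cons (a b : V) : V

namespace V

/-- The preorder serialization. -/
def bits : V → List Bool
  | nil => [false]
  | cons a b => true :: (a.bits ++ b.bits)

/-- The length of the serialization. -/
def size (v : V) : ℕ := v.bits.length

theorem size_nil : nil.size = 1 := rfl

theorem size_cons (a b : V) : (cons a b).size = a.size + b.size + 1 := by
  simp [size, bits]

theorem one_le_size (v : V) : 1 ≤ v.size := by
  cases v <;> simp [size, bits]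

/-- The preorder code is prefix-free, so values can lie on one stack without separators. -/
theorem eq_of_bits_append_eq {v w : V} {r r' : List Bool} (h : v.bits ++ r = w.bits ++ r') :
    v = w ∧ r = r' := by
  induction v generalizing w r r' with
  | nil => cases w <;> simp_all [bits]
  | cons a b iha ihb =>
    cases w with
    | nil => simp [bits] at h
    | cons c d =>
      simp only [bits, List.cons_append, List.append_assoc, List.cons.injEq, true_and] at h
      obtain ⟨h₁, h⟩ := iha h
      obtain ⟨h₂, h⟩ := ihb h
      exact ⟨by rw [h₁, h₂], h⟩

theorem bits_injective : Injective bits := fun v w h =>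
  (eq_of_bits_append_eq (r := []) (r' := []) (by simpa using h)).1

end V

namespace Prog

/-- `RunLE p S S' t`: the program `p` transforms `S` into `S'` in at most `t` steps. -/
def RunLE (p : Prog) (S S' : Stacks) (t : ℕ) : Prop := ∃ t' ≤ t, Run p S S' t'

namespace RunLE

variable {p q : Prog} {S S' S'' : Stacks} {t t' : ℕ} {k : Stk} {c : Option TreeSymbol → Bool}

theorem mono (h : RunLE p S S' t) (htt : t ≤ t') : RunLE p S S' t' :=
  let ⟨s, hs, r⟩ := h; ⟨s, hs.trans htt, r⟩

theorem seq (h : RunLE p S S' t) (h' : RunLE q S' S'' t') : RunLE (seq p q) S S'' (t + t') :=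
  let ⟨_, hs, r⟩ := h; let ⟨_, hs', r'⟩ := h'; ⟨_, add_le_add hs hs', r.seq r'⟩

theorem cond_true (hc : c (S k).head? = true) (h : RunLE p S S' t) :
    RunLE (cond k c p q) S S' (t + 1) :=
  let ⟨_, hs, r⟩ := h; ⟨_, add_le_add_left hs 1, r.cond_true hc⟩

theorem cond_false (hc : c (S k).head? = false) (h : RunLE q S S' t) :
    RunLE (cond k c p q) S S' (t + 1) :=
  let ⟨_, hs, r⟩ := h; ⟨_, add_le_add_left hs 1, r.cond_false hc⟩

theorem loop_true (hc : c (S k).head? = true) (h : RunLE p S S' t)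
    (h' : RunLE (loop k c p) S' S'' t') : RunLE (loop k c p) S S'' (t + t' + 1) :=
  let ⟨_, hs, r⟩ := h; let ⟨_, hs', r'⟩ := h'
  ⟨_, add_le_add_left (add_le_add hs hs') 1, r.loop_true hc r'⟩

theorem loop_false (hc : c (S k).head? = false) : RunLE (loop k c p) S S 1 :=
  ⟨_, le_rfl, .loop_false hc⟩

end RunLE

/-- The symbol that stands for a bit. -/
def sym : Bool → TreeSymbol
  | false => .endIndex
  | true => .query

/-- Stacks that hold bits. -/
def bitStacks (m a b c : List Bool) : Stacks :=
  config (m.map sym) (a.map sym) (b.map sym) (c.map sym)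

/-- Test whether the top symbol stands for the bit `x`. -/
def topIs (x : Bool) (o : Option TreeSymbol) : Bool := o == some (sym x)

theorem push_main {m a b c : List Bool} {x : Bool} :
    RunLE (push .main (sym x)) (bitStacks m a b c) (bitStacks (x :: m) a b c) 1 :=
  ⟨1, le_rfl, by simpa [bitStacks] using Run.push .main (sym x) (bitStacks m a b c)⟩

theorem pop_main {m a b c : List Bool} {x : Bool} :
    RunLE (pop .main) (bitStacks (x :: m) a b c) (bitStacks m a b c) 1 :=
  ⟨1, le_rfl, by simpa [bitStacks] using Run.pop .main (bitStacks (x :: m) a b c)⟩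

theorem push_aux {m a b c : List Bool} {x : Bool} :
    RunLE (push .aux (sym x)) (bitStacks m a b c) (bitStacks m (x :: a) b c) 1 :=
  ⟨1, le_rfl, by simpa [bitStacks] using Run.push .aux (sym x) (bitStacks m a b c)⟩

theorem pop_aux {m a b c : List Bool} {x : Bool} :
    RunLE (pop .aux) (bitStacks m (x :: a) b c) (bitStacks m a b c) 1 :=
  ⟨1, le_rfl, by simpa [bitStacks] using Run.pop .aux (bitStacks m (x :: a) b c)⟩

theorem push_buf {m a b c : List Bool} {x : Bool} :
    RunLE (push .buf (sym x)) (bitStacks m a b c) (bitStacks m a (x :: b) c) 1 :=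
  ⟨1, le_rfl, by simpa [bitStacks] using Run.push .buf (sym x) (bitStacks m a b c)⟩

theorem pop_buf {m a b c : List Bool} {x : Bool} :
    RunLE (pop .buf) (bitStacks m a (x :: b) c) (bitStacks m a b c) 1 :=
  ⟨1, le_rfl, by simpa [bitStacks] using Run.pop .buf (bitStacks m a (x :: b) c)⟩

theorem push_cnt {m a b c : List Bool} {x : Bool} :
    RunLE (push .cnt (sym x)) (bitStacks m a b c) (bitStacks m a b (x :: c)) 1 :=
  ⟨1, le_rfl, by simpa [bitStacks] using Run.push .cnt (sym x) (bitStacks m a b c)⟩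

theorem pop_cnt {m a b c : List Bool} {x : Bool} :
    RunLE (pop .cnt) (bitStacks m a b (x :: c)) (bitStacks m a b c) 1 :=
  ⟨1, le_rfl, by simpa [bitStacks] using Run.pop .cnt (bitStacks m a b (x :: c))⟩

theorem pop_buf_nil {m a c : List Bool} :
    RunLE (pop .buf) (bitStacks m a [] c) (bitStacks m a [] c) 1 :=
  ⟨1, le_rfl, by simpa [bitStacks] using Run.pop .buf (bitStacks m a [] c)⟩

/-- Empty the stack `k`. -/
def clear (k : Stk) : Prog := loop k (·.isSome) (pop k)

theorem runLE_clear_aux (m a b c : List Bool) :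
    RunLE (clear .aux) (bitStacks m a b c) (bitStacks m [] b c) (2 * a.length + 1) := by
  induction a with
  | nil => exact .loop_false rfl
  | cons x a ih => exact (RunLE.loop_true rfl pop_aux ih).mono (by simp; omega)

theorem runLE_clear_cnt (m a b c : List Bool) :
    RunLE (clear .cnt) (bitStacks m a b c) (bitStacks m a b []) (2 * c.length + 1) := by
  induction c with
  | nil => exact .loop_false rfl
  | cons x a ih => exact (RunLE.loop_true rfl pop_cnt ih).mono (by simp; omega)

/-- Move the top bit of `k` to `k'`. -/
def moveBit (k k' : Stk) : Prog :=
  cond k (topIs true) (seq (pop k) (push k' (sym true))) (seq (pop k) (push k' (sym false)))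

/-- Move the top bit of `k` to `k'` and to `k''`. -/
def copyBit (k k' k'' : Stk) : Prog :=
  cond k (topIs true) (seq (pop k) (seq (push k' (sym true)) (push k'' (sym true))))
    (seq (pop k) (seq (push k' (sym false)) (push k'' (sym false))))

/-- Move the contents of `k` to `k'`, reversing them. -/
def pour (k k' : Stk) : Prog := loop k (·.isSome) (moveBit k k')

theorem runLE_pour_aux_main (m a b c : List Bool) :
    RunLE (pour .aux .main) (bitStacks m a b c) (bitStacks (a.reverse ++ m) [] b c)
      (4 * a.length + 1) := by
  induction a generalizing m with
  | nil => exact .loop_false rfl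
  | cons x a ih =>
    refine (RunLE.loop_true (t := 3) (t' := 4 * a.length + 1) (S' := bitStacks (x :: m) a b c) rfl ?_ ?_).mono ?_
    · cases x
      · exact .cond_false rfl (.seq pop_aux push_main)
      · exact .cond_true rfl (.seq pop_aux push_main)
    · simpa [pour] using ih (x :: m)
    · simp; omega

theorem runLE_pour_buf_main (m a b c : List Bool) :
    RunLE (pour .buf .main) (bitStacks m a b c) (bitStacks (b.reverse ++ m) a [] c)
      (4 * b.length + 1) := by
  induction b generalizing m with
  | nil => exact .loop_false rfl
  | cons x b ih =>
    refine (RunLE.loop_true (t := 3) (t' := 4 * b.length + 1) (S' := bitStacks (x :: m) a b c) rfl ?_ ?_).mono ?_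
    · cases x
      · exact .cond_false rfl (.seq pop_buf push_main)
      · exact .cond_true rfl (.seq pop_buf push_main)
    · simpa [pour] using ih (x :: m)
    · simp; omega

theorem runLE_pour_buf_aux (m a b c : List Bool) :
    RunLE (pour .buf .aux) (bitStacks m a b c) (bitStacks m (b.reverse ++ a) [] c)
      (4 * b.length + 1) := by
  induction b generalizing a with
  | nil => exact .loop_false rfl
  | cons x b ih =>
    refine (RunLE.loop_true (t := 3) (t' := 4 * b.length + 1) (S' := bitStacks m (x :: a) b c) rfl ?_ ?_).mono ?_
    · cases x
      · exact .cond_false rfl (.seq pop_buf push_aux)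
      · exact .cond_true rfl (.seq pop_buf push_aux)
    · simpa [pour] using ih (x :: a)
    · simp; omega

/-- Move the contents of `aux` to `main` and to `buf`, reversing them. -/
def pourBoth : Prog := loop .aux (·.isSome) (copyBit .aux .main .buf)

theorem runLE_pourBoth (m a b c : List Bool) :
    RunLE pourBoth (bitStacks m a b c) (bitStacks (a.reverse ++ m) [] (a.reverse ++ b) c)
      (5 * a.length + 1) := by
  induction a generalizing m b with
  | nil => exact .loop_false rfl
  | cons x a ih =>
    refine (RunLE.loop_true (t := 4) (t' := 5 * a.length + 1) (S' := bitStacks (x :: m) a (x :: b) c) rfl ?_ ?_).mono ?_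
    · cases x
      · exact .cond_false rfl (.seq pop_aux (.seq push_main push_buf))
      · exact .cond_true rfl (.seq pop_aux (.seq push_main push_buf))
    · simpa [pourBoth] using ih (x :: m) (x :: b)
    · simp; omega

/-- Move values from `main` to `k`, reversing them, as many as `cnt` indicates. -/
def takeLoop (k : Stk) : Prog :=
  loop .cnt (·.isSome) (cond .main (topIs true)
    (seq (pop .main) (seq (push k (sym true)) (push .cnt (sym true))))
    (seq (pop .main) (seq (push k (sym false)) (pop .cnt))))

/-- The height of `cnt` is the number of subtrees still to be read: a node replaces one pending
subtree by two, a leaf removes one. The remainder of the run is a hypothesis, so that in the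
induction the run through the right subtree can serve as the continuation of the run through the
left one. Each bit costs 5 steps: the loop test, the branch and three stack operations. -/
theorem runLE_takeLoop_aux (v : V) {m a b c : List Bool} {S : Stacks} {t : ℕ}
    (h : RunLE (takeLoop .aux) (bitStacks m (v.bits.reverse ++ a) b c) S t) :
    RunLE (takeLoop .aux) (bitStacks (v.bits ++ m) a b (true :: c)) S (t + 5 * v.size) := by
  induction v generalizing m a c t with
  | nil =>
    exact (RunLE.loop_true rfl (.cond_false rfl (.seq pop_main
      (.seq push_aux pop_cnt))) h).mono (by simp [V.size_nil]; omega)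
  | cons v w ihv ihw =>
    have := ihv (m := w.bits ++ m) (a := true :: a) (c := true :: c) (ihw (by simpa [V.bits] using h))
    rw [← List.append_assoc] at this
    exact (RunLE.loop_true rfl (.cond_true rfl (.seq pop_main
      (.seq push_aux push_cnt))) this).mono
        (by simp [V.size_cons]; omega)

theorem runLE_takeLoop_buf (v : V) {m a b c : List Bool} {S : Stacks} {t : ℕ}
    (h : RunLE (takeLoop .buf) (bitStacks m a (v.bits.reverse ++ b) c) S t) :
    RunLE (takeLoop .buf) (bitStacks (v.bits ++ m) a b (true :: c)) S (t + 5 * v.size) := by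
  induction v generalizing m b c t with
  | nil =>
    exact (RunLE.loop_true rfl (.cond_false rfl (.seq pop_main
      (.seq push_buf pop_cnt))) h).mono (by simp [V.size_nil]; omega)
  | cons v w ihv ihw =>
    have := ihv (m := w.bits ++ m) (b := true :: b) (c := true :: c) (ihw (by simpa [V.bits] using h))
    rw [← List.append_assoc] at this
    exact (RunLE.loop_true rfl (.cond_true rfl (.seq pop_main
      (.seq push_buf push_cnt))) this).mono
        (by simp [V.size_cons]; omega)

/-- Move one value from `main` to `k`, reversing it. -/
def take (k : Stk) : Prog := seq (push .cnt (sym true)) (takeLoop k)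

theorem runLE_take_aux (v : V) (m a b : List Bool) :
    RunLE (take .aux) (bitStacks (v.bits ++ m) a b []) (bitStacks m (v.bits.reverse ++ a) b [])
      (5 * v.size + 2) :=
  (RunLE.seq push_cnt (runLE_takeLoop_aux v (.loop_false rfl))).mono (by omega)

theorem runLE_take_buf (v : V) (m a b : List Bool) :
    RunLE (take .buf) (bitStacks (v.bits ++ m) a b []) (bitStacks m a (v.bits.reverse ++ b) [])
      (5 * v.size + 2) :=
  (RunLE.seq push_cnt (runLE_takeLoop_buf v (.loop_false rfl))).mono (by omega)

/-- Remove the top value. -/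
def drop : Prog := seq (take .aux) (clear .aux)

theorem runLE_drop (v : V) (m : List Bool) :
    RunLE drop (bitStacks (v.bits ++ m) [] [] []) (bitStacks m [] [] []) (7 * v.size + 3) := by
  refine ((runLE_take_aux v m [] []).seq (runLE_clear_aux ..)).mono ?_
  simp [V.size]; omega

/-- Duplicate the top value. -/
def dup : Prog := seq (take .aux) (seq pourBoth (seq (pour .buf .aux) (pour .aux .main)))

theorem runLE_dup (v : V) (m : List Bool) :
    RunLE dup (bitStacks (v.bits ++ m) [] [] []) (bitStacks (v.bits ++ (v.bits ++ m)) [] [] [])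
      (18 * v.size + 5) := by
  have h1 := runLE_take_aux v m [] []
  have h2 := runLE_pourBoth m (v.bits.reverse ++ []) [] []
  have h3 := runLE_pour_buf_aux (v.bits ++ m) [] v.bits []
  have h4 := runLE_pour_aux_main (v.bits ++ m) v.bits.reverse [] []
  simp only [List.append_nil, List.reverse_reverse] at h1 h2 h3 h4
  refine (h1.seq (h2.seq (h3.seq h4))).mono ?_
  simp [V.size]; omega

/-- Exchange the two top values. -/
def swap : Prog := seq (take .aux) (seq (take .buf) (seq (pour .aux .main) (pour .buf .main)))

theorem runLE_swap (v w : V) (m : List Bool) :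
    RunLE swap (bitStacks (v.bits ++ (w.bits ++ m)) [] [] [])
      (bitStacks (w.bits ++ (v.bits ++ m)) [] [] []) (9 * v.size + 9 * w.size + 6) := by
  have h1 := runLE_take_aux v (w.bits ++ m) [] []
  have h2 := runLE_take_buf w m v.bits.reverse []
  have h3 := runLE_pour_aux_main m v.bits.reverse w.bits.reverse []
  have h4 := runLE_pour_buf_main (v.bits ++ m) [] w.bits.reverse []
  simp only [List.append_nil, List.reverse_reverse] at h1 h2 h3 h4
  refine (h1.seq (h2.seq (h3.seq h4))).mono ?_
  simp [V.size]; omega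

/-- Compare the bit `x` with the top bit of `buf`, and mark a difference on `cnt`. -/
def compareBit (x : Bool) : Prog :=
  seq (pop .aux) (cond .buf (topIs x) (pop .buf) (seq (pop .buf) (push .cnt (sym true))))

/-- Compare `aux` and `buf`, and mark differences on `cnt`. -/
def compare : Prog :=
  seq (loop .aux (·.isSome) (cond .aux (topIs true) (compareBit true) (compareBit false)))
    (loop .buf (·.isSome) (seq (pop .buf) (push .cnt (sym true))))

/-- Only the emptiness of `cnt` matters in the end: it stays empty as long as no difference was met.
An exhausted `buf` counts as a difference, and popping it is harmless. -/
theorem runLE_compareBit (x : Bool) (m a b c : List Bool) (y : Bool) :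
    ∃ c', RunLE (compareBit x) (bitStacks m (y :: a) b c) (bitStacks m a b.tail c') 4 ∧
      (c' = [] ↔ c = [] ∧ b.head? = some x) ∧ c'.length ≤ c.length + 1 := by
  rcases b with _ | ⟨z, b⟩
  · exact ⟨true :: c, .seq pop_aux (.cond_false rfl (.seq pop_buf_nil push_cnt)),
      by simp, by simp⟩
  · by_cases h : z = x
    · subst h
      refine ⟨c, (pop_aux.seq (.cond_true ?_ pop_buf)).mono (by omega), by simp,
        by simp⟩
      cases z <;> rfl
    · refine ⟨true :: c, .seq pop_aux (.cond_false ?_ (.seq pop_buf push_cnt)), by simp [h], by simp⟩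
      cases z <;> cases x <;> first | rfl | exact absurd rfl h

theorem runLE_compare_fst (m a b c : List Bool) :
    ∃ c' b', RunLE (loop .aux (·.isSome) (cond .aux (topIs true) (compareBit true)
      (compareBit false))) (bitStacks m a b c) (bitStacks m [] b' c') (6 * a.length + 1) ∧
      (c' = [] ∧ b' = [] ↔ c = [] ∧ a = b) ∧ c'.length ≤ c.length + a.length ∧
      b'.length ≤ b.length := by
  induction a generalizing b c with
  | nil => exact ⟨c, b, .loop_false rfl, by simp [eq_comm], by simp⟩
  | cons x a ih =>
    obtain ⟨c₁, h₁, h₁', h₁''⟩ := runLE_compareBit x m a b c x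
    obtain ⟨c', b', h, h', h'', h'''⟩ := ih b.tail c₁
    refine ⟨c', b', (RunLE.loop_true (t := 5) rfl ?_ h).mono (by simp; omega), ?_, ?_, ?_⟩
    · cases x
      · exact .cond_false rfl h₁
      · exact .cond_true rfl h₁
    · rw [h', h₁']
      cases b <;> simp [and_assoc, eq_comm]
    · simp; omega
    · simp at h'''; omega

theorem runLE_compare_snd (m b c : List Bool) :
    ∃ c', RunLE (loop .buf (·.isSome) (seq (pop .buf) (push .cnt (sym true))))
      (bitStacks m [] b c) (bitStacks m [] [] c') (3 * b.length + 1) ∧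
      (c' = [] ↔ c = [] ∧ b = []) ∧ c'.length ≤ c.length + b.length := by
  induction b generalizing c with
  | nil => exact ⟨c, .loop_false rfl, by simp⟩
  | cons x b ih =>
    obtain ⟨c', h, h', h''⟩ := ih (true :: c)
    refine ⟨c', (RunLE.loop_true rfl (.seq pop_buf push_cnt) h).mono
      (by simp; omega), ?_, ?_⟩
    · rw [h']; simp
    · simp at h'' ⊢; omega

theorem runLE_compare (m a b : List Bool) :
    ∃ c, RunLE compare (bitStacks m a b []) (bitStacks m [] [] c)
      (6 * a.length + 3 * b.length + 2) ∧ (c = [] ↔ a = b) ∧ c.length ≤ a.length + b.length := by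
  obtain ⟨c', b', h, h', h'', h'''⟩ := runLE_compare_fst m a b []
  obtain ⟨c, k, k', k''⟩ := runLE_compare_snd m b' c'
  refine ⟨c, (h.seq k).mono (by omega), ?_, ?_⟩
  · rw [k', h']; simp
  · simp at h''; omega

/-- Replace the two top values by the truth value of their equality. -/
def equal : Prog :=
  seq (take .aux) (seq (take .buf) (seq compare (seq (cond .cnt (·.isSome)
    (push .main (sym false))
    (seq (push .main (sym false)) (seq (push .main (sym false)) (push .main (sym true)))))
    (clear .cnt))))

/-- The value that stands for a truth value. -/
def _root_.V.ofBool : Bool → V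
  | false => .nil
  | true => .cons .nil .nil

-- Comparing serializations decides equality of values because `bits` is injective.
open Classical in
theorem runLE_equal (v w : V) (m : List Bool) :
    RunLE equal (bitStacks (v.bits ++ (w.bits ++ m)) [] [] [])
      (bitStacks ((V.ofBool (decide (v = w))).bits ++ m) [] [] [])
      (13 * v.size + 10 * w.size + 11) := by
  have h1 := runLE_take_aux v (w.bits ++ m) [] []
  have h2 := runLE_take_buf w m v.bits.reverse []
  obtain ⟨c, h3, h4, h5⟩ := runLE_compare m v.bits.reverse w.bits.reverse
  simp only [List.append_nil] at h1 h2
  have h6 : c = [] ↔ v = w := by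
    rw [h4, List.reverse_inj, V.bits_injective.eq_iff]
  have h7 := runLE_clear_cnt ((V.ofBool (decide (v = w))).bits ++ m) [] [] c
  refine (h1.seq (h2.seq (h3.seq (RunLE.seq (t := 4) ?_ h7)))).mono ?_
  · by_cases h : v = w
    · rw [h6.2 h, decide_eq_true h]
      exact .cond_false rfl (.seq push_main (.seq push_main push_main))
    · obtain ⟨x, c, rfl⟩ := List.exists_cons_of_ne_nil (mt h6.1 h)
      rw [decide_eq_false h]
      exact (RunLE.cond_true rfl push_main).mono (by omega)
  · simp only [V.size, List.length_reverse] at h5 ⊢; omega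

end Prog

end

/-! ### Encodings, polynomial bounds and polynomial-time functions -/

section
open Turing Function

/-- Types whose elements are encoded by values. -/
class Enc (α : Type) where
  /-- the encoding -/
  enc : α → V
  enc_injective : Injective enc

open Enc (enc enc_injective)

/-- The length of the encoding. -/
def esize {α : Type} [Enc α] (a : α) : ℕ := (enc a).size

section Instances

variable {α β : Type} [Enc α] [Enc β]

instance : Enc Unit := ⟨fun _ => .nil, fun _ _ _ => rfl⟩

instance : Enc Bool := ⟨V.ofBool, fun a b => by cases a <;> cases b <;> simp [V.ofBool]⟩

instance : Enc (α × β) where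
  enc p := .cons (enc p.1) (enc p.2)
  enc_injective p q h := by
    simp only [V.cons.injEq] at h
    exact Prod.ext (enc_injective h.1) (enc_injective h.2)

/-- The encoding of a list. -/
def encList : List α → V
  | [] => .nil
  | a :: l => .cons (enc a) (encList l)

instance : Enc (List α) where
  enc := encList
  enc_injective l m h := by
    induction l generalizing m with
    | nil => cases m <;> simp_all [encList]
    | cons a l ih =>
      cases m with
      | nil => simp [encList] at h
      | cons b m =>
        simp only [encList, V.cons.injEq] at h
        rw [enc_injective h.1, ih _ h.2]

/-- The encoding is unary, so that sizes are linear in the number. This suffices, since all numbers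
in the algorithm are bounded by the length of the input up to a constant factor, and it lets `PB` on
`ℕ × ℕ` mean "polynomial in two numbers". -/
instance : Enc ℕ where
  enc n := enc (List.replicate n ())
  enc_injective m n h := by simpa using congrArg List.length (enc_injective h)

/-- The position of a symbol in a fixed list. -/
def TreeSymbol.index : TreeSymbol → ℕ
  | leaf false => 0
  | leaf true => 1
  | query => 2
  | coin => 3
  | bit false => 4
  | bit true => 5
  | endIndex => 6

instance : Enc TreeSymbol where
  enc s := enc s.index
  enc_injective s t h := by
    replace h : s.index = t.index := enc_injective h
    revert s t
    decide

/-- Keeping the ambient encoding allows `PT` to be asserted only on the states that satisfy an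
invariant, while the program still runs on the unrestricted states. -/
instance {P : α → Prop} : Enc (Subtype P) where
  enc a := enc a.1
  enc_injective _ _ h := Subtype.ext (enc_injective h)

theorem esize_unit (a : Unit) : esize a = 1 := rfl

theorem esize_bool_le (a : Bool) : esize a ≤ 3 := by cases a <;> decide

theorem esize_prod (p : α × β) : esize p = esize p.1 + esize p.2 + 1 := V.size_cons ..

theorem esize_nil : esize ([] : List α) = 1 := rfl

theorem esize_cons (a : α) (l : List α) : esize (a :: l) = esize a + esize l + 1 := V.size_cons ..

theorem one_le_esize (a : α) : 1 ≤ esize a := V.one_le_size _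

theorem esize_append (l m : List α) : esize (l ++ m) + 1 = esize l + esize m := by
  induction l with
  | nil => simp [esize_nil]; omega
  | cons a l ih => simp only [List.cons_append, esize_cons]; omega

theorem length_lt_esize (l : List α) : l.length < esize l := by
  induction l with
  | nil => simp [esize_nil]
  | cons a l ih => simp only [List.length_cons, esize_cons]; omega

theorem esize_le_of_mem {a : α} {l : List α} (h : a ∈ l) : esize a < esize l := by
  induction l with
  | nil => simp at h
  | cons b l ih =>
    rw [esize_cons]
    rcases List.mem_cons.1 h with rfl | h
    · omega
    · have := ih h; omega

theorem esize_list_le (l : List α) (B : ℕ) (h : ∀ a ∈ l, esize a ≤ B) :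
    esize l ≤ l.length * (B + 1) + 1 := by
  induction l with
  | nil => simp [esize_nil]
  | cons a l ih =>
    have := ih fun b hb => h b (List.mem_cons_of_mem _ hb)
    have := h a List.mem_cons_self
    rw [esize_cons, List.length_cons, Nat.succ_mul]
    omega

theorem esize_le_of_sublist {l m : List α} (h : l.Sublist m) : esize l ≤ esize m := by
  induction h with
  | slnil => rfl
  | cons a _ ih => rw [esize_cons]; omega
  | cons_cons a _ ih => rw [esize_cons, esize_cons]; omega

theorem esize_reverse (l : List α) : esize l.reverse = esize l := by
  induction l with
  | nil => rfl
  | cons a l ih =>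
    have := esize_append l.reverse [a]
    rw [List.reverse_cons, esize_cons, ← ih]
    rw [esize_cons, esize_nil] at this
    omega

theorem esize_nat (n : ℕ) : esize n = 2 * n + 1 := by
  change esize (List.replicate n ()) = _
  induction n with
  | zero => rfl
  | succ n ih => rw [List.replicate_succ, esize_cons, ih, esize_unit]; omega

theorem esize_symbol_le (s : TreeSymbol) : esize s ≤ 13 := by
  change esize s.index ≤ 13
  rw [esize_nat]
  revert s
  decide

theorem esize_subtype {P : α → Prop} (a : Subtype P) : esize a = esize a.1 := rfl

end Instances

section PolynomialBounds

variable {α β : Type} [Enc α] [Enc β]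

/-- The function `g` is bounded by a polynomial in the size of its argument. -/
def PB (g : α → ℕ) : Prop := ∃ k, ∀ a, g a ≤ (esize a + 2) ^ k

theorem PB.mono {g h : α → ℕ} (hh : PB h) (hg : ∀ a, g a ≤ h a) : PB g :=
  let ⟨k, hk⟩ := hh; ⟨k, fun a => (hg a).trans (hk a)⟩

theorem PB.const (c : ℕ) : PB fun _ : α => c :=
  ⟨c, fun a => (Nat.lt_two_pow_self).le.trans (Nat.pow_le_pow_left (by omega) c)⟩

theorem PB.mul {g h : α → ℕ} (hg : PB g) (hh : PB h) : PB fun a => g a * h a :=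
  let ⟨k, hk⟩ := hg; let ⟨l, hl⟩ := hh
  ⟨k + l, fun a => (Nat.mul_le_mul (hk a) (hl a)).trans_eq (pow_add ..).symm⟩

theorem PB.pow {g : α → ℕ} (hg : PB g) (m : ℕ) : PB fun a => g a ^ m :=
  let ⟨k, hk⟩ := hg
  ⟨k * m, fun a => (Nat.pow_le_pow_left (hk a) m).trans_eq (pow_mul ..).symm⟩

/-- The base `esize a + 2` is at least 2, so one more factor absorbs the sum. -/
theorem PB.add {g h : α → ℕ} (hg : PB g) (hh : PB h) : PB fun a => g a + h a := by
  obtain ⟨k, hk⟩ := hg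
  obtain ⟨l, hl⟩ := hh
  refine ⟨max k l + 1, fun a => ?_⟩
  have h1 := (hk a).trans (Nat.pow_le_pow_right (by omega) (le_max_left k l))
  have h2 := (hl a).trans (Nat.pow_le_pow_right (by omega) (le_max_right k l))
  rw [pow_succ]
  change g a + h a ≤ _
  have := Nat.mul_le_mul_left ((esize a + 2) ^ max k l) (show 2 ≤ esize a + 2 by omega)
  omega

theorem PB.size : PB fun a : α => esize a := ⟨1, fun a => by rw [pow_one]; exact Nat.le_add_right _ _⟩

end PolynomialBounds

/-- The program `p` replaces the top value `x` by `y` in at most `t` steps. -/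
def Prog.Computes (p : Prog) (x y : V) (t : ℕ) : Prop :=
  ∀ r, p.RunLE (Prog.bitStacks (x.bits ++ r) [] [] []) (Prog.bitStacks (y.bits ++ r) [] [] []) t

/-- The function `f` is computable in polynomial time. -/
@[fun_prop]
def PT {α β : Type} [Enc α] [Enc β] (f : α → β) : Prop :=
  ∃ (p : Prog) (k : ℕ), ∀ a, p.Computes (enc a) (enc (f a)) ((esize a + 2) ^ k)

namespace Prog

theorem Computes.mono {p : Prog} {x y : V} {t t' : ℕ} (h : p.Computes x y t) (ht : t ≤ t') :
    p.Computes x y t' := fun r => (h r).mono ht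

theorem Computes.seq {p q : Prog} {x y z : V} {t t' : ℕ} (h : p.Computes x y t)
    (h' : q.Computes y z t') : (p.seq q).Computes x z (t + t') := fun r => (h r).seq (h' r)

theorem Computes.size_le {p : Prog} {x y : V} {t : ℕ} (h : p.Computes x y t) :
    y.size ≤ x.size + t := by
  obtain ⟨t', ht, h⟩ := h []
  have := h.total_le
  simp [bitStacks, total_config, V.size] at this ⊢
  omega

end Prog

namespace Prog

/-- Run `p`, then push a list of bits on `main`. -/
def pushBits : List Bool → Prog → Prog
  | [], p => p
  | x :: l, p => (pushBits l p).seq (push .main (sym x))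

theorem runLE_pushBits {p : Prog} {S : Stacks} {m a b c : List Bool} {t : ℕ} (l : List Bool)
    (h : RunLE p S (bitStacks m a b c) t) :
    RunLE (pushBits l p) S (bitStacks (l ++ m) a b c) (t + l.length) := by
  induction l with
  | nil => exact h
  | cons x l ih => exact ih.seq push_main

end Prog

namespace PT

open Prog

variable {α β γ σ : Type} [Enc α] [Enc β] [Enc γ] [Enc σ]

theorem of_bound {f : α → β} (p : Prog) {g : α → ℕ} (hg : PB g)
    (h : ∀ a, p.Computes (enc a) (enc (f a)) (g a)) : PT f :=
  let ⟨k, hk⟩ := hg; ⟨p, k, fun a => (h a).mono (hk a)⟩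

theorem exists_bound {f : α → β} (hf : PT f) : ∃ (p : Prog) (g : α → ℕ), PB g ∧
    ∀ a, p.Computes (enc a) (enc (f a)) (g a) :=
  let ⟨p, k, h⟩ := hf; ⟨p, _, ⟨k, fun _ => le_rfl⟩, h⟩

theorem size {f : α → β} (hf : PT f) : PB fun a => esize (f a) := by
  obtain ⟨p, g, hg, h⟩ := hf.exists_bound
  exact (PB.size.add hg).mono fun a => (h a).size_le

theorem _root_.PB.comp {g : β → ℕ} (hg : PB g) {f : α → β} (hf : PT f) : PB fun a => g (f a) := by
  obtain ⟨k, hk⟩ := hg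
  exact ((hf.size.add (PB.const 2)).pow k).mono fun a => hk (f a)

/-- Programs see encodings only. Thus `cons` is pairing, a number is a list of units, and a subtype
is its ambient type, at no cost. -/
theorem of_enc_eq {δ : Type} [Enc δ] {f : α → β} {g : α → δ} (hf : PT f)
    (h : ∀ a, enc (g a) = enc (f a)) : PT g := by
  obtain ⟨p, k, hp⟩ := hf
  exact ⟨p, k, fun a => by rw [h]; exact hp a⟩

theorem congr {f g : α → β} (hf : PT f) (h : ∀ a, g a = f a) : PT g :=
  (funext h : g = f) ▸ hf

@[fun_prop]
theorem comp {g : β → γ} {f : α → β} (hg : PT g) (hf : PT f) : PT fun a => g (f a) := by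
  obtain ⟨p, t, ht, hp⟩ := hf.exists_bound
  obtain ⟨q, u, hu, hq⟩ := hg.exists_bound
  exact of_bound (p.seq q) (ht.add (hu.comp hf)) fun a => (hp a).seq (hq (f a))

@[fun_prop]
theorem const (b : β) : PT fun _ : α => b := by
  refine of_bound (g := fun a => 7 * esize a + (3 + (enc b).bits.length)) (pushBits (enc b).bits drop)
    (((PB.const 7).mul PB.size).add (PB.const _)) fun a r => ?_
  exact (runLE_pushBits _ (runLE_drop (enc a) r)).mono (le_of_eq (by simp only [esize]; ring))

@[fun_prop]
theorem id : PT fun a : α => a := by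
  refine of_bound (g := fun a => 18 * esize a + 5 + (7 * esize a + 3)) (dup.seq drop)
    (by
      exact (((PB.const 18).mul PB.size).add (PB.const 5)).add
        (((PB.const 7).mul PB.size).add (PB.const 3))) fun a r => ?_
  exact (runLE_dup (enc a) r).seq (runLE_drop (enc a) _)

@[fun_prop]
theorem fst {f : σ → α × β} (hf : PT f) : PT fun s => (f s).1 := by
  refine comp (g := fun p : α × β => p.1) (of_bound
    (g := fun p => 1 + (9 * esize p + 9 * esize p + 6 + (7 * esize p + 3)))
    ((pop .main).seq (swap.seq drop)) ?_ fun p r => ?_) hf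
  · exact (PB.const 1).add (((((PB.const 9).mul PB.size).add ((PB.const 9).mul PB.size)).add
      (PB.const 6)).add (((PB.const 7).mul PB.size).add (PB.const 3)))
  · rw [show enc p = .cons (enc p.1) (enc p.2) from rfl, V.bits, List.cons_append,
      List.append_assoc]
    refine (pop_main.seq ((runLE_swap _ _ _).seq (runLE_drop _ _))).mono ?_
    rw [esize_prod]; simp only [esize]; omega

@[fun_prop]
theorem snd {f : σ → α × β} (hf : PT f) : PT fun s => (f s).2 := by
  refine comp (g := fun p : α × β => p.2) (of_bound
    (g := fun p => 1 + (7 * esize p + 3))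
    ((pop .main).seq drop) ?_ fun p r => ?_) hf
  · exact (PB.const 1).add (((PB.const 7).mul PB.size).add (PB.const 3))
  · rw [show enc p = .cons (enc p.1) (enc p.2) from rfl, V.bits, List.cons_append,
      List.append_assoc]
    refine (pop_main.seq (runLE_drop _ _)).mono ?_
    rw [esize_prod]; simp only [esize]; omega

/-- The values of `f` and of `g`, one after the other. -/
theorem exists_both {f : σ → α} {g : σ → β} (hf : PT f) (hg : PT g) :
    ∃ (p : Prog) (t : σ → ℕ), PB t ∧ ∀ s r, p.RunLE (bitStacks ((enc s).bits ++ r) [] [] [])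
      (bitStacks ((enc (f s)).bits ++ ((enc (g s)).bits ++ r)) [] [] []) (t s) := by
  obtain ⟨p, t, ht, hp⟩ := hf.exists_bound
  obtain ⟨q, u, hu, hq⟩ := hg.exists_bound
  refine ⟨dup.seq (q.seq (swap.seq p)), _, ?_, fun s r => (runLE_dup _ _).seq ((hq s _).seq
    ((runLE_swap _ _ _).seq (hp s _)))⟩
  exact (((PB.const 18).mul PB.size).add (PB.const 5)).add (hu.add (((((PB.const 9).mul
    hg.size).add ((PB.const 9).mul PB.size)).add (PB.const 6)).add ht))

@[fun_prop]
theorem pair {f : σ → α} {g : σ → β} (hf : PT f) (hg : PT g) : PT fun s => (f s, g s) := by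
  obtain ⟨p, t, ht, hp⟩ := hf.exists_both hg
  refine of_bound (p.seq (push .main (sym true))) (ht.add (PB.const 1)) fun s r => ?_
  rw [show enc (f s, g s) = .cons (enc (f s)) (enc (g s)) from rfl, V.bits, List.cons_append,
      List.append_assoc]
  exact (hp s r).seq push_main

@[fun_prop]
theorem cons {f : σ → α} {g : σ → List α} (hf : PT f) (hg : PT g) : PT fun s => f s :: g s :=
  (hf.pair hg).of_enc_eq fun _ => rfl

@[fun_prop]
theorem val {P : α → Prop} {f : σ → Subtype P} (hf : PT f) : PT fun s => (f s).1 :=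
  hf.of_enc_eq fun _ => rfl

@[fun_prop]
theorem eq [DecidableEq α] {f g : σ → α} (hf : PT f) (hg : PT g) :
    PT fun s => decide (f s = g s) := by
  obtain ⟨p, t, ht, hp⟩ := hf.exists_both hg
  refine of_bound (p.seq equal) (ht.add ((((PB.const 13).mul hf.size).add
    ((PB.const 10).mul hg.size)).add (PB.const 11))) fun s r => ?_
  classical
  have := (hp s r).seq (runLE_equal (enc (f s)) (enc (g s)) r)
  rwa [show enc (decide (f s = g s)) = V.ofBool (decide (enc (f s) = enc (g s))) by
    simp only [enc_injective.eq_iff]; congr]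

@[fun_prop]
theorem ite {c : σ → Prop} [DecidablePred c] {f g : σ → α} (hc : PT fun s => decide (c s))
    (hf : PT f) (hg : PT g) : PT fun s => if c s then f s else g s := by
  obtain ⟨p, t, ht, hp⟩ := hc.exists_both (PT.id (α := σ))
  obtain ⟨q, u, hu, hq⟩ := hf.exists_bound
  obtain ⟨q', u', hu', hq'⟩ := hg.exists_bound
  -- The truth value `true` is encoded by three bits and `false` by one, hence the three pops in the
  -- first branch and the single pop in the second.
  refine of_bound (g := fun s => t s + (u s + u' s + 4)) (p.seq (cond .main (topIs true)
    ((pop .main).seq ((pop .main).seq ((pop .main).seq q))) ((pop .main).seq q')))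
    (ht.add ((hu.add hu').add (PB.const 4))) fun s r => ?_
  refine (hp s r).seq ?_
  by_cases h : c s
  · simp only [h, decide_true, if_true]
    exact (RunLE.cond_true rfl (pop_main.seq (pop_main.seq (pop_main.seq (hq s r))))).mono
      (by omega)
  · simp only [h, decide_false, if_false]
    exact (RunLE.cond_false rfl (pop_main.seq (hq' s r))).mono (by simp; omega)

/-- A nonempty list is encoded as the pair of its head and its tail. So on top of the encoding of
`s`, the encoding of `l s` needs just one more leading `true` to become the encoding of `((a, m),
s)`, on which the program for `g` runs. -/
theorem listCases {l : σ → List α} {f : σ → β} {g : σ → α → List α → β} (hl : PT l) (hf : PT f)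
    (hg : PT fun p : σ × α × List α => g p.1 p.2.1 p.2.2) :
    PT fun s => match l s with
      | [] => f s
      | a :: m => g s a m := by
  obtain ⟨p, t, ht, hp⟩ := hl.exists_both (PT.id (α := σ))
  obtain ⟨q, u, hu, hq⟩ := hf.exists_bound
  have hg' : PT fun p : (α × List α) × σ => g p.2 p.1.1 p.1.2 :=
    comp (g := fun p : σ × α × List α => g p.1 p.2.1 p.2.2)
      (f := fun p : (α × List α) × σ => (p.2, p.1)) hg (by fun_prop)
  obtain ⟨q', k, hq'⟩ := hg'
  refine of_bound (g := fun s => t s + (u s + ((esize (l s) + esize s + 1) + 2) ^ k + 2))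
    (p.seq (cond .main (topIs true) ((push .main (sym true)).seq q') ((pop .main).seq q)))
    (ht.add ((hu.add ((((hl.size.add PB.size).add (PB.const 1)).add (PB.const 2)).pow k)).add
      (PB.const 2))) fun s r => ?_
  refine (hp s r).seq ?_
  rcases h : l s with _ | ⟨a, m⟩
  · exact (RunLE.cond_false rfl (pop_main.seq (hq s r))).mono (by simp; omega)
  · have := hq' ((a, m), s) r
    rw [show enc ((a, m), s) = .cons (enc (a :: m)) (enc s) from rfl, V.bits, List.cons_append,
      List.append_assoc, show esize ((a, m), s) = esize (a :: m) + esize s + 1 from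
        esize_prod _] at this
    exact (RunLE.cond_true rfl (push_main.seq this)).mono (by omega)

end PT

/-! ### Loops and folds -/

namespace Prog

variable {α β : Type} [Enc α] [Enc β]

/-- Repeat `p` as long as the list in the first component of the top value is not empty. -/
def whileCons (p : Prog) : Prog :=
  (pop .main).seq ((loop .main (topIs true) ((push .main (sym true)).seq (p.seq (pop .main)))).seq
    (push .main (sym true)))

/-- Removing the leading bit of the pair exposes the leading bit of the list, which is `true`
exactly when the list is not empty; the bit is restored for each run of `p`. Time is required to be
bounded by `t` only along the orbit of `s`, so this also times loops whose states grow beyond any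
polynomial in the input. -/
theorem computes_whileCons {p : Prog} {step : List α × β → List α × β} {t : ℕ} (n : ℕ)
    (s : List α × β)
    (hp : ∀ i < n, p.Computes (enc (step^[i] s)) (enc (step^[i + 1] s)) t)
    (hs : ∀ i < n, (step^[i] s).1 ≠ []) (hn : (step^[n] s).1 = []) :
    p.whileCons.Computes (enc s) (enc (step^[n] s)) (n * (t + 3) + 3) := by
  intro r
  have henc : ∀ s : List α × β, (enc s).bits ++ r =
      true :: ((enc s.1).bits ++ ((enc s.2).bits ++ r)) := fun s => by
    rw [show enc s = .cons (enc s.1) (enc s.2) from rfl, V.bits, List.cons_append,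
      List.append_assoc]
  have key : ∀ (n : ℕ) (s : List α × β),
      (∀ i < n, p.Computes (enc (step^[i] s)) (enc (step^[i + 1] s)) t) →
      (∀ i < n, (step^[i] s).1 ≠ []) → (step^[n] s).1 = [] →
      RunLE (loop .main (topIs true) ((push .main (sym true)).seq (p.seq (pop .main))))
        (bitStacks ((enc s.1).bits ++ ((enc s.2).bits ++ r)) [] [] [])
        (bitStacks ((enc (step^[n] s).1).bits ++ ((enc (step^[n] s).2).bits ++ r)) [] [] [])
        (n * (t + 3) + 1) := by
    intro n
    induction n with
    | zero =>
      intro s _ _ hs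
      rw [iterate_zero_apply] at hs ⊢
      rw [hs]
      exact (RunLE.loop_false rfl).mono (by omega)
    | succ n ih =>
      intro s hp hs hn
      have h0 := hs 0 (by omega)
      have hp0 := hp 0 (by omega) r
      rw [zero_add, iterate_one, iterate_zero_apply, henc, henc] at hp0
      have := ih (step s) (fun i hi => hp (i + 1) (by omega)) (fun i hi => hs (i + 1) (by omega))
        hn
      refine (RunLE.loop_true ?_ (push_main.seq (hp0.seq pop_main)) this).mono ?_
      · rw [iterate_zero_apply] at h0
        obtain ⟨x, l, h⟩ := List.exists_cons_of_ne_nil h0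
        rw [h]
        rfl
      · rw [Nat.succ_mul]; omega
  rw [henc, henc]
  exact (pop_main.seq ((key n s hp hs hn).seq push_main)).mono (by omega)

end Prog

namespace PT

open Prog

variable {α β γ σ : Type} [Enc α] [Enc β] [Enc γ] [Enc σ]

/-- Iterating a polynomial-time step can blow up the accumulator, hence the polynomial bound `B` on
all intermediate results. The loop state holds the rest of the list, the accumulator and the
parameter `s`. -/
theorem foldl {l : σ → List α} {init : σ → β} {step : σ → β → α → β} {B : σ → ℕ} (hl : PT l)
    (hi : PT init) (hs : PT fun p : σ × β × α => step p.1 p.2.1 p.2.2) (hB : PB B)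
    (h : ∀ s pre, pre <+: l s → esize (pre.foldl (step s) (init s)) ≤ B s) :
    PT fun s => (l s).foldl (step s) (init s) := by
  set body : List α × β × σ → List α × β × σ := fun x => match x.1 with
    | [] => ([], x.2)
    | a :: m => (m, step x.2.2 x.2.1 a, x.2.2) with hbody
  have hb : PT body := by
    refine listCases (l := fun x : List α × β × σ => x.1) (f := fun x => ([], x.2))
      (g := fun x a m => (m, step x.2.2 x.2.1 a, x.2.2)) (by fun_prop) (by fun_prop) ?_
    refine PT.pair (by fun_prop) (PT.pair ?_ (by fun_prop))
    exact comp (g := fun p : σ × β × α => step p.1 p.2.1 p.2.2)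
      (f := fun p : (List α × β × σ) × α × List α => (p.1.2.2, p.1.2.1, p.2.1)) hs (by fun_prop)
  have hiter : ∀ s i, i ≤ (l s).length → body^[i] (l s, init s, s) =
      ((l s).drop i, ((l s).take i).foldl (step s) (init s), s) := by
    intro s i
    induction i with
    | zero => intro _; simp
    | succ i ih =>
      intro hi
      rw [iterate_succ_apply', ih (by omega), hbody]
      have := List.drop_eq_getElem_cons (show i < (l s).length by omega)
      simp only [this, List.take_add_one, List.getElem?_eq_getElem (show i < (l s).length by omega),
        Option.toList_some, List.foldl_append, List.foldl_cons, List.foldl_nil]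
  obtain ⟨p, k, hp⟩ := hb
  suffices PT fun s => (([] : List α), (l s).foldl (step s) (init s), s) from this.snd.fst
  have hstart : PT fun s => (l s, init s, s) := by fun_prop
  obtain ⟨q, u, hu, hq⟩ := hstart.exists_bound
  refine of_bound (g := fun s => u s + (esize (l s) * ((esize (l s) + (B s + esize s + 1) + 1 + 2) ^ k
    + 3) + 3)) (q.seq p.whileCons) ?_ fun s => ?_
  · exact hu.add ((hl.size.mul ((((hl.size.add ((hB.add PB.size).add (PB.const 1))).add
      (PB.const 1)).add (PB.const 2)).pow k |>.add (PB.const 3))).add (PB.const 3))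
  · refine (hq s).seq ?_
    have := computes_whileCons (p := p) (step := body)
      (t := (esize (l s) + (B s + esize s + 1) + 1 + 2) ^ k) (l s).length
      (l s, init s, s) (fun i hi => ?_) (fun i hi => ?_) ?_
    · rw [hiter s _ le_rfl, List.drop_length, List.take_length] at this
      exact this.mono (by gcongr; exact (length_lt_esize _).le)
    · rw [iterate_succ_apply']
      refine (hp _).mono (Nat.pow_le_pow_left ?_ k)
      rw [hiter s i hi.le, esize_prod, esize_prod]
      have h1 := h s _ (List.take_prefix i (l s))
      have h2 := esize_le_of_sublist (List.drop_sublist i (l s))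
      simp only
      omega
    · rw [hiter s i hi.le]
      simpa using hi
    · rw [hiter s _ le_rfl]; simp

end PT

end

/-! ### Closure of polynomial time under operations on lists, booleans and unary numbers -/

section
open Turing Function Enc

theorem esize_flatMap_le {α β : Type} [Enc β] (f : α → List β) (l : List α) (B : ℕ)
    (h : ∀ a ∈ l, esize (f a) ≤ B) : esize (l.flatMap f) ≤ l.length * B + 1 := by
  induction l with
  | nil => simp [esize_nil]
  | cons a l ih =>
    have := ih fun b hb => h b (List.mem_cons_of_mem _ hb)
    have := h a List.mem_cons_self
    have := esize_append (f a) (l.flatMap f)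
    rw [List.flatMap_cons, List.length_cons, Nat.succ_mul]
    omega

namespace PT

theorem foldl_cons_eq {α : Type} (l m : List α) : l.foldl (fun acc a => a :: acc) m = l.reverse ++ m := by
  induction l generalizing m with
  | nil => rfl
  | cons a l ih => simp [ih]

theorem foldl_append_eq {α β : Type} (f : α → List β) (l : List α) (m : List β) :
    l.foldl (fun acc a => acc ++ f a) m = m ++ l.flatMap f := by
  induction l generalizing m with
  | nil => simp
  | cons a l ih => simp [ih]

/-- The result is the default or a single value of `f`, so nothing accumulates; this yields the size
bound for `foldlOverwrite`. -/
theorem foldl_overwrite_mem {α β : Type} (P : β → Prop) (c : α → Prop) [DecidablePred c] (f : α → β)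
    (l : List α) (d : β) (hd : P d) (hf : ∀ a ∈ l, c a → P (f a)) :
    P (l.foldl (fun acc a => if c a then f a else acc) d) := by
  induction l generalizing d with
  | nil => exact hd
  | cons a l ih =>
    refine ih _ ?_ fun b hb => hf b (List.mem_cons_of_mem _ hb)
    dsimp only
    split_ifs with h
    · exact hf a List.mem_cons_self h
    · exact hd

variable {α β γ σ : Type} [Enc α] [Enc β] [Enc γ] [Enc σ]

@[fun_prop]
theorem not {f : σ → Bool} (hf : PT f) : PT fun s => !f s := by
  refine (PT.ite (c := fun s => f s = true) (f := fun _ => false) (g := fun _ => true)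
    (by simpa using hf) (by fun_prop) (by fun_prop)).congr fun s => ?_
  cases f s <;> rfl

@[fun_prop]
theorem and {f g : σ → Bool} (hf : PT f) (hg : PT g) : PT fun s => f s && g s := by
  refine (PT.ite (c := fun s => f s = true) (f := g) (g := fun _ => false)
    (by simpa using hf) (by fun_prop) (by fun_prop)).congr fun s => ?_
  cases f s <;> simp

@[fun_prop]
theorem tail {l : σ → List α} (hl : PT l) : PT fun s => (l s).tail := by
  refine (listCases (g := fun _ _ m => m) hl (const ([] : List α)) (by fun_prop)).congr fun s => ?_
  cases l s <;> rfl

@[fun_prop]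
theorem headD {l : σ → List α} {d : σ → α} (hl : PT l) (hd : PT d) :
    PT fun s => (l s).headD (d s) := by
  refine (listCases (g := fun _ a _ => a) hl hd (by fun_prop)).congr fun s => ?_
  cases l s <;> rfl

@[fun_prop]
theorem take_one {l : σ → List α} (hl : PT l) : PT fun s => (l s).take 1 := by
  refine (listCases (g := fun _ a _ => [a]) hl (const ([] : List α)) (by fun_prop)).congr
    fun s => ?_
  cases l s <;> rfl

@[fun_prop]
theorem reverseAppend {l m : σ → List α} (hl : PT l) (hm : PT m) :
    PT fun s => (l s).reverse ++ m s := by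
  refine (foldl (step := fun _ acc a => a :: acc) (B := fun s => esize (l s) + esize (m s)) hl hm
    (by fun_prop) (hl.size.add hm.size) fun s pre hpre => ?_).congr fun s =>
      (foldl_cons_eq _ _).symm
  rw [foldl_cons_eq]
  have := esize_append pre.reverse (m s)
  have := esize_le_of_sublist hpre.sublist
  rw [esize_reverse] at *
  omega

@[fun_prop]
theorem reverse {l : σ → List α} (hl : PT l) : PT fun s => (l s).reverse :=
  (hl.reverseAppend (const [])).congr fun s => by simp

@[fun_prop]
theorem append {l m : σ → List α} (hl : PT l) (hm : PT m) : PT fun s => l s ++ m s :=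
  (hl.reverse.reverseAppend hm).congr fun s => by simp

@[fun_prop]
theorem flatMap {l : σ → List α} {f : σ → α → List β} (hl : PT l)
    (hf : PT fun p : σ × α => f p.1 p.2) : PT fun s => (l s).flatMap (f s) := by
  obtain ⟨k, hk⟩ := hf.size
  refine (foldl (step := fun s acc a => acc ++ f s a) (init := fun _ => [])
    (B := fun s => esize (l s) * (esize s + esize (l s) + 1 + 2) ^ k + 1)
    hl (by fun_prop) ?_ ?_ fun s pre hpre => ?_).congr fun s =>
      ((foldl_append_eq _ _ _).trans (List.nil_append _)).symm
  · exact PT.append (by fun_prop) (comp (g := fun p : σ × α => f p.1 p.2)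
      (f := fun p : σ × List β × α => (p.1, p.2.2)) hf (by fun_prop))
  · exact (hl.size.mul ((((PB.size.add hl.size).add (PB.const 1)).add (PB.const 2)).pow k)).add
      (PB.const 1)
  · rw [foldl_append_eq, List.nil_append]
    refine (esize_flatMap_le _ _ ((esize s + esize (l s) + 1 + 2) ^ k) fun a ha => ?_).trans ?_
    · refine (hk (s, a)).trans (Nat.pow_le_pow_left ?_ k)
      have := esize_le_of_mem (hpre.subset ha)
      rw [esize_prod]; simp only; omega
    · gcongr
      exact hpre.length_le.trans (length_lt_esize _).le

@[fun_prop]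
theorem map {l : σ → List α} {f : σ → α → β} (hl : PT l) (hf : PT fun p : σ × α => f p.1 p.2) :
    PT fun s => (l s).map (f s) := by
  refine (flatMap (f := fun s a => [f s a]) hl (by fun_prop)).congr fun s => ?_
  exact (List.flatMap_pure_eq_map _ _).symm

@[fun_prop]
theorem all {l : σ → List α} {f : σ → α → Bool} (hl : PT l)
    (hf : PT fun p : σ × α => f p.1 p.2) : PT fun s => (l s).all (f s) := by
  refine (foldl (step := fun s (acc : Bool) a => acc && f s a) (init := fun _ => true)
    (B := fun s => 3) hl (by fun_prop) ?_ (PB.const 3)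
    fun s pre hpre => esize_bool_le _).congr fun s => ?_
  · exact PT.and (by fun_prop) (comp (g := fun p : σ × α => f p.1 p.2)
      (f := fun p : σ × Bool × α => (p.1, p.2.2)) hf (by fun_prop))
  · have : ∀ (m : List α) (b : Bool), m.foldl (fun (acc : Bool) a => acc && f s a) b =
        (b && m.all (f s)) := by
      intro m
      induction m with
      | nil => simp
      | cons a m ih => intro b; simp [ih, Bool.and_assoc]
    simp [this]

@[fun_prop]
theorem decide_and {c d : σ → Prop} [DecidablePred c] [DecidablePred d]
    (hc : PT fun s => decide (c s)) (hd : PT fun s => decide (d s)) :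
    PT fun s => decide (c s ∧ d s) := by
  simpa using hc.and hd

/-- The value of `f` at the last element of a list that satisfies a condition. -/
theorem foldlOverwrite {l : σ → List α} {c : σ → α → Prop} [∀ s, DecidablePred (c s)]
    {f : σ → α → β} {d : σ → β} (hl : PT l)
    (hc : PT fun p : σ × α => decide (c p.1 p.2)) (hf : PT fun p : σ × α => f p.1 p.2)
    (hd : PT d) :
    PT fun s => (l s).foldl (fun acc a => if c s a then f s a else acc) (d s) := by
  obtain ⟨k, hk⟩ := hf.size
  refine foldl (step := fun s acc a => if c s a then f s a else acc)
    (B := fun s => esize (d s) + (esize s + esize (l s) + 1 + 2) ^ k) hl hd ?_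
    (hd.size.add ((((PB.size.add hl.size).add (PB.const 1)).add (PB.const 2)).pow k))
    fun s pre hpre => ?_
  · refine PT.ite (c := fun p : σ × β × α => c p.1 p.2.2) ?_ ?_ (by fun_prop)
    · exact comp (g := fun p : σ × α => decide (c p.1 p.2))
        (f := fun p : σ × β × α => (p.1, p.2.2)) hc (by fun_prop)
    · exact comp (g := fun p : σ × α => f p.1 p.2)
        (f := fun p : σ × β × α => (p.1, p.2.2)) hf (by fun_prop)
  · refine foldl_overwrite_mem (fun b => esize b ≤ _) (c s) (f s) pre (d s) (by simp)
      fun a ha _ => ?_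
    refine ((hk (s, a)).trans (Nat.pow_le_pow_left ?_ k)).trans (Nat.le_add_left _ _)
    have := esize_le_of_mem (hpre.subset ha)
    rw [esize_prod]; simp only; omega

@[fun_prop]
theorem replicate {n : σ → ℕ} (hn : PT n) : PT fun s => List.replicate (n s) () :=
  hn.of_enc_eq fun _ => rfl

@[fun_prop]
theorem succ {n : σ → ℕ} (hn : PT n) : PT fun s => n s + 1 :=
  ((const ()).cons hn.replicate).of_enc_eq fun _ => rfl

@[fun_prop]
theorem pred {n : σ → ℕ} (hn : PT n) : PT fun s => n s - 1 :=
  hn.replicate.tail.of_enc_eq fun s => by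
    rw [List.tail_replicate]; rfl

/-- Iteration of a function. -/
theorem iterate {n : σ → ℕ} {init : σ → β} {step : σ → β → β} {B : σ → ℕ} (hn : PT n)
    (hi : PT init) (hs : PT fun p : σ × β => step p.1 p.2) (hB : PB B)
    (h : ∀ s i, i ≤ n s → esize ((step s)^[i] (init s)) ≤ B s) :
    PT fun s => (step s)^[n s] (init s) := by
  have key : ∀ (s : σ) (i : ℕ) (b : β),
      (List.replicate i ()).foldl (fun b _ => step s b) b = (step s)^[i] b := by
    intro s i
    induction i with
    | zero => intro b; rfl
    | succ i ih => intro b; rw [List.replicate_succ, List.foldl_cons, ih, iterate_succ_apply]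
  refine (foldl (l := fun s => List.replicate (n s) ()) (step := fun s b _ => step s b) (B := B)
    (by fun_prop) hi ?_ hB fun s pre hpre => ?_).congr fun s => (key _ _ _).symm
  · exact comp (g := fun p : σ × β => step p.1 p.2)
      (f := fun p : σ × β × Unit => (p.1, p.2.1)) hs (by fun_prop)
  · obtain ⟨i, rfl⟩ : ∃ i, pre = List.replicate i () :=
      ⟨pre.length, List.eq_replicate_of_mem fun _ _ => rfl⟩
    rw [key]
    exact h s i (by simpa using hpre.length_le)

@[fun_prop]
theorem add {m n : σ → ℕ} (hm : PT m) (hn : PT n) : PT fun s => m s + n s := by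
  have key : ∀ i a : ℕ, (fun x => x + 1)^[i] a = a + i := fun i a => by
    rw [Nat.succ_iterate]
  refine (iterate (step := fun _ x => x + 1) (B := fun s => esize (m s) + esize (n s)) hn hm
    (by fun_prop) (hm.size.add hn.size) fun s i hi => ?_).congr fun s => (key _ _).symm
  rw [key]
  simp only [esize_nat]; omega

@[fun_prop]
theorem sub {m n : σ → ℕ} (hm : PT m) (hn : PT n) : PT fun s => m s - n s := by
  have key : ∀ i a : ℕ, (fun x => x - 1)^[i] a = a - i := fun i a => by
    induction i with
    | zero => rfl
    | succ i ih => rw [iterate_succ_apply', ih]; omega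
  refine (iterate (step := fun _ x => x - 1) (B := fun s => esize (m s)) hn hm
    (by fun_prop) hm.size fun s i hi => ?_).congr fun s => (key _ _).symm
  rw [key]
  simp only [esize_nat]; omega

@[fun_prop]
theorem max {m n : σ → ℕ} (hm : PT m) (hn : PT n) : PT fun s => max (m s) (n s) :=
  (hm.add (hn.sub hm)).congr fun s => by omega

@[fun_prop]
theorem decide_lt {m n : σ → ℕ} (hm : PT m) (hn : PT n) : PT fun s => decide (m s < n s) := by
  refine (((hm.add (const 1)).sub hn).eq (const 0)).congr fun s => ?_
  rw [Bool.eq_iff_iff]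
  simp; omega

@[fun_prop]
theorem half {n : σ → ℕ} (hn : PT n) : PT fun s => n s / 2 := by
  -- Swapping the two components and incrementing one of them lets each component grow at every
  -- second step, which halves without a division.
  have key : ∀ i : ℕ, (fun x : ℕ × ℕ => (x.2, x.1 + 1))^[i] (0, 0) = (i / 2, (i + 1) / 2) := by
    intro i
    induction i with
    | zero => rfl
    | succ i ih => rw [iterate_succ_apply', ih]; simp only [Prod.mk.injEq, true_and]; omega
  refine (iterate (step := fun _ (x : ℕ × ℕ) => (x.2, x.1 + 1)) (init := fun _ => (0, 0))
    (B := fun s => esize (n s) + 5) hn (by fun_prop) (by fun_prop) (hn.size.add (PB.const 5))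
    fun s i hi => ?_).fst.congr fun s => ?_
  · rw [key]
    simp only [esize_prod, esize_nat]; omega
  · rw [key]

@[fun_prop]
theorem length {l : σ → List α} (hl : PT l) : PT fun s => (l s).length :=
  (hl.map (f := fun _ _ => ()) (by fun_prop)).of_enc_eq fun s => by
    rw [List.map_const']; rfl

/-- The alphabet is finite, so a case distinction is a chain of equality tests; `coin` is the case
left when all tests fail. -/
theorem symbolCases {c : σ → TreeSymbol} {f : TreeSymbol → σ → β} (hc : PT c)
    (hf : ∀ t, PT (f t)) : PT fun s => f (c s) s := by
  have key : ∀ L : List TreeSymbol, PT fun s =>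
      L.foldr (fun t r => if c s = t then f t s else r) (f .coin s) := by
    intro L
    induction L with
    | nil => exact hf _
    | cons t L ih => exact PT.ite (c := fun s => c s = t) (by fun_prop) (hf t) ih
  refine (key [.leaf false, .leaf true, .query, .bit false, .bit true, .endIndex]).congr
    fun s => ?_
  rcases c s with (_ | _) | _ | _ | (_ | _) | _ <;> rfl

@[fun_prop]
theorem bit {f : σ → Bool} (hf : PT f) : PT fun s => TreeSymbol.bit (f s) := by
  refine (PT.ite (c := fun s => f s = true) (f := fun _ => TreeSymbol.bit true)
    (g := fun _ => TreeSymbol.bit false) (by fun_prop) (by fun_prop) (by fun_prop)).congr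
    fun s => ?_
  cases f s <;> rfl

@[fun_prop]
theorem leaf {f : σ → Bool} (hf : PT f) : PT fun s => TreeSymbol.leaf (f s) := by
  refine (PT.ite (c := fun s => f s = true) (f := fun _ => TreeSymbol.leaf true)
    (g := fun _ => TreeSymbol.leaf false) (by fun_prop) (by fun_prop) (by fun_prop)).congr
    fun s => ?_
  cases f s <;> rfl

end PT

end

/-! ### Input and output of the machine -/

section
open Turing Function Enc

namespace Prog

theorem push_main_config {m : List Bool} {a b c : List TreeSymbol} {x : Bool} :
    RunLE (push .main (sym x)) (config (m.map sym) a b c) (config ((x :: m).map sym) a b c) 1 :=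
  ⟨1, le_rfl, by simpa using Run.push .main (sym x) (config (m.map sym) a b c)⟩

theorem pop_main_config {m : List Bool} {a b c : List TreeSymbol} {x : Bool} :
    RunLE (pop .main) (config ((x :: m).map sym) a b c) (config (m.map sym) a b c) 1 :=
  ⟨1, le_rfl, by simpa using Run.pop .main (config ((x :: m).map sym) a b c)⟩

theorem pop_aux_config {m a b c : List TreeSymbol} {s : TreeSymbol} :
    RunLE (pop .aux) (config m (s :: a) b c) (config m a b c) 1 :=
  ⟨1, le_rfl, by simpa using Run.pop .aux (config m (s :: a) b c)⟩

theorem push_aux_config {m a b c : List TreeSymbol} {s : TreeSymbol} :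
    RunLE (push .aux s) (config m a b c) (config m (s :: a) b c) 1 :=
  ⟨1, le_rfl, by simpa using Run.push .aux s (config m a b c)⟩

theorem runLE_pushBits_config {p : Prog} {S : Stacks} {m : List Bool} {a b c : List TreeSymbol}
    {t : ℕ} (l : List Bool) (h : RunLE p S (config (m.map sym) a b c) t) :
    RunLE (pushBits l p) S (config ((l ++ m).map sym) a b c) (t + l.length) := by
  induction l with
  | nil => exact h
  | cons x l ih => exact ih.seq push_main_config

/-- Replace the top symbol on `aux`, if it is in the list, by its encoding on `main`. -/
def absorb : List TreeSymbol → Prog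
  | [] => pop .aux
  | s :: L => cond .aux (· == some s) (pushBits (true :: (enc s).bits) (pop .aux)) (absorb L)

theorem runLE_absorb (m : List Bool) (a : List TreeSymbol) (s : TreeSymbol) (L : List TreeSymbol)
    (hs : s ∈ L) : RunLE (absorb L) (config (m.map sym) (s :: a) [] [])
      (config ((true :: (enc s).bits ++ m).map sym) a [] []) (L.length + 15) := by
  induction L with
  | nil => simp at hs
  | cons s' L ih =>
    by_cases h : s = s'
    · subst h
      refine (RunLE.cond_true (by simp)
        (runLE_pushBits_config (true :: (enc s).bits) pop_aux_config)).mono ?_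
      have := esize_symbol_le s
      simp only [List.length_cons]
      change (enc s).bits.length ≤ 13 at this
      omega
    · exact (RunLE.cond_false (by simp [h]) (ih (by simpa [h] using hs))).mono
        (by simp)

/-- The list of all symbols. -/
def symbols : List TreeSymbol :=
  [.leaf false, .leaf true, .query, .coin, .bit false, .bit true, .endIndex]

theorem symbols_index (s : TreeSymbol) : symbols[s.index]? = some s := by
  revert s; decide

/-- Read the input on `aux`. -/
def input : Prog :=
  seq (push .main (sym false)) (loop .aux (·.isSome) (absorb symbols))

/-- Moving symbols from one stack to another reverses them, so the programs receive and return
reversed descriptions. The factor is 23 = 7 + 15 + 1: seven symbols to test, the cost of writing one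
encoding, and the loop test. -/
theorem runLE_input (l : List TreeSymbol) :
    RunLE input (config [] l [] []) (bitStacks ((enc l.reverse).bits ++ []) [] [] [])
      (23 * l.length + 2) := by
  have key : ∀ l m : List TreeSymbol, RunLE (loop .aux (·.isSome) (absorb symbols))
      (config ((enc m).bits.map sym) l [] []) (config ((enc (l.reverse ++ m)).bits.map sym) [] [] [])
      (23 * l.length + 1) := by
    intro l
    induction l with
    | nil => exact fun m => .loop_false rfl
    | cons s l ih =>
      intro m
      have := ih (s :: m)
      rw [List.reverse_cons, List.append_assoc, List.singleton_append]
      refine (RunLE.loop_true rfl (runLE_absorb _ l s symbols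
        (List.mem_of_getElem? (symbols_index s))) this).mono ?_
      simp [symbols]; omega
  have := key l []
  rw [List.append_nil] at this ⊢
  exact ((push_main_config (m := [])).seq this).mono (by omega)

/-- Replace the encoding of a symbol on `main` by the symbol on `aux`. -/
def emit : List TreeSymbol → Prog
  | [] => pop .main
  | s :: L => cond .main (topIs true) ((pop .main).seq ((pop .main).seq (emit L)))
      ((pop .main).seq (push .aux s))

/-- A symbol is stored as its unary index. Each unit is a pair of bits, and removing it advances one
place in the list of symbols. -/
theorem runLE_emit (m : List Bool) (a : List TreeSymbol) (s : TreeSymbol) (L : List TreeSymbol)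
    (n : ℕ) (h : L[n]? = some s) : RunLE (emit L) (config (((enc n).bits ++ m).map sym) a [] [])
      (config (m.map sym) (s :: a) [] []) (3 * L.length) := by
  induction L generalizing n with
  | nil => simp at h
  | cons s' L ih =>
    cases n with
    | zero =>
      obtain rfl : s' = s := by simpa using h
      exact (RunLE.cond_false rfl ((pop_main_config (m := m)).seq push_aux_config)).mono
        (by simp)
    | succ n =>
      exact (RunLE.cond_true rfl ((pop_main_config (m := false :: ((enc n).bits ++ m))).seq
        (pop_main_config.seq (ih n (by simpa using h))))).mono (by simp; omega)

/-- Write the output on `aux`. -/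
def output : Prog :=
  seq (loop .main (topIs true) ((pop .main).seq (emit symbols))) (pop .main)

theorem runLE_output (l : List TreeSymbol) :
    RunLE output (bitStacks ((enc l.reverse).bits ++ []) [] [] []) (config [] l [] [])
      (23 * l.length + 2) := by
  have key : ∀ l a : List TreeSymbol, RunLE (loop .main (topIs true)
      ((pop .main).seq (emit symbols))) (config ((enc l).bits.map sym) a [] [])
      (config ([false].map sym) (l.reverse ++ a) [] []) (23 * l.length + 1) := by
    intro l
    induction l with
    | nil => exact fun a => .loop_false rfl
    | cons s l ih =>
      intro a
      have := ih (s :: a)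
      rw [List.reverse_cons, List.append_assoc, List.singleton_append]
      exact (RunLE.loop_true rfl ((pop_main_config (m := (enc s.index).bits ++ (enc l).bits)).seq
        (runLE_emit _ a s symbols s.index (symbols_index s))) this).mono
          (by simp [symbols]; omega)
  have := key l.reverse []
  rw [List.append_nil] at this ⊢
  rw [List.reverse_reverse, List.length_reverse] at this
  exact (this.seq (pop_main_config (m := []))).mono (by omega)

theorem Computes.outputsInTime {p : Prog} {i o : List TreeSymbol} {t T : ℕ}
    (h : p.Computes (enc i.reverse) (enc o.reverse) t)
    (hT : 23 * i.length + t + 23 * o.length + 5 ≤ T) :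
    Nonempty (TM2OutputsInTime (input.seq (p.seq output)).machine i (some o) T) := by
  obtain ⟨t', ht', hr⟩ := (runLE_input i).seq ((h []).seq (runLE_output o))
  exact hr.outputsInTime (by omega)

end Prog

end

/-! ### The algorithm as functions on lists -/

section
open Turing Function Enc

/-- The name of a variable: the bits of its index, most significant first. -/
abbrev Name : Type := List Bool

/-- A partial assignment of the variables. Later entries take precedence. -/
abbrev Assignment : Type := List (Name × Bool)

/-- A node of a tree: its symbol, and the name of the variable at a decision node. -/
abbrev Token : Type := TreeSymbol × Name

/-- The value of a variable under an assignment, where `d` is the default. -/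
def Assignment.value (d : Bool) (p : Assignment) (i : Name) : Bool :=
  p.foldl (fun acc e => if e.1 = i then e.2 else acc) d

/-- Process one symbol of a description. -/
def tokenStep (s : TreeSymbol) (acc : List Token × Name) : List Token × Name :=
  match s with
  | .leaf b => ((.leaf b, []) :: acc.1, [])
  | .coin => ((.coin, []) :: acc.1, [])
  | .query => acc
  | .bit b => (acc.1, b :: acc.2)
  | .endIndex => ((.query, acc.2) :: acc.1, [])

/-- The nodes of a tree, in reverse preorder, from its description. -/
def tokenize (s : List TreeSymbol) : List Token :=
  (s.foldl (fun acc c => tokenStep c acc) ([], [])).1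

/-- Process one node in the evaluation of a tree on a stack of numbers, where leaves labelled `1`
have the value `U`. -/
def evalStep (U : ℕ) (p : Assignment) (c : TreeSymbol) (i : Name) (st : List ℕ) : List ℕ :=
  match c with
  | .leaf b => (if b = true then U else 0) :: st
  | .coin => ((st.headD 0 + st.tail.headD 0) / 2) :: st.tail.tail
  | .query => (if p.value false i = true then st.tail.headD 0 else st.headD 0) :: st.tail.tail
  | _ => st

/-- The approximate mean of a tree, multiplied by `U`. -/
def evalTokens (ts : List Token) (U : ℕ) (p : Assignment) : ℕ :=
  (ts.foldl (fun st t => evalStep U p t.1 t.2 st) []).headD 0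

/-- The bit that a tree computes. -/
def decideTokens (ts : List Token) (U : ℕ) (p : Assignment) : Bool :=
  decide (U < 2 * evalTokens ts U p)

/-- Process one node in the computation of the query complexity. -/
def queryStep (c : TreeSymbol) (st : List ℕ) : List ℕ :=
  match c with
  | .leaf _ => 0 :: st
  | .coin => max (st.headD 0) (st.tail.headD 0) :: st.tail.tail
  | .query => (max (st.headD 0) (st.tail.headD 0) + 1) :: st.tail.tail
  | _ => st

/-- The query complexity of a tree. -/
def queryTokens (ts : List Token) : ℕ :=
  (ts.foldl (fun st t => queryStep t.1 st) []).headD 0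

/-- The names of the variables of a tree. -/
def namesOf (ts : List Token) : List Name :=
  ts.foldl (fun acc t => if t.1 = .query ∧ (acc.all fun i => !decide (t.2 = i)) = true then t.2 :: acc
    else acc) []

/-- Extend assignments by one more variable that is set. -/
def expandPoints (names : List Name) (T : List Assignment) : List Assignment :=
  [] :: names.flatMap fun i => T.map fun t => (i, true) :: t

/-- What the search needs to know of a tree. -/
abbrev Env : Type := (List Token × ℕ) × List Name × List Assignment

/-- The leaf that computes the function on the points that extend `ρ`, if there is one. -/
def constantLeaf (e : Env) (ρ : Assignment) : List (List TreeSymbol) :=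
  if (e.2.2.all fun t => decide (decideTokens e.1.1 e.1.2 (t ++ ρ) = decideTokens e.1.1 e.1.2 ρ))
    = true
  then [[.leaf (decideTokens e.1.1 e.1.2 ρ)]] else []

/-- Results of searches. -/
abbrev Table : Type := List (Assignment × List (List TreeSymbol))

/-- The entry at `ρ` of a table. -/
def Table.lookup (t : Table) (ρ : Assignment) : List (List TreeSymbol) :=
  t.foldl (fun acc e => if e.1 = ρ then e.2 else acc) []

/-- The description of a tree with a decision node at the root. -/
def describeNode (i : Name) (t₀ t₁ : List TreeSymbol) : List TreeSymbol :=
  .query :: (i.reverse.map (fun b => TreeSymbol.bit b) ++ .endIndex :: (t₀ ++ t₁))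

/-- A tree with a decision node at the root whose subtrees are given by `g`, if there is one. -/
def combine (names : List Name) (g : Assignment → List (List TreeSymbol)) (ρ : Assignment) :
    List (List TreeSymbol) :=
  (names.flatMap fun i => (g ((i, false) :: ρ)).flatMap fun t₀ =>
    (g ((i, true) :: ρ)).map fun t₁ => describeNode i t₀ t₁).take 1

/-- A tree of depth `d` that computes the function on the points that extend `ρ`, if there is
one. -/
def search (e : Env) : ℕ → Assignment → List (List TreeSymbol)
  | 0 => constantLeaf e
  | d + 1 => combine e.2.1 (search e d)

/-- All extensions of the given assignments by one variable. -/
def expandLevel (names : List Name) (L : List Assignment) : List Assignment :=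
  L.flatMap fun ρ => names.flatMap fun i => [(i, false) :: ρ, (i, true) :: ρ]

/-- The table of leaves. -/
def baseTable (e : Env) (L : List Assignment) : Table := L.map fun ρ => (ρ, constantLeaf e ρ)

/-- The next table. -/
def nextTable (names : List Name) (t : Table) (L : List Assignment) : Table :=
  L.map fun ρ => (ρ, combine names t.lookup ρ)

/-- The result of the search, where `Ls` lists the assignments of each length, longest first. -/
def searchLevels (e : Env) (Ls : List (List Assignment)) : List (List TreeSymbol) :=
  Table.lookup (Ls.tail.foldl (fun t L => nextTable e.2.1 t L) (baseTable e (Ls.headD []))) []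

/-- One more round of the search. -/
def searchStep (e : Env) (Ls : List (List Assignment)) :
    List Unit × (Env × List (List Assignment)) × List (List TreeSymbol) :=
  if searchLevels e Ls = [] then ([()], (e, expandLevel e.2.1 (Ls.headD []) :: Ls), [])
  else ([], (e, Ls), searchLevels e Ls)

namespace PT

variable {σ : Type} [Enc σ]

@[fun_prop]
theorem value {p : σ → Assignment} {i : σ → Name} {d : σ → Bool} (hp : PT p) (hi : PT i)
    (hd : PT d) : PT fun s => (p s).value (d s) (i s) :=
  foldlOverwrite (l := p) (c := fun s (e : Name × Bool) => e.1 = i s) (f := fun _ e => e.2) hp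
    (by fun_prop) (by fun_prop) hd

@[fun_prop]
theorem tableLookup {t : σ → Table} {ρ : σ → Assignment} (ht : PT t) (hρ : PT ρ) :
    PT fun s => (t s).lookup (ρ s) :=
  foldlOverwrite (l := t) (c := fun s (e : Assignment × List (List TreeSymbol)) => e.1 = ρ s)
    (f := fun _ e => e.2) ht (by fun_prop) (by fun_prop) (by fun_prop)

theorem tokenStep : PT fun x : TreeSymbol × (List Token × Name) => tokenStep x.1 x.2 := by
  refine symbolCases (c := fun x : TreeSymbol × (List Token × Name) => x.1)
    (f := fun c x => _root_.tokenStep c x.2) (by fun_prop) fun t => ?_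
  rcases t with b | _ | _ | b | _ <;> simp only [_root_.tokenStep] <;> fun_prop

theorem evalStep : PT fun x : TreeSymbol × ℕ × Assignment × Name × List ℕ =>
    evalStep x.2.1 x.2.2.1 x.1 x.2.2.2.1 x.2.2.2.2 := by
  refine symbolCases (c := fun x : TreeSymbol × ℕ × Assignment × Name × List ℕ => x.1)
    (f := fun c x => _root_.evalStep x.2.1 x.2.2.1 c x.2.2.2.1 x.2.2.2.2) (by fun_prop) fun t => ?_
  rcases t with b | _ | _ | b | _ <;> simp only [_root_.evalStep] <;> fun_prop

theorem queryStep : PT fun x : TreeSymbol × List ℕ => queryStep x.1 x.2 := by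
  refine symbolCases (c := fun x : TreeSymbol × List ℕ => x.1)
    (f := fun c x => _root_.queryStep c x.2) (by fun_prop) fun t => ?_
  rcases t with b | _ | _ | b | _ <;> simp only [_root_.queryStep] <;> fun_prop

end PT

end

/-! ### Polynomial time of the steps, and the dynamic programming -/

section
open Turing Function Enc

theorem esize_tokens_tokenStep_le (c : TreeSymbol) (acc : List Token × Name) :
    esize (tokenStep c acc) ≤ esize acc + 17 := by
  have h1 := one_le_esize acc.1
  have h2 := one_le_esize acc.2
  rcases c with b | _ | _ | b | _
  · have := esize_symbol_le (.leaf b)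
    simp only [tokenStep, esize_prod, esize_cons, esize_nil]; omega
  · simp only [tokenStep]; omega
  · have := esize_symbol_le .coin
    simp only [tokenStep, esize_prod, esize_cons, esize_nil]; omega
  · have := esize_bool_le b
    simp only [tokenStep, esize_prod, esize_cons]; omega
  · have := esize_symbol_le .query
    simp only [tokenStep, esize_prod, esize_cons, esize_nil]; omega

theorem esize_foldl_tokenStep_le (s : List TreeSymbol) (acc : List Token × Name) :
    esize (s.foldl (fun acc c => tokenStep c acc) acc) ≤ esize acc + 17 * s.length := by
  induction s generalizing acc with
  | nil => simp
  | cons c s ih =>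
    have := ih (tokenStep c acc)
    have := esize_tokens_tokenStep_le c acc
    rw [List.foldl_cons, List.length_cons]; omega

/-- Leaves contribute `0` or `U`, and selecting and averaging preserve the bound `U`. Rounding thus
replaces denominators `2 ^ m` by numbers small enough for the unary encoding. -/
theorem mem_le_of_evalStep {U : ℕ} {p : Assignment} {c : TreeSymbol} {i : Name} {st : List ℕ}
    (h : ∀ x ∈ st, x ≤ U) : ∀ x ∈ evalStep U p c i st, x ≤ U := by
  have h1 : st.headD 0 ≤ U := by cases st <;> simp_all
  have h2 : st.tail.headD 0 ≤ U := by rcases st with _ | ⟨a, _ | ⟨b, st⟩⟩ <;> simp_all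
  have h3 : ∀ x ∈ st.tail.tail, x ≤ U := fun x hx =>
    h x (List.mem_of_mem_tail (List.mem_of_mem_tail hx))
  rcases c with b | _ | _ | b | _ <;> simp only [evalStep, List.mem_cons, forall_eq_or_imp]
  · exact ⟨by split_ifs <;> simp, h⟩
  · exact ⟨by split_ifs <;> assumption, h3⟩
  · exact ⟨by omega, h3⟩
  · exact h
  · exact h

theorem length_evalStep_le {U : ℕ} {p : Assignment} {c : TreeSymbol} {i : Name} {st : List ℕ} :
    (evalStep U p c i st).length ≤ st.length + 1 := by
  rcases c with b | _ | _ | b | _ <;> simp [evalStep]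
  all_goals omega

theorem mem_le_of_queryStep {n : ℕ} {c : TreeSymbol} {st : List ℕ}
    (h : ∀ x ∈ st, x ≤ n) : ∀ x ∈ queryStep c st, x ≤ n + 1 := by
  have h1 : st.headD 0 ≤ n := by cases st <;> simp_all
  have h2 : st.tail.headD 0 ≤ n := by rcases st with _ | ⟨a, _ | ⟨b, st⟩⟩ <;> simp_all
  have h3 : ∀ x ∈ st.tail.tail, x ≤ n + 1 := fun x hx =>
    (h x (List.mem_of_mem_tail (List.mem_of_mem_tail hx))).trans (by omega)
  have h' : ∀ x ∈ st, x ≤ n + 1 := fun x hx => (h x hx).trans (by omega)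
  rcases c with b | _ | _ | b | _ <;> simp only [queryStep, List.mem_cons, forall_eq_or_imp]
  · exact ⟨by omega, h'⟩
  · exact ⟨by omega, h3⟩
  · exact ⟨by omega, h3⟩
  · exact h'
  · exact h'

theorem length_queryStep_le {c : TreeSymbol} {st : List ℕ} :
    (queryStep c st).length ≤ st.length + 1 := by
  rcases c with b | _ | _ | b | _ <;> simp [queryStep]
  all_goals omega

theorem foldl_evalStep_bound (U : ℕ) (p : Assignment) (ts : List Token) (st : List ℕ)
    (h : ∀ x ∈ st, x ≤ U) :
    (∀ x ∈ ts.foldl (fun st t => evalStep U p t.1 t.2 st) st, x ≤ U) ∧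
      (ts.foldl (fun st t => evalStep U p t.1 t.2 st) st).length ≤ st.length + ts.length := by
  induction ts generalizing st with
  | nil => exact ⟨h, le_rfl⟩
  | cons t ts ih =>
    obtain ⟨h1, h2⟩ := ih _ (mem_le_of_evalStep (p := p) (c := t.1) (i := t.2) h)
    refine ⟨h1, h2.trans ?_⟩
    have := length_evalStep_le (U := U) (p := p) (c := t.1) (i := t.2) (st := st)
    rw [List.length_cons]; omega

theorem foldl_queryStep_bound (n : ℕ) (ts : List Token) (st : List ℕ) (h : ∀ x ∈ st, x ≤ n) :
    (∀ x ∈ ts.foldl (fun st t => queryStep t.1 st) st, x ≤ n + ts.length) ∧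
      (ts.foldl (fun st t => queryStep t.1 st) st).length ≤ st.length + ts.length := by
  induction ts generalizing st n with
  | nil => exact ⟨h, le_rfl⟩
  | cons t ts ih =>
    obtain ⟨h1, h2⟩ := ih _ _ (mem_le_of_queryStep (c := t.1) h)
    have := length_queryStep_le (c := t.1) (st := st)
    simp only [List.length_cons]
    exact ⟨fun x hx => (h1 x hx).trans (by omega), h2.trans (by omega)⟩

theorem esize_foldl_names_le (ts : List Token) (acc : List Name) :
    esize (ts.foldl (fun acc t => if t.1 = .query ∧ (acc.all fun i => !decide (t.2 = i)) = true
      then t.2 :: acc else acc) acc) ≤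
      esize acc + esize ts := by
  induction ts generalizing acc with
  | nil => simp
  | cons t ts ih =>
    refine (ih _).trans ?_
    rw [esize_cons, esize_prod]
    dsimp only
    split_ifs
    · rw [esize_cons]; omega
    · omega

namespace PT

variable {σ : Type} [Enc σ]

@[fun_prop]
theorem tokenize {l : σ → List TreeSymbol} (hl : PT l) : PT fun s => tokenize (l s) := by
  refine PT.fst (foldl (init := fun _ => ([], [])) (step := fun _ acc c => _root_.tokenStep c acc)
    (B := fun s => 3 + 17 * esize (l s)) hl (by fun_prop)
    (comp (f := fun p : σ × (List Token × Name) × TreeSymbol => (p.2.2, p.2.1)) tokenStep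
      (by fun_prop)) ((PB.const 3).add ((PB.const 17).mul hl.size)) fun s pre hpre => ?_)
  refine (esize_foldl_tokenStep_le pre _).trans ?_
  have := hpre.length_le
  have := length_lt_esize (l s)
  simp only [esize_prod, esize_nil]; omega

@[fun_prop]
theorem evalTokens {ts : σ → List Token} {U : σ → ℕ} {p : σ → Assignment} (hts : PT ts)
    (hU : PT U) (hp : PT p) : PT fun s => evalTokens (ts s) (U s) (p s) := by
  refine PT.headD (foldl (init := fun _ => [])
    (step := fun s st t => _root_.evalStep (U s) (p s) t.1 t.2 st)
    (B := fun s => esize (ts s) * (esize (U s) + 1) + 1) hts (by fun_prop)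
    (comp (f := fun x : σ × List ℕ × Token => (x.2.2.1, U x.1, p x.1, x.2.2.2, x.2.1)) evalStep
      (by fun_prop)) ((hts.size.mul (hU.size.add (PB.const 1))).add (PB.const 1))
      fun s pre hpre => ?_) (by fun_prop)
  obtain ⟨h1, h2⟩ := foldl_evalStep_bound (U s) (p s) pre [] (by simp)
  refine (esize_list_le _ (esize (U s)) fun a ha => ?_).trans ?_
  · have := h1 a ha
    simp only [esize_nat]; omega
  · gcongr
    have := hpre.length_le
    have := length_lt_esize (ts s)
    simp only [List.length_nil] at h2
    omega

@[fun_prop]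
theorem decideTokens {ts : σ → List Token} {U : σ → ℕ} {p : σ → Assignment} (hts : PT ts)
    (hU : PT U) (hp : PT p) : PT fun s => decideTokens (ts s) (U s) (p s) := by
  have : PT fun s => decide (U s <
      _root_.evalTokens (ts s) (U s) (p s) + _root_.evalTokens (ts s) (U s) (p s)) := by fun_prop
  exact this.congr fun s => by rw [_root_.decideTokens, two_mul]

@[fun_prop]
theorem queryTokens {ts : σ → List Token} (hts : PT ts) : PT fun s => queryTokens (ts s) := by
  refine PT.headD (foldl (init := fun _ => [])
    (step := fun s st t => _root_.queryStep t.1 st)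
    (B := fun s => esize (ts s) * (2 * esize (ts s) + 1 + 1) + 1) hts (by fun_prop)
    (comp (f := fun x : σ × List ℕ × Token => (x.2.2.1, x.2.1)) queryStep
      (by fun_prop)) ((hts.size.mul ((((PB.const 2).mul hts.size).add (PB.const 1)).add
        (PB.const 1))).add (PB.const 1))
      fun s pre hpre => ?_) (by fun_prop)
  obtain ⟨h1, h2⟩ := foldl_queryStep_bound 0 pre [] (by simp)
  have := hpre.length_le
  have := length_lt_esize (ts s)
  refine (esize_list_le _ (2 * esize (ts s) + 1) fun a ha => ?_).trans ?_
  · have := h1 a ha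
    simp only [esize_nat]; omega
  · gcongr
    simp only [List.length_nil] at h2
    omega

@[fun_prop]
theorem namesOf {ts : σ → List Token} (hts : PT ts) : PT fun s => namesOf (ts s) := by
  refine foldl (init := fun _ => [])
    (step := fun s acc (t : Token) => if t.1 = .query ∧ (acc.all fun i => !decide (t.2 = i)) = true
      then t.2 :: acc else acc)
    (B := fun s => 1 + esize (ts s)) hts (by fun_prop) (by fun_prop)
    ((PB.const 1).add hts.size) fun s pre hpre => ?_
  have := esize_foldl_names_le pre []
  have := esize_le_of_sublist hpre.sublist
  rw [esize_nil] at *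
  omega

theorem expandPoints : PT fun x : List Name × List Assignment => expandPoints x.1 x.2 := by
  unfold _root_.expandPoints; fun_prop

@[fun_prop]
theorem constantLeaf {e : σ → Env} {ρ : σ → Assignment} (he : PT e) (hρ : PT ρ) :
    PT fun s => constantLeaf (e s) (ρ s) := by
  unfold _root_.constantLeaf; fun_prop

@[fun_prop]
theorem describeNode {i : σ → Name} {t u : σ → List TreeSymbol} (hi : PT i) (ht : PT t)
    (hu : PT u) : PT fun s => describeNode (i s) (t s) (u s) := by
  unfold _root_.describeNode; fun_prop

@[fun_prop]
theorem expandLevel {names : σ → List Name} {L : σ → List Assignment} (hn : PT names)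
    (hL : PT L) : PT fun s => expandLevel (names s) (L s) := by
  unfold _root_.expandLevel; fun_prop

@[fun_prop]
theorem baseTable {e : σ → Env} {L : σ → List Assignment} (he : PT e) (hL : PT L) :
    PT fun s => baseTable (e s) (L s) := by
  unfold _root_.baseTable; fun_prop

@[fun_prop]
theorem nextTable {names : σ → List Name} {t : σ → Table} {L : σ → List Assignment}
    (hn : PT names) (ht : PT t) (hL : PT L) : PT fun s => nextTable (names s) (t s) (L s) := by
  unfold _root_.nextTable combine; fun_prop

end PT

/-- The assignments of `d` variables. -/
def level (names : List Name) (d : ℕ) : List Assignment := (expandLevel names)^[d] [[]]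

/-- The assignments of fewer than `d` variables. -/
def levelsBelow (names : List Name) : ℕ → List (List Assignment)
  | 0 => []
  | d + 1 => level names d :: levelsBelow names d

theorem level_succ (names : List Name) (d : ℕ) :
    level names (d + 1) = expandLevel names (level names d) := iterate_succ_apply' _ _ _

theorem length_expandLevel (names : List Name) (L : List Assignment) :
    (expandLevel names L).length = L.length * (2 * names.length) := by
  have : ∀ ρ : Assignment, (names.flatMap fun i => [(i, false) :: ρ, (i, true) :: ρ]).length =
      2 * names.length := fun ρ => by
    simp [List.length_flatMap, mul_comm]
  simp [expandLevel, List.length_flatMap, this]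

theorem length_level (names : List Name) (d : ℕ) :
    (level names d).length = (2 * names.length) ^ d := by
  induction d with
  | zero => rfl
  | succ d ih => rw [level_succ, length_expandLevel, ih, pow_succ]

theorem mem_level_succ {names : List Name} {d : ℕ} {i : Name} {ρ : Assignment} (b : Bool)
    (hi : i ∈ names) (hρ : ρ ∈ level names d) : (i, b) :: ρ ∈ level names (d + 1) := by
  rw [level_succ, expandLevel]
  simp only [List.mem_flatMap]
  exact ⟨ρ, hρ, i, hi, by cases b <;> simp⟩

/-- The table with the results of the searches of depth `k`. -/
def searchTable (e : Env) (k : ℕ) (L : List Assignment) : Table := L.map fun ρ => (ρ, search e k ρ)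

/-- Repeated entries are harmless, since all entries at `ρ` carry the same result. -/
theorem lookup_searchTable {e : Env} {k : ℕ} {L : List Assignment} {ρ : Assignment} (h : ρ ∈ L) :
    (searchTable e k L).lookup ρ = search e k ρ := by
  -- For the induction the default may already be the right result, as it is once `ρ` has been met.
  have key : ∀ (L : List Assignment) (d : List (List TreeSymbol)), (ρ ∈ L ∨ d = search e k ρ) →
      (searchTable e k L).foldl (fun acc e => if e.1 = ρ then e.2 else acc) d = search e k ρ := by
    intro L
    induction L with
    | nil => simp [searchTable]
    | cons a L ih =>
      intro d hd
      rw [searchTable, List.map_cons, List.foldl_cons]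
      refine ih _ ?_
      by_cases ha : a = ρ
      · subst ha; simp
      · simp only [ha, if_false]
        simpa [Ne.symm ha] using hd
  exact key L _ (Or.inl h)

/-- Only extensions of `ρ` by one variable are consulted, so the table of the next longer level is
enough. -/
theorem combine_congr {names : List Name} {g h : Assignment → List (List TreeSymbol)}
    {ρ : Assignment} (hgh : ∀ i ∈ names, ∀ b, g ((i, b) :: ρ) = h ((i, b) :: ρ)) :
    combine names g ρ = combine names h ρ := by
  unfold combine
  congr 1
  exact List.flatMap_congr fun i hi => by rw [hgh i hi, hgh i hi]

theorem nextTable_searchTable (e : Env) (k d : ℕ) :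
    nextTable e.2.1 (searchTable e k (level e.2.1 (d + 1))) (level e.2.1 d) =
      searchTable e (k + 1) (level e.2.1 d) := by
  refine List.map_congr_left fun ρ hρ => ?_
  rw [search, combine_congr fun i hi b => lookup_searchTable (mem_level_succ b hi hρ)]

/-- The invariant of the dynamic programming: each round shortens the assignments by one and deepens
the search by one. -/
theorem foldl_nextTable (e : Env) (k d j : ℕ) (hj : j ≤ d) :
    ((levelsBelow e.2.1 d).take j).foldl (fun t L => nextTable e.2.1 t L)
      (searchTable e k (level e.2.1 d)) = searchTable e (k + j) (level e.2.1 (d - j)) := by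
  induction j generalizing k d with
  | zero => rfl
  | succ j ih =>
    obtain ⟨d, rfl⟩ : ∃ d', d = d' + 1 := ⟨d - 1, by omega⟩
    rw [levelsBelow, List.take_succ_cons, List.foldl_cons, nextTable_searchTable,
      ih _ _ (by omega), Nat.add_sub_add_right, add_right_comm, add_assoc]

theorem length_levelsBelow (names : List Name) (d : ℕ) : (levelsBelow names d).length = d := by
  induction d with
  | zero => rfl
  | succ d ih => rw [levelsBelow, List.length_cons, ih]

theorem searchLevels_eq (e : Env) (d : ℕ) :
    searchLevels e (levelsBelow e.2.1 (d + 1)) = search e d [] := by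
  have := foldl_nextTable e 0 d d le_rfl
  rw [List.take_of_length_le (length_levelsBelow _ _).le, zero_add, Nat.sub_self] at this
  rw [searchLevels]
  change Table.lookup ((levelsBelow e.2.1 d).foldl (fun t L => nextTable e.2.1 t L)
    (searchTable e 0 (level e.2.1 d))) [] = _
  rw [this]
  exact lookup_searchTable (List.mem_singleton.2 rfl)

theorem esize_describeNode_le (i : Name) (t u : List TreeSymbol) :
    esize (describeNode i t u) ≤ esize t + esize u + 14 * esize i + 32 := by
  have h1 := esize_symbol_le .query
  have h2 := esize_symbol_le .endIndex
  have h3 := esize_list_le (i.reverse.map fun b => TreeSymbol.bit b) 13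
    fun a _ => esize_symbol_le a
  have h4 := length_lt_esize i
  have h5 := esize_append (i.reverse.map fun b => TreeSymbol.bit b) (.endIndex :: (t ++ u))
  have h6 := esize_append t u
  rw [esize_cons] at h5
  rw [describeNode, esize_cons]
  simp only [List.length_map, List.length_reverse] at h3
  omega

/-- Joining two descriptions adds at most `c = 14 * esize e.2.1 + 32`, so size plus `c` at most
doubles with each level; this is why `c` appears on the left. A leaf has size at most 15, and 47 =
15 + 32. -/
theorem esize_mem_search_le (e : Env) (k : ℕ) (ρ : Assignment) :
    ∀ t ∈ search e k ρ, esize t + (14 * esize e.2.1 + 32) ≤ 2 ^ k * (14 * esize e.2.1 + 47) := by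
  induction k generalizing ρ with
  | zero =>
    intro t ht
    rw [search, constantLeaf] at ht
    split_ifs at ht
    · obtain rfl := List.mem_singleton.1 ht
      have := esize_symbol_le (.leaf (decideTokens e.1.1 e.1.2 ρ))
      rw [esize_cons, esize_nil]; omega
    · simp at ht
  | succ k ih =>
    intro t ht
    have := List.mem_of_mem_take ht
    simp only [List.mem_flatMap, List.mem_map] at this
    obtain ⟨i, hi, t₀, ht₀, t₁, ht₁, rfl⟩ := this
    have h0 := ih _ _ ht₀
    have h1 := ih _ _ ht₁
    have h2 := esize_describeNode_le i t₀ t₁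
    have h3 := esize_le_of_mem hi
    rw [pow_succ, mul_assoc, mul_comm 2, ← mul_assoc]
    omega

/-- Keeping a single tree per assignment prevents the tables from growing with the number of
solutions. -/
theorem length_search_le (e : Env) (k : ℕ) (ρ : Assignment) : (search e k ρ).length ≤ 1 := by
  cases k with
  | zero => rw [search, constantLeaf]; split_ifs <;> simp
  | succ k => exact List.length_take_le _ _

theorem esize_search_le (e : Env) (k : ℕ) (ρ : Assignment) :
    esize (search e k ρ) ≤ 2 ^ k * (14 * esize e.2.1 + 47) + 2 := by
  refine (esize_list_le _ _ fun t ht => Nat.le_of_add_right_le (esize_mem_search_le e k ρ t ht)).trans ?_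
  have := Nat.mul_le_mul_right (2 ^ k * (14 * esize e.2.1 + 47) + 1) (length_search_le e k ρ)
  omega

theorem esize_searchTable_le (e : Env) (k : ℕ) (L : List Assignment) :
    esize (searchTable e k L) ≤ esize L * (esize L + 2 ^ k * (14 * esize e.2.1 + 47) + 4) + 1 := by
  refine (esize_list_le _ (esize L + 2 ^ k * (14 * esize e.2.1 + 47) + 3) fun a ha => ?_).trans ?_
  · obtain ⟨ρ, hρ, rfl⟩ := List.mem_map.1 ha
    have := esize_le_of_mem hρ
    have := esize_search_le e k ρ
    rw [esize_prod]; simp only; omega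
  · gcongr
    rw [searchTable, List.length_map]
    exact (length_lt_esize L).le

theorem level_mem_levelsBelow (names : List Name) {d j : ℕ} (h : j < d) :
    level names j ∈ levelsBelow names d := by
  induction d with
  | zero => omega
  | succ d ih =>
    rw [levelsBelow, List.mem_cons]
    rcases Nat.lt_succ_iff_lt_or_eq.1 h with h | rfl
    · exact Or.inr (ih h)
    · exact Or.inl rfl

/-- The states of the search. -/
abbrev SearchState : Type :=
  {x : Env × List (List Assignment) //
    ∃ d, x.2 = levelsBelow x.1.2.1 (d + 1) ∧ (x.1.2.1 = [] → d = 0)}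

/-- Trees of depth `j` have size of order `2 ^ j`. This is polynomial in the state, because the
state already lists the `(2 * |names|) ^ d ≥ 2 ^ j` assignments of `d` variables. The inequality
needs a name or `d = 0`, which is the second condition in `SearchState`. -/
theorem esize_foldl_nextTable_le (e : Env) (Ls : List (List Assignment)) (d : ℕ)
    (hL : Ls = levelsBelow e.2.1 (d + 1)) (hd : e.2.1 = [] → d = 0)
    (pre : List (List Assignment)) (hpre : pre <+: Ls.tail) :
    esize (pre.foldl (fun t L => nextTable e.2.1 t L) (baseTable e (Ls.headD []))) ≤
      esize (e, Ls) * (esize (e, Ls) + esize (e, Ls) * (14 * esize (e, Ls) + 47) + 4) + 1 := by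
  subst hL
  simp only [levelsBelow, List.tail_cons] at hpre
  obtain ⟨j, hj, rfl⟩ : ∃ j ≤ d, pre = (levelsBelow e.2.1 d).take j :=
    ⟨pre.length, by simpa [length_levelsBelow] using hpre.length_le, List.prefix_iff_eq_take.1 hpre⟩
  have h1 := foldl_nextTable e 0 d j hj
  simp only [levelsBelow, List.headD_cons]
  change esize (List.foldl _ (searchTable e 0 (level e.2.1 d)) _) ≤ _
  rw [h1, zero_add]
  refine (esize_searchTable_le _ _ _).trans ?_
  simp only [esize_prod]
  have h2 := esize_le_of_mem (level_mem_levelsBelow e.2.1 (show d - j < d + 1 by omega))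
  rw [levelsBelow] at h2
  have h3 : 2 ^ j ≤ esize (level e.2.1 d) := by
    refine (Nat.pow_le_pow_right (by norm_num) hj).trans ?_
    refine le_trans ?_ (length_lt_esize _).le
    rw [length_level]
    rcases Nat.eq_zero_or_pos e.2.1.length with h | h
    · rw [hd (List.length_eq_zero_iff.1 h)]
      rfl
    · exact Nat.pow_le_pow_left (by omega) d
  have h4 := esize_le_of_mem (level_mem_levelsBelow e.2.1 (show d < d + 1 by omega))
  rw [levelsBelow] at h4
  gcongr <;> omega

theorem PT.searchLevels : PT fun s : SearchState => searchLevels s.1.1 s.1.2 := by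
  refine PT.tableLookup (foldl (l := fun s : SearchState => s.1.2.tail)
    (init := fun s => _root_.baseTable s.1.1 (s.1.2.headD []))
    (step := fun s t L => _root_.nextTable s.1.1.2.1 t L)
    (B := fun s => esize s * (esize s + esize s * (14 * esize s + 47) + 4) + 1)
    (by fun_prop) (by fun_prop) (by fun_prop) ?_ ?_) (by fun_prop)
  · exact (PB.size.mul ((PB.size.add (PB.size.mul (((PB.const 14).mul PB.size).add
      (PB.const 47)))).add (PB.const 4))).add (PB.const 1)
  · intro s pre hpre
    obtain ⟨d, hL, hd⟩ := s.2
    exact esize_foldl_nextTable_le s.1.1 s.1.2 d hL hd pre hpre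

theorem PT.searchStep : PT fun s : SearchState => searchStep s.1.1 s.1.2 := by
  have := PT.searchLevels
  unfold _root_.searchStep
  fun_prop

end

/-! ### Acceptance and hitting probabilities of a randomized tree -/

section
open Finset

namespace RDT

variable {n : ℕ}

/-- The probability that a tree outputs `1`. -/
noncomputable def prob : RDT n → (Fin n → Bool) → ℝ
  | leaf b, _ => if b then 1 else 0
  | query i t₀ t₁, x => if x i then t₁.prob x else t₀.prob x
  | coin t₀ t₁, x => (t₀.prob x + t₁.prob x) / 2

/-- Surplus coins are ignored. Allowing them is needed for the induction, as the subtrees may use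
fewer coins than the whole tree. -/
theorem sum_eval_eq (R : RDT n) (x : Fin n → Bool) (m : ℕ) (hm : R.randomnessComplexity ≤ m) :
    ∑ r : Fin m → Bool, (if R.eval x (List.ofFn r) then (1 : ℝ) else 0) = 2 ^ m * R.prob x := by
  induction R generalizing m with
  | leaf b => cases b <;> simp [eval, prob]
  | query i t₀ t₁ ih₀ ih₁ =>
    simp only [randomnessComplexity, max_le_iff] at hm
    by_cases h : x i
    · simp [eval, prob, h, ih₁ m hm.2]
    · simp [eval, prob, h, ih₀ m hm.1]
  | coin t₀ t₁ ih₀ ih₁ =>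
    simp only [randomnessComplexity] at hm
    obtain ⟨m, rfl⟩ : ∃ m', m = m' + 1 := ⟨m - 1, by omega⟩
    have hc : ∀ (b : Bool) (r : Fin m → Bool),
        List.ofFn (Fin.consEquiv (fun _ => Bool) (b, r)) = b :: List.ofFn r := fun b r => by
      simp [Fin.consEquiv, List.ofFn_succ]
    rw [← (Fin.consEquiv fun _ => Bool).sum_comp, Fintype.sum_prod_type]
    simp only [hc, Fintype.sum_bool, eval, if_true, prob, Bool.false_eq_true, if_false]
    rw [ih₀ m (by omega), ih₁ m (by omega)]
    ring

theorem mean_eq_prob (R : RDT n) (x : Fin n → Bool) : R.mean x = R.prob x := by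
  rw [mean, sum_eval_eq R x _ le_rfl]
  field_simp

theorem prob_mem (R : RDT n) (x : Fin n → Bool) : 0 ≤ R.prob x ∧ R.prob x ≤ 1 := by
  induction R with
  | leaf b => cases b <;> simp [prob]
  | query i t₀ t₁ ih₀ ih₁ => rw [prob]; split_ifs <;> assumption
  | coin t₀ t₁ ih₀ ih₁ => rw [prob]; constructor <;> linarith

/-- The probability that a tree queries a variable in `S`. -/
noncomputable def hit : RDT n → (Fin n → Bool) → Finset (Fin n) → ℝ
  | leaf _, _, _ => 0
  | query i t₀ t₁, x, S => if i ∈ S then 1 else if x i then t₁.hit x S else t₀.hit x S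
  | coin t₀ t₁, x, S => (t₀.hit x S + t₁.hit x S) / 2

theorem hit_nonneg (R : RDT n) (x : Fin n → Bool) (S : Finset (Fin n)) : 0 ≤ R.hit x S := by
  induction R with
  | leaf b => exact le_rfl
  | query i t₀ t₁ ih₀ ih₁ => rw [hit]; split_ifs <;> first | assumption | exact zero_le_one
  | coin t₀ t₁ ih₀ ih₁ => rw [hit]; linarith

/-- Coupling: with the same coins the runs on `x` and on `y` agree until a variable in `S` is
queried. -/
theorem abs_prob_sub_le (R : RDT n) {x y : Fin n → Bool} {S : Finset (Fin n)}
    (h : ∀ i ∉ S, x i = y i) : |R.prob x - R.prob y| ≤ R.hit x S := by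
  induction R with
  | leaf b => simp [prob, hit]
  | query i t₀ t₁ ih₀ ih₁ =>
    by_cases hi : i ∈ S
    · have h1 := (query i t₀ t₁).prob_mem x
      have h2 := (query i t₀ t₁).prob_mem y
      rw [hit, if_pos hi, abs_le]
      constructor <;> linarith
    · rw [hit, if_neg hi, prob, prob, ← h i hi]
      split_ifs <;> assumption
  | coin t₀ t₁ ih₀ ih₁ =>
    rw [abs_le] at *
    rw [hit, prob, prob]
    constructor <;> linarith

/-- A query meets at most one of the disjoint blocks, so the expected number of blocks hit is at
most the number of queries. -/
theorem sum_hit_le (R : RDT n) (x : Fin n → Bool) (F : Finset (Finset (Fin n)))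
    (hF : (F : Set (Finset (Fin n))).PairwiseDisjoint id) :
    ∑ S ∈ F, R.hit x S ≤ R.queryComplexity := by
  induction R with
  | leaf b => simp [hit, queryComplexity]
  | query i t₀ t₁ ih₀ ih₁ =>
    have h1 : ∑ S ∈ F, (if i ∈ S then (1 : ℝ) else 0) ≤ 1 := by
      rw [Finset.sum_boole]
      norm_cast
      refine Finset.card_le_one.2 fun S hS T hT => ?_
      rw [Finset.mem_filter] at hS hT
      by_contra hST
      exact Finset.disjoint_left.1 (hF hS.1 hT.1 hST) hS.2 hT.2
    have h2 : ∀ S ∈ F, (query i t₀ t₁).hit x S ≤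
        (if i ∈ S then (1 : ℝ) else 0) + if x i then t₁.hit x S else t₀.hit x S := by
      intro S _
      have := t₀.hit_nonneg x S
      have := t₁.hit_nonneg x S
      rw [hit]
      split_ifs <;> linarith
    refine (Finset.sum_le_sum h2).trans ?_
    rw [Finset.sum_add_distrib, queryComplexity]
    push_cast
    have h3 := le_max_left (t₀.queryComplexity : ℝ) t₁.queryComplexity
    have h4 := le_max_right (t₀.queryComplexity : ℝ) t₁.queryComplexity
    split_ifs <;> linarith
  | coin t₀ t₁ ih₀ ih₁ =>
    simp only [hit]
    rw [← Finset.sum_div, Finset.sum_add_distrib, queryComplexity]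
    push_cast
    have h3 := le_max_left (t₀.queryComplexity : ℝ) t₁.queryComplexity
    have h4 := le_max_right (t₀.queryComplexity : ℝ) t₁.queryComplexity
    linarith

/-- The variables that a tree queries. -/
def vars : RDT n → Finset (Fin n)
  | leaf _ => ∅
  | query i t₀ t₁ => insert i (t₀.vars ∪ t₁.vars)
  | coin t₀ t₁ => t₀.vars ∪ t₁.vars

theorem prob_congr (R : RDT n) {x y : Fin n → Bool} (h : ∀ i ∈ R.vars, x i = y i) :
    R.prob x = R.prob y := by
  induction R with
  | leaf b => rfl
  | query i t₀ t₁ ih₀ ih₁ =>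
    simp only [vars, mem_insert, mem_union] at h
    rw [prob, prob, h i (Or.inl rfl), ih₀ fun i hi => h i (Or.inr (Or.inl hi)),
      ih₁ fun i hi => h i (Or.inr (Or.inr hi))]
  | coin t₀ t₁ ih₀ ih₁ =>
    simp only [vars, mem_union] at h
    rw [prob, prob, ih₀ fun i hi => h i (Or.inl hi), ih₁ fun i hi => h i (Or.inr hi)]

end RDT

/-- The point `x` with the coordinates in `S` flipped. -/
def flipAt {n : ℕ} (x : Fin n → Bool) (S : Finset (Fin n)) : Fin n → Bool :=
  fun i => if i ∈ S then !x i else x i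

theorem flipAt_filter_ne {n : ℕ} (x y : Fin n → Bool) (W : Finset (Fin n)) {i : Fin n}
    (hi : i ∈ W) : flipAt x (W.filter fun i => x i ≠ y i) i = y i := by
  by_cases h : x i = y i
  · simp [flipAt, h]
  · simp [flipAt, hi, Bool.eq_not_of_ne h]

/-- On the set `X` of inputs, some deterministic tree with at most `d` queries computes `f`. -/
def ComputableOn {n : ℕ} (f : (Fin n → Bool) → Bool) (X : Set (Fin n → Bool)) (d : ℕ) : Prop :=
  ∃ D : RDT n, D.IsDeterministic ∧ D.queryComplexity ≤ d ∧ ∀ x ∈ X, D.eval x [] = f x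

namespace ComputableOn

variable {n : ℕ} {f : (Fin n → Bool) → Bool} {X Y : Set (Fin n → Bool)} {d e : ℕ}

theorem mono (h : ComputableOn f X d) (hY : Y ⊆ X) (hd : d ≤ e) : ComputableOn f Y e :=
  let ⟨D, hD, hq, hX⟩ := h
  ⟨D, hD, hq.trans hd, fun x hx => hX x (hY hx)⟩

theorem const {b : Bool} (h : ∀ x ∈ X, f x = b) : ComputableOn f X d :=
  ⟨.leaf b, trivial, Nat.zero_le _, fun x hx => (h x hx).symm⟩

theorem query (i : Fin n) (h : ∀ b, ComputableOn f {x ∈ X | x i = b} d) :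
    ComputableOn f X (d + 1) := by
  obtain ⟨D₀, hD₀, hq₀, h₀⟩ := h false
  obtain ⟨D₁, hD₁, hq₁, h₁⟩ := h true
  refine ⟨.query i D₀ D₁, ⟨hD₀, hD₁⟩, by simp [RDT.queryComplexity, hq₀, hq₁], fun x hx => ?_⟩
  by_cases hi : x i = true
  · rw [RDT.eval, if_pos hi]; exact h₁ x ⟨hx, hi⟩
  · rw [RDT.eval, if_neg hi]; exact h₀ x ⟨hx, by simpa using hi⟩

theorem queryFinset (W : Finset (Fin n))
    (h : ∀ z : Fin n → Bool, ComputableOn f {x ∈ X | ∀ i ∈ W, x i = z i} d) :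
    ComputableOn f X (d + W.card) := by
  induction W using Finset.induction_on generalizing X with
  | empty => exact (h fun _ => false).mono (by simp) (by simp)
  | insert i W hi ih =>
    rw [Finset.card_insert_of_notMem hi, ← add_assoc]
    refine query i fun b => ih fun z => (h (Function.update z i b)).mono ?_ le_rfl
    rintro x ⟨⟨hx, hb⟩, hz⟩
    refine ⟨hx, fun j hj => ?_⟩
    rcases Finset.mem_insert.1 hj with rfl | hj
    · simpa using hb
    · rw [Function.update_of_ne (ne_of_mem_of_not_mem hj hi)]
      exact hz j hj

end ComputableOn

/-! ### Block sensitivity, certificates and Nisan's bound -/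

namespace RDT

variable {n : ℕ} {R : RDT n} {f : (Fin n → Bool) → Bool}

namespace ComputesWithBoundedError

theorem prob_of_true (h : R.ComputesWithBoundedError f) {x : Fin n → Bool} (hx : f x = true) :
    2 / 3 ≤ R.prob x := by
  rw [← mean_eq_prob]; exact ((h x).1 hx).1

theorem prob_of_false (h : R.ComputesWithBoundedError f) {x : Fin n → Bool} (hx : f x = false) :
    R.prob x ≤ 1 / 3 := by
  rw [← mean_eq_prob]; exact ((h x).2 hx).2

theorem le_abs_sub (h : R.ComputesWithBoundedError f) {x y : Fin n → Bool} (hxy : f x ≠ f y) :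
    1 / 3 ≤ |R.prob x - R.prob y| := by
  rw [le_abs]
  rcases hx : f x <;> rcases hy : f y
  · simp_all
  · have := h.prob_of_false hx
    have := h.prob_of_true hy
    right; linarith
  · have := h.prob_of_true hx
    have := h.prob_of_false hy
    left; linarith
  · simp_all

/-- The acceptance probability depends only on the variables in `R`, and it determines `f` by the
gap between 1/3 and 2/3. -/
theorem congr (h : R.ComputesWithBoundedError f) {x y : Fin n → Bool}
    (hxy : ∀ i ∈ R.vars, x i = y i) : f x = f y := by
  by_contra hne
  have := h.le_abs_sub hne
  rw [R.prob_congr hxy, sub_self, abs_zero] at this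
  norm_num at this

/-- The block sensitivity is at most three times the query complexity. -/
theorem card_le (h : R.ComputesWithBoundedError f) (x : Fin n → Bool)
    (F : Finset (Finset (Fin n))) (hF : (F : Set (Finset (Fin n))).PairwiseDisjoint id)
    (hs : ∀ S ∈ F, f (flipAt x S) ≠ f x) : F.card ≤ 3 * R.queryComplexity := by
  have h1 : ∀ S ∈ F, (1 / 3 : ℝ) ≤ R.hit x S := fun S hS =>
    (h.le_abs_sub (hs S hS).symm).trans (R.abs_prob_sub_le fun i hi => by simp [flipAt, hi])
  have h2 := (Finset.card_nsmul_le_sum F _ _ h1).trans (R.sum_hit_le x F hF)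
  rw [nsmul_eq_mul] at h2
  have : (F.card : ℝ) ≤ 3 * R.queryComplexity := by linarith
  exact_mod_cast this

/-- Every sensitive block contains one of at most `3 * q` variables. -/
theorem exists_block (h : R.ComputesWithBoundedError f) (x : Fin n → Bool)
    (B : Finset (Fin n)) (hB : f (flipAt x B) ≠ f x) :
    ∃ B' ⊆ B, B' ⊆ R.vars ∧ B'.card ≤ 3 * R.queryComplexity ∧ f (flipAt x B') ≠ f x := by
  obtain ⟨B', hB', hmin⟩ := Finset.exists_min_image
    (B.powerset.filter fun S => f (flipAt x S) ≠ f x) Finset.card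
    ⟨B, by simp [hB]⟩
  rw [Finset.mem_filter, Finset.mem_powerset] at hB'
  have hflip : ∀ i ∈ B', flipAt (flipAt x B') {i} = flipAt x (B'.erase i) := by
    intro i hi
    funext j
    by_cases hj : j = i
    · subst hj; simp [flipAt, hi]
    · simp [flipAt, hj]
  -- By minimality, flipping a variable of `B'` back restores the value at `x`. So the singletons in
  -- `B'` are disjoint sensitive blocks at the flipped point, and there are at most `3 * q` of them.
  have hs : ∀ i ∈ B', f (flipAt (flipAt x B') {i}) ≠ f (flipAt x B') := by
    intro i hi heq
    rw [hflip i hi] at heq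
    have := hmin (B'.erase i) (by
      rw [Finset.mem_filter, Finset.mem_powerset]
      exact ⟨(Finset.erase_subset _ _).trans hB'.1, heq ▸ hB'.2⟩)
    exact absurd this (not_le.2 (Finset.card_erase_lt_of_mem hi))
  refine ⟨B', hB'.1, fun i hi => ?_, ?_, hB'.2⟩
  · by_contra hv
    refine hs i hi (h.congr fun j hj => ?_)
    have : j ≠ i := by rintro rfl; exact hv hj
    simp [flipAt, this]
  · have := h.card_le (flipAt x B') (B'.image fun i => {i}) ?_ ?_
    · rwa [Finset.card_image_of_injective _ Finset.singleton_injective] at this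
    · intro S hS T hT hST
      simp only [Finset.coe_image, Set.mem_image] at hS hT
      obtain ⟨i, _, rfl⟩ := hS
      obtain ⟨j, _, rfl⟩ := hT
      exact Finset.disjoint_singleton.2 fun hij => hST (by rw [hij])
    · intro S hS
      obtain ⟨i, hi, rfl⟩ := Finset.mem_image.1 hS
      exact hs i hi

/-- Every input has a certificate of at most `9 * q ^ 2` variables. -/
theorem exists_certificate (h : R.ComputesWithBoundedError f) (y : Fin n → Bool) :
    ∃ W ⊆ R.vars, W.card ≤ 9 * R.queryComplexity ^ 2 ∧
      ∀ z : Fin n → Bool, (∀ i ∈ W, z i = y i) → f z = f y := by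
  classical
  -- The certificate is the union of a maximal disjoint family of small sensitive blocks. A point
  -- agreeing with `y` on it but with another value of `f` would give a further small block,
  -- disjoint from the family.
  obtain ⟨F, hF, hmax⟩ := Finset.exists_max_image
    (Finset.univ.filter fun F : Finset (Finset (Fin n)) =>
      (F : Set (Finset (Fin n))).PairwiseDisjoint id ∧ ∀ S ∈ F, S ⊆ R.vars ∧
        S.card ≤ 3 * R.queryComplexity ∧ f (flipAt y S) ≠ f y) Finset.card
    ⟨∅, by simp⟩
  simp only [Finset.mem_filter, Finset.mem_univ, true_and] at hF hmax
  refine ⟨F.biUnion id, Finset.biUnion_subset.2 fun S hS => (hF.2 S hS).1, ?_, fun z hz => ?_⟩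
  · refine (Finset.card_biUnion_le_card_mul F id _ fun S hS => (hF.2 S hS).2.1).trans ?_
    refine (Nat.mul_le_mul_right _ (h.card_le y F hF.1 fun S hS => (hF.2 S hS).2.2)).trans ?_
    exact le_of_eq (by ring)
  · by_contra hne
    have hz' : flipAt y (Finset.univ.filter fun i => y i ≠ z i) = z :=
      funext fun i => flipAt_filter_ne y z _ (Finset.mem_univ i)
    obtain ⟨B, hB, hBv, hBc, hBs⟩ := h.exists_block y _ (hz'.symm ▸ hne)
    have hdisj : ∀ S ∈ F, Disjoint B S := by
      intro S hS
      refine Finset.disjoint_left.2 fun i hi hiS => ?_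
      have := (Finset.mem_filter.1 (hB hi)).2
      exact this (hz i (Finset.mem_biUnion.2 ⟨S, hS, hiS⟩)).symm
    have hBF : B ∉ F := fun hmem => by
      have := hdisj B hmem
      rw [disjoint_self, Finset.bot_eq_empty] at this
      subst this
      exact hBs (congrArg f (funext fun i => by simp [flipAt]))
    have := hmax (insert B F) ⟨?_, ?_⟩
    · rw [Finset.card_insert_of_notMem hBF] at this
      omega
    · rw [Finset.coe_insert]
      exact hF.1.insert fun S hS _ => hdisj S hS
    · intro S hS
      rcases Finset.mem_insert.1 hS with rfl | hS
      · exact ⟨hBv, hBc, hBs⟩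
      · exact hF.2 S hS

/-- Flipping in `y` the places of `W` where it differs from `y'` makes the certificate `W` apply, so
these places form a sensitive block. It avoids `S`, where `y` and `y'` agree, and hence all blocks
in `F`. -/
theorem _root_.exists_insert_block (S W : Finset (Fin n)) {y y' : Fin n → Bool}
    (hyy' : ∀ i ∈ S, y i = y' i) (hfy : f y ≠ f y')
    (hW : ∀ x : Fin n → Bool, (∀ i ∈ W, x i = y' i) → f x = f y')
    (F : Finset (Finset (Fin n))) (hF : (F : Set (Finset (Fin n))).PairwiseDisjoint id)
    (hFs : ∀ B ∈ F, B ⊆ S ∧ f (flipAt y B) ≠ f y) :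
    ∃ F' : Finset (Finset (Fin n)), (F' : Set (Finset (Fin n))).PairwiseDisjoint id ∧
      (∀ B ∈ F', B ⊆ S ∪ W ∧ f (flipAt y B) ≠ f y) ∧ F'.card = F.card + 1 := by
  set B := W.filter fun i => y i ≠ y' i with hB
  have hBs : f (flipAt y B) ≠ f y := by
    rw [hW _ fun i hi => flipAt_filter_ne y y' W hi]
    exact hfy.symm
  have hBS : Disjoint B S := Finset.disjoint_left.2 fun i hi hiS =>
    (Finset.mem_filter.1 hi).2 (hyy' i hiS)
  have hdisj : ∀ C ∈ F, Disjoint B C := fun C hC => hBS.mono_right (hFs C hC).1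
  have hBF : B ∉ F := fun hmem => by
    have := hdisj B hmem
    rw [disjoint_self, Finset.bot_eq_empty] at this
    rw [this] at hBs
    exact hBs (congrArg f (funext fun i => by simp [flipAt]))
  refine ⟨insert B F, ?_, fun C hC => ?_, Finset.card_insert_of_notMem hBF⟩
  · rw [Finset.coe_insert]
    exact hF.insert fun C hC _ => hdisj C hC
  · rcases Finset.mem_insert.1 hC with rfl | hC
    · exact ⟨(Finset.filter_subset _ _).trans Finset.subset_union_right, hBs⟩
    · exact ⟨(hFs C hC).1.trans Finset.subset_union_left, (hFs C hC).2⟩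

/-- On a subcube on which every zero of `f` has `k` disjoint sensitive blocks of fixed variables,
`f` is computed by querying the variables of `j` certificates, where `j + k` bounds the block
sensitivity. -/
theorem computableOn (h : R.ComputesWithBoundedError f) (j k : ℕ)
    (hjk : 3 * R.queryComplexity ≤ j + k) (S : Finset (Fin n)) (hS : S ⊆ R.vars)
    (z : Fin n → Bool)
    (hk : ∀ y : Fin n → Bool, (∀ i ∈ S, y i = z i) → f y = false →
      ∃ F : Finset (Finset (Fin n)), (F : Set (Finset (Fin n))).PairwiseDisjoint id ∧
        (∀ B ∈ F, B ⊆ S ∧ f (flipAt y B) ≠ f y) ∧ F.card = k) :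
    ComputableOn f {x | ∀ i ∈ S, x i = z i}
      (min (9 * R.queryComplexity ^ 2 * j) (R.vars.card - S.card)) := by
  induction j generalizing k S z with
  | zero =>
    by_cases hall : ∀ y : Fin n → Bool, (∀ i ∈ S, y i = z i) → f y = false
    · exact ComputableOn.const hall
    push Not at hall
    obtain ⟨y', hy', hfy'⟩ := hall
    -- The subcube contains a one `y'`. A zero in it would acquire a block beyond its `k ≥ 3 * q`
    -- disjoint ones, so `f` is constantly `true` there.
    obtain ⟨W, -, -, hW⟩ := h.exists_certificate y'
    refine ComputableOn.const (b := true) fun y hy => ?_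
    by_contra hfy
    rw [Bool.not_eq_true] at hfy
    obtain ⟨F, hF, hFs, hFc⟩ := hk y hy hfy
    obtain ⟨F', hF', hFs', hFc'⟩ := exists_insert_block S W
      (fun i hi => (hy i hi).trans (hy' i hi).symm) (hfy ▸ hfy'.symm) hW F hF hFs
    have := h.card_le y F' hF' fun B hB => (hFs' B hB).2
    omega
  | succ j ih =>
    by_cases hall : ∀ y : Fin n → Bool, (∀ i ∈ S, y i = z i) → f y = false
    · exact ComputableOn.const hall
    push Not at hall
    obtain ⟨y', hy', hfy'⟩ := hall
    obtain ⟨W, hWv, hWc, hW⟩ := h.exists_certificate y'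
    have hSW : S ∪ W ⊆ R.vars := Finset.union_subset hS hWv
    have hc : (W \ S).card + S.card = (S ∪ W).card := by
      rw [Finset.union_comm, Finset.card_sdiff_add_card]
    -- Querying `W \ S` costs at most `9 * q ^ 2` and also uses up that many of the remaining
    -- variables, so both terms of the minimum pay for it.
    refine (ComputableOn.queryFinset (d := min (9 * R.queryComplexity ^ 2 * j)
      (R.vars.card - (S ∪ W).card)) (W \ S) fun z' => ?_).mono subset_rfl ?_
    · have := ih (k + 1) (by omega) (S ∪ W) hSW (fun i => if i ∈ S then z i else z' i) ?_
      · refine this.mono ?_ le_rfl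
        rintro x ⟨hx, hx'⟩ i hi
        by_cases hiS : i ∈ S
        · simp only [hiS, if_true]; exact hx i hiS
        · simp only [hiS, if_false]
          exact hx' i (Finset.mem_sdiff.2 ⟨(Finset.mem_union.1 hi).resolve_left hiS, hiS⟩)
      · intro y hy hfy
        have hyS : ∀ i ∈ S, y i = z i := fun i hi => by
          have := hy i (Finset.mem_union_left _ hi)
          rwa [if_pos hi] at this
        obtain ⟨F, hF, hFs, rfl⟩ := hk y hyS hfy
        exact exists_insert_block S W (fun i hi => (hyS i hi).trans (hy' i hi).symm)
          (hfy ▸ hfy'.symm) hW F hF hFs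
    · have h1 := Finset.card_le_card hSW
      have h2 := Finset.card_le_card (Finset.sdiff_subset : W \ S ⊆ W)
      rw [Nat.mul_succ]
      omega

theorem exists_deterministic (h : R.ComputesWithBoundedError f) :
    ∃ D : RDT n, D.ComputesExactly f ∧ D.queryComplexity ≤ 27 * R.queryComplexity ^ 3 ∧
      D.queryComplexity ≤ R.vars.card := by
  obtain ⟨D, hD, hq, hf⟩ := h.computableOn (3 * R.queryComplexity) 0 (by omega) ∅ (by simp)
    (fun _ => false) fun y _ _ => ⟨∅, by simp⟩
  rw [le_min_iff] at hq
  exact ⟨D, ⟨hD, fun x => hf x (by simp)⟩, hq.1.trans (le_of_eq (by ring)), by simpa using hq.2⟩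

theorem minDeterministicQueries_le (h : R.ComputesWithBoundedError f) :
    minDeterministicQueries f ≤ 27 * R.queryComplexity ^ 3 ∧
      minDeterministicQueries f ≤ R.vars.card := by
  obtain ⟨D, hD, h1, h2⟩ := h.exists_deterministic
  have : minDeterministicQueries f ≤ D.queryComplexity := Nat.sInf_le ⟨D, hD, rfl⟩
  omega

theorem exists_minimal (h : R.ComputesWithBoundedError f) :
    ∃ D : RDT n, D.ComputesExactly f ∧ D.queryComplexity = minDeterministicQueries f := by
  obtain ⟨D, hD, -⟩ := h.exists_deterministic
  exact Nat.sInf_mem (s := {q' | ∃ D : RDT n, D.ComputesExactly f ∧ D.queryComplexity = q'})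
    ⟨_, D, hD, rfl⟩

end ComputesWithBoundedError

end RDT

end

/-! ### Assignments, tokens and the evaluation of `f` -/

section
open Function

namespace Assignment

theorem value_nil (d : Bool) (i : Name) : value d [] i = d := rfl

theorem value_cons (d : Bool) (e : Name × Bool) (p : Assignment) (i : Name) :
    value d (e :: p) i = value (if e.1 = i then e.2 else d) p i := rfl

theorem value_append (d : Bool) (p q : Assignment) (i : Name) :
    value d (p ++ q) i = value (value d p i) q i := List.foldl_append

theorem value_cases (p : Assignment) (i : Name) :
    (∃ c, ∀ d, value d p i = c) ∨ ∀ d, value d p i = d := by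
  induction p with
  | nil => exact Or.inr fun d => rfl
  | cons e p ih =>
    rcases ih with ⟨c, hc⟩ | h
    · exact Or.inl ⟨c, fun d => by rw [value_cons, hc]⟩
    · by_cases he : e.1 = i
      · exact Or.inl ⟨e.2, fun d => by rw [value_cons, if_pos he, h]⟩
      · exact Or.inr fun d => by rw [value_cons, if_neg he, h]

theorem value_value (d : Bool) (p : Assignment) (i : Name) :
    value (value d p i) p i = value d p i := by
  rcases value_cases p i with ⟨c, hc⟩ | h
  · rw [hc, hc]
  · rw [h]

end Assignment

/-- The name of a variable. -/
def varName {n : ℕ} (i : Fin n) : Name := (Nat.bits i).reverse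

theorem varName_injective {n : ℕ} : Injective (varName (n := n)) := by
  intro i j h
  have h : Nat.bits i = Nat.bits j := List.reverse_injective h
  refine Fin.ext (Nat.eq_of_testBit_eq fun k => ?_)
  rw [Nat.testBit_eq_inth, Nat.testBit_eq_inth, h]

/-- The point that an assignment describes. -/
def Assignment.point {n : ℕ} (p : Assignment) (i : Fin n) : Bool := p.value false (varName i)

namespace RDT

variable {n : ℕ}

/-- The nodes in reverse preorder. -/
def tokens : RDT n → List Token
  | leaf b => [(.leaf b, [])]
  | query i t₀ t₁ => t₁.tokens ++ (t₀.tokens ++ [(.query, varName i)])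
  | coin t₀ t₁ => t₁.tokens ++ (t₀.tokens ++ [(.coin, [])])

theorem foldl_bits (l : List Bool) (acc : List Token × Name) :
    (l.map TreeSymbol.bit).foldl (fun acc c => tokenStep c acc) acc =
      (acc.1, l.reverse ++ acc.2) := by
  induction l generalizing acc with
  | nil => rfl
  | cons b l ih =>
    rw [List.map_cons, List.foldl_cons, ih]
    simp [tokenStep]

/-- The accumulated name is empty again after each complete subtree, which lets the runs over the
two subtrees be chained. -/
theorem foldl_describe (R : RDT n) (acc : List Token) :
    R.describe.foldl (fun acc c => tokenStep c acc) (acc, []) = (R.tokens ++ acc, []) := by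
  induction R generalizing acc with
  | leaf b => rfl
  | query i t₀ t₁ ih₀ ih₁ =>
    rw [describe, List.foldl_cons, List.foldl_append, foldl_bits, List.foldl_cons,
      List.foldl_append]
    change List.foldl _ (List.foldl _ ((.query, (Nat.bits i).reverse ++ []) :: acc, []) _) _ = _
    rw [ih₀, ih₁]
    simp [tokens, varName]
  | coin t₀ t₁ ih₀ ih₁ =>
    rw [describe, List.foldl_cons, List.foldl_append]
    change List.foldl _ (List.foldl _ ((.coin, []) :: acc, []) _) _ = _
    rw [ih₀, ih₁]
    simp [tokens]

theorem tokenize_describe (R : RDT n) : tokenize R.describe = R.tokens := by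
  rw [tokenize, foldl_describe, List.append_nil]

/-- In reverse preorder both subtrees precede their root, the right one first. When the root is met,
the value of `t₀` is on top of the stack and that of `t₁` below it. -/
theorem foldl_queryStep (R : RDT n) (st : List ℕ) :
    R.tokens.foldl (fun st t => queryStep t.1 st) st = R.queryComplexity :: st := by
  induction R generalizing st with
  | leaf b => rfl
  | query i t₀ t₁ ih₀ ih₁ =>
    simp only [tokens, List.foldl_append, List.foldl_cons, List.foldl_nil, ih₀, ih₁]
    simp [queryStep, queryComplexity]
  | coin t₀ t₁ ih₀ ih₁ =>
    simp only [tokens, List.foldl_append, List.foldl_cons, List.foldl_nil, ih₀, ih₁]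
    simp [queryStep, queryComplexity]

theorem queryTokens_tokens (R : RDT n) : queryTokens R.tokens = R.queryComplexity := by
  rw [queryTokens, foldl_queryStep, List.headD_cons]

/-- The approximate mean, multiplied by `U`. -/
def approx (U : ℕ) (x : Fin n → Bool) : RDT n → ℕ
  | leaf b => if b then U else 0
  | query i t₀ t₁ => if x i then t₁.approx U x else t₀.approx U x
  | coin t₀ t₁ => (t₀.approx U x + t₁.approx U x) / 2

theorem foldl_evalStep (R : RDT n) (U : ℕ) (p : Assignment) (st : List ℕ) :
    R.tokens.foldl (fun st t => evalStep U p t.1 t.2 st) st = R.approx U p.point :: st := by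
  induction R generalizing st with
  | leaf b => rfl
  | query i t₀ t₁ ih₀ ih₁ =>
    simp only [tokens, List.foldl_append, List.foldl_cons, List.foldl_nil, ih₀, ih₁]
    simp [evalStep, approx, Assignment.point]
    congr
  | coin t₀ t₁ ih₀ ih₁ =>
    simp only [tokens, List.foldl_append, List.foldl_cons, List.foldl_nil, ih₀, ih₁]
    simp [evalStep, approx]

/-- Each rounding loses at most 1/2 and averaging does not amplify earlier losses, so the loss is at
most the number of coins on a path. -/
theorem approx_le (R : RDT n) (U : ℕ) (x : Fin n → Bool) :
    (R.approx U x : ℝ) ≤ U * R.prob x ∧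
      U * R.prob x ≤ R.approx U x + R.randomnessComplexity := by
  induction R with
  | leaf b => cases b <;> simp [approx, prob, randomnessComplexity]
  | query i t₀ t₁ ih₀ ih₁ =>
    rw [approx, prob, randomnessComplexity]
    push_cast
    have h1 := le_max_left (t₀.randomnessComplexity : ℝ) t₁.randomnessComplexity
    have h2 := le_max_right (t₀.randomnessComplexity : ℝ) t₁.randomnessComplexity
    split_ifs
    · exact ⟨ih₁.1, by linarith⟩
    · exact ⟨ih₀.1, by linarith⟩
  | coin t₀ t₁ ih₀ ih₁ =>
    rw [approx, prob, randomnessComplexity]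
    have h1 := le_max_left (t₀.randomnessComplexity : ℝ) t₁.randomnessComplexity
    have h2 := le_max_right (t₀.randomnessComplexity : ℝ) t₁.randomnessComplexity
    have h3 : 2 * ((t₀.approx U x + t₁.approx U x) / 2) ≤ t₀.approx U x + t₁.approx U x := by
      omega
    have h4 : t₀.approx U x + t₁.approx U x ≤ 2 * ((t₀.approx U x + t₁.approx U x) / 2) + 1 := by
      omega
    have h3' : (2 : ℝ) * ((t₀.approx U x + t₁.approx U x) / 2 : ℕ) ≤
      t₀.approx U x + t₁.approx U x := by exact_mod_cast h3
    have h4' : (t₀.approx U x + t₁.approx U x : ℝ) ≤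
      2 * ((t₀.approx U x + t₁.approx U x) / 2 : ℕ) + 1 := by exact_mod_cast h4
    push_cast
    constructor <;> linarith

theorem randomnessComplexity_lt (R : RDT n) : R.randomnessComplexity < R.tokens.length := by
  induction R with
  | leaf b => simp [randomnessComplexity, tokens]
  | query i t₀ t₁ ih₀ ih₁ => simp [randomnessComplexity, tokens]; omega
  | coin t₀ t₁ ih₀ ih₁ => simp [randomnessComplexity, tokens]; omega

theorem mem_tokens_query (R : RDT n) (i : Name) :
    (.query, i) ∈ R.tokens ↔ ∃ j ∈ R.vars, varName j = i := by
  induction R with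
  | leaf b => simp [tokens, vars]
  | query j t₀ t₁ ih₀ ih₁ =>
    simp only [tokens, vars, List.mem_append, ih₀, ih₁, Finset.mem_insert, Finset.mem_union,
      List.mem_singleton, Prod.mk.injEq, true_and, or_and_right, exists_or, exists_eq_left]
    grind
  | coin t₀ t₁ ih₀ ih₁ =>
    simp only [tokens, vars, List.mem_append, ih₀, ih₁, Finset.mem_union, List.mem_singleton,
      Prod.mk.injEq, reduceCtorEq, false_and, or_false, or_and_right, exists_or]
    grind

end RDT

theorem namesOf_spec (ts : List Token) (acc : List Name) (hacc : acc.Nodup) :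
    (ts.foldl (fun acc t => if t.1 = .query ∧ (acc.all fun i => !decide (t.2 = i)) = true
      then t.2 :: acc else acc) acc).Nodup ∧
    ∀ i, i ∈ ts.foldl (fun acc t => if t.1 = .query ∧ (acc.all fun i => !decide (t.2 = i)) = true
      then t.2 :: acc else acc) acc ↔ (TreeSymbol.query, i) ∈ ts ∨ i ∈ acc := by
  induction ts generalizing acc with
  | nil => simpa using hacc
  | cons t ts ih =>
    rw [List.foldl_cons]
    obtain ⟨c, j⟩ := t
    have hall : ((acc.all fun i => !decide (j = i)) = true) ↔ j ∉ acc := by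
      simp only [List.all_eq_true, Bool.not_eq_true', decide_eq_false_iff_not]
      exact ⟨fun h hj => h j hj rfl, fun h x hx hxj => h (hxj ▸ hx)⟩
    simp only [hall]
    split_ifs with h
    · obtain ⟨h1, h2⟩ := ih (j :: acc) (List.nodup_cons.2 ⟨h.2, hacc⟩)
      refine ⟨h1, fun i => ?_⟩
      rw [h2, List.mem_cons, List.mem_cons, h.1]
      simp only [Prod.mk.injEq, true_and]
      tauto
    · obtain ⟨h1, h2⟩ := ih acc hacc
      refine ⟨h1, fun i => ?_⟩
      rw [h2, List.mem_cons]
      constructor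
      · tauto
      · rintro ((heq | hi) | hi)
        · obtain ⟨rfl, rfl⟩ := Prod.mk.inj heq
          exact Or.inr (by_contra fun hn => h ⟨rfl, hn⟩)
        · exact Or.inl hi
        · exact Or.inr hi

theorem nodup_namesOf (ts : List Token) : (namesOf ts).Nodup :=
  (namesOf_spec ts [] List.nodup_nil).1

theorem mem_namesOf {ts : List Token} {i : Name} :
    i ∈ namesOf ts ↔ (TreeSymbol.query, i) ∈ ts :=
  ((namesOf_spec ts [] List.nodup_nil).2 i).trans (by simp)

/-- Since `[]` is adjoined in every round, lists shorter than `k` are produced as well. -/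
theorem mem_iterate_expandPoints (names : List Name) (l : List Name) (hl : ∀ i ∈ l, i ∈ names)
    (k : ℕ) (hk : l.length ≤ k) :
    l.map (fun i => (i, true)) ∈ (expandPoints names)^[k] [[]] := by
  induction l generalizing k with
  | nil =>
    cases k with
    | zero => simp
    | succ k => rw [iterate_succ_apply']; exact List.mem_cons_self
  | cons i l ih =>
    obtain ⟨k, rfl⟩ : ∃ k', k = k' + 1 := ⟨k - 1, by simp at hk; omega⟩
    rw [iterate_succ_apply']
    refine List.mem_cons_of_mem _ (List.mem_flatMap.2 ⟨i, hl i List.mem_cons_self,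
      List.mem_map.2 ⟨_, ih (fun j hj => hl j (List.mem_cons_of_mem _ hj)) k
        (by simpa using hk), rfl⟩⟩)

/-! ### Correctness and minimality of the search -/

namespace RDT

variable {n : ℕ} {R : RDT n} {f : (Fin n → Bool) → Bool}

theorem mem_namesOf_tokens {i : Name} :
    i ∈ namesOf R.tokens ↔ ∃ j ∈ R.vars, varName j = i := by
  rw [mem_namesOf, mem_tokens_query]

theorem length_namesOf_tokens (R : RDT n) : (namesOf R.tokens).length = R.vars.card := by
  rw [← List.toFinset_card_of_nodup (nodup_namesOf _),
    ← Finset.card_image_of_injective R.vars varName_injective]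
  congr 1
  ext i
  rw [List.mem_toFinset, mem_namesOf_tokens, Finset.mem_image]

/-- The input of the search. -/
def env (R : RDT n) : Env :=
  ((R.tokens, 8 * R.tokens.length), namesOf R.tokens,
    (expandPoints (namesOf R.tokens))^[3 * R.queryComplexity] [[]])

namespace ComputesWithBoundedError

/-- The rounding loss is below `tokens.length = U / 8`, less than the gap `U / 6` between `2U / 3`
and the threshold `U / 2`. In the other case rounding down only helps. -/
theorem decideTokens_eq (h : R.ComputesWithBoundedError f) (p : Assignment) :
    decideTokens R.tokens (8 * R.tokens.length) p = f p.point := by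
  rw [decideTokens, evalTokens, foldl_evalStep, List.headD_cons]
  obtain ⟨h1, h2⟩ := R.approx_le (8 * R.tokens.length) p.point
  have h3 : (R.randomnessComplexity : ℝ) + 1 ≤ R.tokens.length := by
    exact_mod_cast R.randomnessComplexity_lt
  have h4 : (0 : ℝ) ≤ R.randomnessComplexity := Nat.cast_nonneg _
  push_cast at h1 h2
  rcases hf : f p.point
  · have h5 := h.prob_of_false hf
    rw [decide_eq_false_iff_not, not_lt]
    have : (2 * R.approx (8 * R.tokens.length) p.point : ℝ) ≤ 8 * R.tokens.length := by
      nlinarith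
    exact_mod_cast this
  · have h5 := h.prob_of_true hf
    rw [decide_eq_true_iff]
    have : (8 * R.tokens.length : ℝ) < 2 * R.approx (8 * R.tokens.length) p.point := by
      nlinarith
    exact_mod_cast this

end ComputesWithBoundedError

/-- The point `x` extends the assignment `ρ`, on the variables of `R`. -/
def Extends (R : RDT n) (ρ : Assignment) (x : Fin n → Bool) : Prop :=
  ∀ i ∈ R.vars, ρ.value (x i) (varName i) = x i

/-- Entries of `ρ` override the new one, so querying a variable that is already set does no harm. -/
theorem Extends.cons {ρ : Assignment} {x : Fin n → Bool} (h : R.Extends ρ x) (i : Fin n) :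
    R.Extends ((varName i, x i) :: ρ) x := by
  intro j hj
  rw [Assignment.value_cons]
  split_ifs with hij
  · obtain rfl := varName_injective hij
    exact h i hj
  · exact h j hj

theorem Extends.of_cons {ρ : Assignment} {x : Fin n → Bool} {e : Name × Bool}
    (h : R.Extends (e :: ρ) x) : R.Extends ρ x := by
  intro j hj
  have := h j hj
  rw [Assignment.value_cons] at this
  rw [← this, Assignment.value_value]

theorem Extends.apply {ρ : Assignment} {x : Fin n → Bool} {i : Fin n} {b : Bool} (hi : i ∈ R.vars)
    (h : R.Extends ((varName i, b) :: ρ) x) : x i = ρ.value b (varName i) := by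
  have := h i hi
  rwa [Assignment.value_cons, if_pos rfl, eq_comm] at this

namespace ComputesWithBoundedError

/-- If `f` took another value on the subcube, `ρ.point` would have a sensitive block of at most `3 *
q` free variables. Free variables are `false` at `ρ.point`, so flipping the block means setting it
to `true`, and the resulting point is among those tested. -/
theorem constantLeaf_sound (h : R.ComputesWithBoundedError f) {ρ : Assignment}
    {t : List TreeSymbol} (ht : t ∈ constantLeaf R.env ρ) :
    t = [.leaf (f ρ.point)] ∧ ∀ x, R.Extends ρ x → f x = f ρ.point := by
  simp only [constantLeaf, env, h.decideTokens_eq] at ht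
  split_ifs at ht with hall
  swap
  · simp at ht
  refine ⟨by simpa using ht, fun x hx => ?_⟩
  by_contra hne
  set y : Fin n → Bool := ρ.point with hy
  have hA : f (flipAt y (R.vars.filter fun i => y i ≠ x i)) = f x :=
    h.congr fun i hi => flipAt_filter_ne y x _ hi
  obtain ⟨B, hBA, hBv, hBc, hBs⟩ := h.exists_block y _ (hA.symm ▸ hne)
  refine hBs ?_
  have hmem := mem_iterate_expandPoints (namesOf R.tokens) (B.toList.map varName) (by
    intro i hi
    obtain ⟨j, hj, rfl⟩ := List.mem_map.1 hi
    exact mem_namesOf_tokens.2 ⟨j, hBv (Finset.mem_toList.1 hj), rfl⟩) (3 * R.queryComplexity)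
    (by simpa using hBc)
  have := of_decide_eq_true (List.all_eq_true.1 hall _ hmem)
  rw [← this]
  refine h.congr fun i hi => ?_
  have hval : ∀ (l : List (Fin n)) (d : Bool), Assignment.value d
      ((l.map varName).map fun i => (i, true)) (varName i) = (decide (i ∈ l) || d) := by
    intro l
    induction l with
    | nil => simp [Assignment.value_nil]
    | cons j l ih =>
      intro d
      rw [List.map_cons, List.map_cons, Assignment.value_cons, ih]
      by_cases hij : j = i
      · subst hij; simp
      · simp [varName_injective.ne hij, Ne.symm hij]
  rw [Assignment.point, Assignment.value_append, hval]
  by_cases hiB : i ∈ B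
  · have hne' := (Finset.mem_filter.1 (hBA hiB)).2
    have hx' := hx i hi
    simp only [flipAt, hiB, if_true, Finset.mem_toList, decide_true, Bool.true_or]
    -- A variable in the block cannot be set by `ρ`, since both `x` and `y` extend `ρ` but differ
    -- there.
    rcases Assignment.value_cases ρ (varName i) with ⟨c, hc⟩ | hid
    · refine absurd ?_ hne'
      rw [← hx', hc, hy, Assignment.point, hc]
    · rw [hid, hy, Assignment.point, hid]; rfl
  · simp [flipAt, hiB, hy, Assignment.point]

theorem constantLeaf_ne_nil (h : R.ComputesWithBoundedError f) {ρ : Assignment} {b : Bool}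
    (hb : ∀ x, R.Extends ρ x → (∀ i ∉ R.vars, x i = false) → f x = b) :
    constantLeaf R.env ρ ≠ [] := by
  have key : ∀ t : Assignment, f (t ++ ρ).point = b := by
    intro t
    -- The hypothesis concerns only points that vanish outside `R.vars`; moving to such a point does
    -- not change `f`.
    rw [h.congr (y := fun i => if i ∈ R.vars then (t ++ ρ).point i else false)
      fun i hi => by rw [if_pos hi]]
    refine hb _ (fun i hi => ?_) fun i hi => by simp [hi]
    rw [if_pos hi, Assignment.point, Assignment.value_append, Assignment.value_value]
  simp only [constantLeaf, env, h.decideTokens_eq]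
  rw [if_pos]
  · simp
  · rw [List.all_eq_true]
    intro t _
    rw [key t, ← List.nil_append ρ, key []]
    simp

theorem search_sound (h : R.ComputesWithBoundedError f) (k : ℕ) (ρ : Assignment)
    (t : List TreeSymbol) (ht : t ∈ search R.env k ρ) :
    ∃ D : RDT n, D.describe = t ∧ D.IsDeterministic ∧ D.queryComplexity ≤ k ∧
      ∀ x, R.Extends ρ x → D.eval x [] = f x := by
  induction k generalizing ρ t with
  | zero =>
    obtain ⟨rfl, hx⟩ := h.constantLeaf_sound ht
    exact ⟨.leaf _, rfl, trivial, le_rfl, fun x hx' => (hx x hx').symm⟩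
  | succ k ih =>
    have := List.mem_of_mem_take ht
    simp only [List.mem_flatMap, List.mem_map] at this
    obtain ⟨i, hi, t₀, ht₀, t₁, ht₁, rfl⟩ := this
    obtain ⟨j, hj, rfl⟩ := mem_namesOf_tokens.1 hi
    obtain ⟨D₀, rfl, hD₀, hq₀, he₀⟩ := ih _ _ ht₀
    obtain ⟨D₁, rfl, hD₁, hq₁, he₁⟩ := ih _ _ ht₁
    refine ⟨.query j D₀ D₁, ?_, ⟨hD₀, hD₁⟩, by simp [queryComplexity, hq₀, hq₁], fun x hx => ?_⟩
    · simp [describe, describeNode, varName]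
    · have := hx.cons j
      rw [eval]
      split_ifs with hxj
      · exact he₁ x (hxj ▸ this)
      · exact he₀ x ((Bool.not_eq_true _ ▸ hxj : x j = false) ▸ this)

theorem combine_ne_nil {names : List Name} {g : Assignment → List (List TreeSymbol)}
    {ρ : Assignment} {i : Name} (hi : i ∈ names) (h₀ : g ((i, false) :: ρ) ≠ [])
    (h₁ : g ((i, true) :: ρ) ≠ []) : combine names g ρ ≠ [] := by
  rw [combine, Ne, List.take_eq_nil_iff, List.flatMap_eq_nil_iff]
  rintro (h | h)
  · exact one_ne_zero h
  · have := h i hi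
    rw [List.flatMap_eq_nil_iff] at this
    obtain ⟨t, ht⟩ := List.exists_mem_of_ne_nil _ h₀
    exact h₁ (List.map_eq_nil_iff.1 (this t ht))

/-- The search puts all leaves at depth exactly `k`. Where fewer queries would do, the tree is
padded with arbitrary queries, and for this some variable must exist. -/
theorem search_ne_nil_of_constant (h : R.ComputesWithBoundedError f)
    (hR : namesOf R.tokens ≠ []) (k : ℕ) {ρ : Assignment} {b : Bool}
    (hb : ∀ x, R.Extends ρ x → (∀ i ∉ R.vars, x i = false) → f x = b) :
    search R.env k ρ ≠ [] := by
  induction k generalizing ρ with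
  | zero => exact h.constantLeaf_ne_nil hb
  | succ k ih =>
    obtain ⟨i, hi⟩ := List.exists_mem_of_ne_nil _ hR
    exact combine_ne_nil hi (ih fun x hx => hb x hx.of_cons) (ih fun x hx => hb x hx.of_cons)

/-- The search imitates `D`. As `D` may query variables absent from `R`, only points that vanish
there are considered; at such a node the search simply follows `t₀`. -/
theorem search_ne_nil (h : R.ComputesWithBoundedError f) (hR : namesOf R.tokens ≠ [])
    (D : RDT n) (hD : D.IsDeterministic) (k : ℕ) (hk : D.queryComplexity ≤ k) (ρ : Assignment)
    (hf : ∀ x, R.Extends ρ x → (∀ i ∉ R.vars, x i = false) → D.eval x [] = f x) :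
    search R.env k ρ ≠ [] := by
  induction D generalizing k ρ with
  | leaf b => exact h.search_ne_nil_of_constant hR k fun x hx hx' => (hf x hx hx').symm
  | query i t₀ t₁ ih₀ ih₁ =>
    rw [queryComplexity] at hk
    by_cases hi : i ∈ R.vars
    · obtain ⟨k, rfl⟩ : ∃ k', k = k' + 1 := ⟨k - 1, by omega⟩
      have key : ∀ b, search R.env k ((varName i, b) :: ρ) ≠ [] := by
        intro b
        -- If `ρ` already sets the variable, both values of `b` lead to the same subtree of `D`.
        rcases hb : ρ.value b (varName i)
        · refine ih₀ hD.1 k (by omega) _ fun x hx hx' => ?_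
          have hxi := hx.apply hi
          rw [← hf x hx.of_cons hx', eval, if_neg (by rw [hxi, hb]; simp)]
        · refine ih₁ hD.2 k (by omega) _ fun x hx hx' => ?_
          have hxi := hx.apply hi
          rw [← hf x hx.of_cons hx', eval, if_pos (by rw [hxi, hb])]
      exact combine_ne_nil (mem_namesOf_tokens.2 ⟨i, hi, rfl⟩) (key false) (key true)
    · refine ih₀ hD.1 k (by omega) ρ fun x hx hx' => ?_
      rw [← hf x hx hx', eval, if_neg (by rw [hx' i hi]; simp)]
  | coin t₀ t₁ ih₀ ih₁ => exact hD.elim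

/-- The first successful search finds a deterministic tree of minimal query complexity. -/
theorem exists_first_search (h : R.ComputesWithBoundedError f) :
    ∃ (d : ℕ) (D : RDT n), D.ComputesExactly f ∧
      D.queryComplexity = minDeterministicQueries f ∧ search R.env d [] = [D.describe] ∧
      (∀ d' < d, search R.env d' [] = []) ∧ (namesOf R.tokens = [] → d = 0) ∧
      d ≤ 27 * R.queryComplexity ^ 3 ∧ d ≤ R.vars.card := by
  classical
  have hex : ∃ d, search R.env d [] ≠ [] ∧ d ≤ minDeterministicQueries f ∧
      (namesOf R.tokens = [] → d = 0) := by
    -- Without variables `f` is constant and depth 0 succeeds; no padding is possible in this case.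
    by_cases hR : namesOf R.tokens = []
    · refine ⟨0, h.constantLeaf_ne_nil (b := f fun _ => false) fun x _ _ => h.congr fun i hi => ?_,
        Nat.zero_le _, fun _ => rfl⟩
      have := mem_namesOf_tokens.2 ⟨i, hi, rfl⟩
      rw [hR] at this
      simp at this
    · obtain ⟨D, hD, hq⟩ := h.exists_minimal
      exact ⟨_, h.search_ne_nil hR D hD.1 _ hq.le [] fun x _ _ => hD.2 x, le_rfl,
        fun h' => absurd h' hR⟩
  obtain ⟨d₀, hd₀, hd₀', hd₀''⟩ := hex
  have hex' : ∃ d, search R.env d [] ≠ [] := ⟨d₀, hd₀⟩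
  have hle : Nat.find hex' ≤ d₀ := Nat.find_min' hex' hd₀
  obtain ⟨t, ht⟩ := List.exists_mem_of_ne_nil _ (Nat.find_spec hex')
  obtain ⟨D, rfl, hD, hq, he⟩ := h.search_sound _ _ _ ht
  have hDf : D.ComputesExactly f := ⟨hD, fun x => he x fun i _ => rfl⟩
  -- The tree found has at most as many queries as the first successful depth, which is at most the
  -- minimum; so all three agree.
  have hmin : minDeterministicQueries f ≤ D.queryComplexity := Nat.sInf_le ⟨D, hDf, rfl⟩
  obtain ⟨hb1, hb2⟩ := h.minDeterministicQueries_le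
  refine ⟨Nat.find hex', D, hDf, by omega, ?_, fun d' hd' => by simpa using Nat.find_min hex' hd',
    fun hn => by have := hd₀'' hn; omega, by omega, by omega⟩
  have hlen := length_search_le R.env (Nat.find hex') []
  rcases hs : search R.env (Nat.find hex') [] with _ | ⟨a, _ | ⟨b, l⟩⟩
  · exact absurd hs (Nat.find_spec hex')
  · rw [hs] at ht
    rw [List.mem_singleton.1 ht]
  · rw [hs] at hlen
    simp at hlen

end ComputesWithBoundedError

end RDT

end

/-! ### Sizes of the states of the two outer loops -/

section
open Turing Function Enc

theorem esize_symbols_le (s : List TreeSymbol) : esize s ≤ 14 * s.length + 1 := by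
  have := esize_list_le s 13 fun a _ => esize_symbol_le a
  omega

theorem length_iterate_expandPoints_le (names : List Name) (k : ℕ) :
    ((expandPoints names)^[k] [[]]).length ≤ (k + 1) * max 1 names.length ^ k := by
  induction k with
  | zero => simp
  | succ k ih =>
    have h1 : 1 ≤ max 1 names.length := le_max_left _ _
    have h2 : ((expandPoints names)^[k + 1] [[]]).length =
        names.length * ((expandPoints names)^[k] [[]]).length + 1 := by
      rw [iterate_succ_apply', expandPoints]
      simp [List.length_flatMap]
    have h3 := Nat.mul_le_mul (le_max_right 1 names.length) ih
    have h4 := Nat.one_le_pow (k + 1) _ h1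
    calc _ ≤ max 1 names.length * ((k + 1) * max 1 names.length ^ k) +
          max 1 names.length ^ (k + 1) := by omega
      _ = _ := by ring

theorem esize_mem_iterate_expandPoints_le (names : List Name) (k : ℕ) :
    ∀ t ∈ (expandPoints names)^[k] [[]], esize t ≤ k * (esize names + 5) + 1 := by
  induction k with
  | zero =>
    intro t ht
    obtain rfl := List.mem_singleton.1 ht
    simp [esize_nil]
  | succ k ih =>
    intro t ht
    rw [iterate_succ_apply', expandPoints, List.mem_cons] at ht
    rcases ht with rfl | ht
    · rw [esize_nil]; omega
    · simp only [List.mem_flatMap, List.mem_map] at ht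
      obtain ⟨i, hi, t, ht, rfl⟩ := ht
      have := ih t ht
      have := esize_le_of_mem hi
      have := esize_bool_le true
      rw [esize_cons, esize_prod, Nat.succ_mul]
      dsimp only
      omega

theorem esize_iterate_expandPoints_le (names : List Name) (k : ℕ) :
    esize ((expandPoints names)^[k] [[]]) ≤
      (k + 1) * max 1 names.length ^ k * (k * (esize names + 5) + 2) + 1 :=
  (esize_list_le _ _ (esize_mem_iterate_expandPoints_le names k)).trans
    (by gcongr; exact length_iterate_expandPoints_le names k)

theorem esize_mem_level_le (names : List Name) (d : ℕ) :
    ∀ ρ ∈ level names d, esize ρ ≤ d * (esize names + 5) + 1 := by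
  induction d with
  | zero =>
    intro t ht
    obtain rfl := List.mem_singleton.1 ht
    simp [esize_nil]
  | succ d ih =>
    intro t ht
    rw [level_succ, expandLevel] at ht
    simp only [List.mem_flatMap] at ht
    obtain ⟨ρ, hρ, i, hi, ht⟩ := ht
    obtain ⟨b, rfl⟩ : ∃ b, t = (i, b) :: ρ := by
      simp only [List.mem_cons, List.not_mem_nil, or_false] at ht
      rcases ht with rfl | rfl <;> exact ⟨_, rfl⟩
    have := ih ρ hρ
    have := esize_le_of_mem hi
    have := esize_bool_le b
    rw [esize_cons, esize_prod, Nat.succ_mul]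
    dsimp only
    omega

theorem esize_levelsBelow_le (names : List Name) (d W : ℕ)
    (hW : ∀ j < d, (2 * names.length) ^ j ≤ W) :
    esize (levelsBelow names d) ≤ d * (W * (d * (esize names + 5) + 2) + 2) + 1 := by
  refine (esize_list_le _ (W * (d * (esize names + 5) + 2) + 1) fun L hL => ?_).trans
    (by rw [length_levelsBelow])
  obtain ⟨j, hj, rfl⟩ : ∃ j < d, L = level names j := by
    clear hW
    induction d with
    | zero => simp [levelsBelow] at hL
    | succ d ih =>
      rw [levelsBelow, List.mem_cons] at hL
      rcases hL with rfl | hL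
      · exact ⟨d, by omega, rfl⟩
      · obtain ⟨j, hj, rfl⟩ := ih hL
        exact ⟨j, by omega, rfl⟩
  refine (esize_list_le _ _ (esize_mem_level_le names j)).trans ?_
  rw [length_level]
  have hj' := Nat.mul_le_mul_right (esize names + 5) hj.le
  exact Nat.succ_le_succ (Nat.mul_le_mul (hW j hj) (by omega))

/-- The states of the computation of the points. -/
abbrev PointState : Type :=
  List Unit × ((List Token × ℕ) × List Name) × List Assignment

/-- The first state of the computation of the points, from the reverse of a description. -/
def startPoints (s : List TreeSymbol) : PointState :=
  (List.replicate (queryTokens (tokenize s.reverse) + (queryTokens (tokenize s.reverse) +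
      queryTokens (tokenize s.reverse))) (),
    ((tokenize s.reverse, 8 * (tokenize s.reverse).length), namesOf (tokenize s.reverse)), [[]])

/-- One step of the computation of the points. -/
def stepPoints (x : PointState) : PointState := (x.1.tail, x.2.1, expandPoints x.2.1.2 x.2.2)

/-- The states of the loop of the search. -/
abbrev LoopState : Type :=
  List Unit × (Env × List (List Assignment)) × List (List TreeSymbol)

/-- The first state of the search. -/
def startSearch (x : PointState) : LoopState :=
  ([()], ((x.2.1.1, x.2.1.2, x.2.2), [[[]]]), [])

/-- One step of the search. -/
def stepSearch (x : LoopState) : LoopState := searchStep x.2.1.1 x.2.1.2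

/-- The reverse of the description that the search found. -/
def finish (x : LoopState) : List TreeSymbol := (x.2.2.headD []).reverse

theorem PT.startPoints : PT startPoints := by
  -- Multiplication by 8 is repeated doubling, as only addition is at hand.
  have h8 : ∀ (σ : Type) [Enc σ] (g : σ → ℕ), PT g → PT fun s => 8 * g s := by
    intro σ _ g hg
    have : PT fun s => g s + g s + (g s + g s) + (g s + g s + (g s + g s)) := by fun_prop
    exact this.congr fun s => by omega
  have := h8 (List TreeSymbol) (fun s => (_root_.tokenize s.reverse).length) (by fun_prop)
  unfold _root_.startPoints
  fun_prop

theorem PT.stepPoints : PT stepPoints :=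
  PT.pair (by fun_prop) (PT.pair (by fun_prop) (PT.comp
    (f := fun x : PointState => (x.2.1.2, x.2.2)) PT.expandPoints (by fun_prop)))

theorem PT.startSearch : PT startSearch := by
  unfold _root_.startSearch
  fun_prop

theorem PT.finish : PT finish := by
  unfold _root_.finish
  fun_prop

namespace RDT

variable {n : ℕ}

/-- The states of the computation of the points. -/
def pointState (R : RDT n) (i : ℕ) : PointState :=
  (List.replicate (3 * R.queryComplexity - i) (),
    ((R.tokens, 8 * R.tokens.length), namesOf R.tokens), (expandPoints (namesOf R.tokens))^[i] [[]])

theorem startPoints_describe (R : RDT n) : startPoints R.describe.reverse = R.pointState 0 := by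
  rw [startPoints, List.reverse_reverse, tokenize_describe, queryTokens_tokens, pointState]
  congr 2
  omega

theorem iterate_stepPoints (R : RDT n) (i : ℕ) :
    stepPoints^[i] (R.pointState 0) = R.pointState i := by
  induction i with
  | zero => rfl
  | succ i ih =>
    rw [iterate_succ_apply', ih, stepPoints, pointState, pointState, List.tail_replicate,
      iterate_succ_apply']
    rfl

/-- The states of the search before its success. -/
def loopState (R : RDT n) (d : ℕ) : LoopState :=
  ([()], (R.env, levelsBelow (namesOf R.tokens) (d + 1)), [])

theorem stepSearch_of_fail {R : RDT n} {d : ℕ} (h : search R.env d [] = []) :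
    stepSearch (R.loopState d) = R.loopState (d + 1) := by
  have := searchLevels_eq R.env d
  rw [h] at this
  change searchStep R.env (levelsBelow R.env.2.1 (d + 1)) = _
  rw [searchStep, if_pos this, levelsBelow, List.headD_cons, ← level_succ]
  rfl

theorem stepSearch_of_success {R : RDT n} {d : ℕ} {t : List TreeSymbol}
    (h : search R.env d [] = [t]) :
    stepSearch (R.loopState d) =
      ([], (R.env, levelsBelow (namesOf R.tokens) (d + 1)), [t]) := by
  have := searchLevels_eq R.env d
  rw [h] at this
  change searchStep R.env (levelsBelow R.env.2.1 (d + 1)) = _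
  rw [searchStep, if_neg (by rw [this]; simp), this]
  rfl

theorem iterate_stepSearch {R : RDT n} {d : ℕ} (h : ∀ d' < d, search R.env d' [] = []) (i : ℕ)
    (hi : i ≤ d) : stepSearch^[i] (R.loopState 0) = R.loopState i := by
  induction i with
  | zero => rfl
  | succ i ih => rw [iterate_succ_apply', ih (by omega), stepSearch_of_fail (h i (by omega))]

theorem queryComplexity_eq_zero {R : RDT n} (h : R.vars = ∅) : R.queryComplexity = 0 := by
  induction R with
  | leaf b => rfl
  | query i t₀ t₁ => simp [vars] at h
  | coin t₀ t₁ ih₀ ih₁ =>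
    rw [vars, Finset.union_eq_empty] at h
    rw [queryComplexity, ih₀ h.1, ih₁ h.2, max_self]

/-- The size of the search, up to polynomial factors. -/
def weight (R : RDT n) : ℕ := 2 * max 1 R.vars.card ^ (57 * R.queryComplexity ^ 3)

theorem pow_le_weight (R : RDT n) :
    max 1 R.vars.card ^ (3 * R.queryComplexity) ≤ R.weight := by
  refine le_trans (Nat.pow_le_pow_right (by omega) ?_) (Nat.le_mul_of_pos_left _ two_pos)
  have : R.queryComplexity ≤ R.queryComplexity ^ 3 := Nat.le_self_pow (by norm_num) _
  omega

/-- For `v ≥ 2` one has `2v ≤ v²`, so the power is at most `v ^ (54 q³)`. For `v ≤ 1` the bound `j ≤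
v` leaves `j ≤ 1`, and the factor 2 in `weight` suffices. The exponent 57 is 54 + 3, with room for
`v ^ (3q)` too. -/
theorem two_mul_pow_le_weight (R : RDT n) (j : ℕ) (h₁ : j ≤ 27 * R.queryComplexity ^ 3)
    (h₂ : j ≤ R.vars.card) : (2 * R.vars.card) ^ j ≤ R.weight := by
  rw [weight]
  rcases Nat.lt_or_ge R.vars.card 2 with hv | hv
  · interval_cases hc : R.vars.card
    · obtain rfl : j = 0 := by omega
      simp
    · interval_cases j <;> simp
  · rw [max_eq_right (by omega)]
    refine le_trans ?_ (Nat.le_mul_of_pos_left _ two_pos)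
    calc (2 * R.vars.card) ^ j ≤ (R.vars.card ^ 2) ^ j :=
          Nat.pow_le_pow_left (by rw [sq]; exact Nat.mul_le_mul_right _ hv) j
      _ = R.vars.card ^ (2 * j) := (pow_mul ..).symm
      _ ≤ _ := Nat.pow_le_pow_right (by omega) (by omega)

theorem weight_pow_le (R : RDT n) (k : ℕ) :
    R.weight ^ k ≤ 2 ^ k * n ^ (57 * k * R.queryComplexity ^ 3) := by
  rw [weight, mul_pow, ← pow_mul, mul_right_comm 57]
  refine Nat.mul_le_mul_left _ ?_
  -- If no variable occurs then `q = 0`, and both powers are 1, even for `n = 0`.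
  rcases R.vars.eq_empty_or_nonempty with h | h
  · simp [queryComplexity_eq_zero h]
  · rw [max_eq_right h.card_pos]
    exact Nat.pow_le_pow_left (by simpa using Finset.card_le_univ R.vars) _

end RDT

end

/-! ### Running times and the main theorem -/

open Turing Function Enc

/-- Separating the variables: the weight enters only through `w ^ k`, which becomes the factor `n ^
(C q³)`, and the rest is a polynomial in the length of the input. -/
theorem PB.exists_mul_pow {T : ℕ × ℕ → ℕ} (hT : PB T) :
    ∃ k, ∀ s w, 1 ≤ w → T (s, w) ≤ ((s + 2) * w) ^ k := by
  obtain ⟨k, hk⟩ := hT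
  refine ⟨3 * k, fun s w hw => (hk _).trans ?_⟩
  rw [pow_mul]
  -- A cube is needed: for `s = 0` and `w = 1` the left side is 7, and `(s + 2) * w` is 2.
  refine Nat.pow_le_pow_left ?_ k
  rw [esize_prod, esize_nat, esize_nat]
  obtain ⟨v, rfl⟩ := Nat.exists_eq_add_of_le hw
  nlinarith [Nat.zero_le (s * v), Nat.zero_le (s ^ 2), Nat.zero_le (s ^ 3), Nat.zero_le (v ^ 2),
    Nat.zero_le (v ^ 3), Nat.zero_le (s * v ^ 2), Nat.zero_le (s * v ^ 3),
    Nat.zero_le (s ^ 2 * v), Nat.zero_le (s ^ 2 * v ^ 2), Nat.zero_le (s ^ 2 * v ^ 3),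
    Nat.zero_le (s ^ 3 * v), Nat.zero_le (s ^ 3 * v ^ 2), Nat.zero_le (s ^ 3 * v ^ 3)]

theorem PB.fst : PB fun a : ℕ × ℕ => a.1 :=
  PB.size.mono fun a => by rw [esize_prod, esize_nat]; omega

theorem PB.snd : PB fun a : ℕ × ℕ => a.2 :=
  PB.size.mono fun a => by rw [esize_prod, esize_nat, esize_nat]; omega

namespace RDT

variable {n : ℕ}

theorem one_le_weight (R : RDT n) : 1 ≤ R.weight :=
  (Nat.one_le_pow _ _ (Nat.lt_of_lt_of_le one_pos (le_max_left _ _))).trans R.pow_le_weight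

theorem queries_lt_esize_pointState (R : RDT n) :
    3 * R.queryComplexity < esize (R.pointState 0) := by
  have := length_lt_esize (R.pointState 0).1
  rw [pointState, List.length_replicate] at this
  rw [pointState, esize_prod]
  omega

theorem esize_namesOf_tokens_lt (R : RDT n) :
    esize (namesOf R.tokens) < esize (R.pointState 0) := by
  rw [pointState, esize_prod, esize_prod, esize_prod]
  dsimp only
  omega

theorem esize_pointState_le (R : RDT n) (i : ℕ) (hi : i ≤ 3 * R.queryComplexity) :
    esize (R.pointState i) ≤ esize (R.pointState 0) +
      (esize (R.pointState 0) * R.weight *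
        (esize (R.pointState 0) * (esize (R.pointState 0) + 5) + 2) + 1) := by
  have h1 := R.queries_lt_esize_pointState
  have h2 := R.esize_namesOf_tokens_lt
  have h3 : esize ((expandPoints (namesOf R.tokens))^[i] [[]]) ≤
      esize (R.pointState 0) * R.weight *
        (esize (R.pointState 0) * (esize (R.pointState 0) + 5) + 2) + 1 := by
    refine (esize_iterate_expandPoints_le _ i).trans ?_
    rw [length_namesOf_tokens]
    have h4 : max 1 R.vars.card ^ i ≤ R.weight :=
      (Nat.pow_le_pow_right (Nat.lt_of_lt_of_le one_pos (le_max_left _ _)) hi).trans R.pow_le_weight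
    have h5 : i + 1 ≤ esize (R.pointState 0) := by omega
    have h6 : i ≤ esize (R.pointState 0) := by omega
    have h7 := Nat.mul_le_mul h6 (Nat.add_le_add_right h2.le 5)
    exact Nat.succ_le_succ (Nat.mul_le_mul (Nat.mul_le_mul h5 h4) (Nat.add_le_add_right h7 2))
  have h4 := esize_le_of_sublist ((List.replicate_sublist_replicate ()).2
    (show 3 * R.queryComplexity - i ≤ 3 * R.queryComplexity - 0 by omega))
  have h5 : esize (R.pointState i) ≤ esize (R.pointState 0) +
      esize ((expandPoints (namesOf R.tokens))^[i] [[]]) := by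
    simp only [pointState, esize_prod]
    omega
  omega

theorem card_lt_esize_loopState (R : RDT n) : R.vars.card < esize (R.loopState 0) := by
  have := length_lt_esize (namesOf R.tokens)
  rw [length_namesOf_tokens] at this
  simp only [loopState, env, esize_prod]
  omega

theorem esize_loopState_le (R : RDT n) (j : ℕ) (h₁ : j ≤ 27 * R.queryComplexity ^ 3)
    (h₂ : j ≤ R.vars.card) : esize (R.loopState j) ≤ esize (R.loopState 0) +
      (esize (R.loopState 0) * (R.weight *
        (esize (R.loopState 0) * (esize (R.loopState 0) + 5) + 2) + 2) + 1) := by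
  have h3 : j + 1 ≤ esize (R.loopState 0) := by
    have := R.card_lt_esize_loopState
    omega
  have h4 : esize (namesOf R.tokens) ≤ esize (R.loopState 0) := by
    simp only [loopState, env, esize_prod]
    omega
  have h5 := esize_levelsBelow_le (namesOf R.tokens) (j + 1) R.weight fun i hi => by
    rw [length_namesOf_tokens]
    exact R.two_mul_pow_le_weight i (by omega) (by omega)
  have h6 := Nat.mul_le_mul h3 (Nat.add_le_add_right h4 5)
  have h7 := Nat.mul_le_mul h3 (Nat.add_le_add_right
    (Nat.mul_le_mul_left R.weight (Nat.add_le_add_right h6 2)) 2)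
  have h8 : esize (R.loopState j) ≤ esize (R.loopState 0) +
      esize (levelsBelow (namesOf R.tokens) (j + 1)) := by
    simp only [loopState, esize_prod]
    omega
  omega

/-- The program that computes the points. -/
theorem exists_prog_points : ∃ (p : Prog) (k : ℕ), ∀ {n : ℕ} (R : RDT n),
    p.Computes (enc R.describe.reverse) (enc (R.loopState 0))
      (((esize R.describe.reverse + 2) * R.weight) ^ k) := by
  obtain ⟨p₁, k₁, h₁⟩ := PT.startPoints
  obtain ⟨p₂, k₂, h₂⟩ := PT.stepPoints
  obtain ⟨p₃, k₃, h₃⟩ := PT.startSearch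
  -- As functions of input size and weight, `A` bounds the first state and `S` every state of the
  -- loop.
  let A : ℕ × ℕ → ℕ := fun a => a.1 + (a.1 + 2) ^ k₁
  let S : ℕ × ℕ → ℕ := fun a => A a + (A a * a.2 * (A a * (A a + 5) + 2) + 1)
  have hA : PB A := PB.fst.add ((PB.fst.add (PB.const 2)).pow k₁)
  have hS : PB S := hA.add (((hA.mul PB.snd).mul ((hA.mul (hA.add (PB.const 5))).add
    (PB.const 2))).add (PB.const 1))
  have hT : PB fun a => (a.1 + 2) ^ k₁ + (A a * ((S a + 2) ^ k₂ + 3) + 3) + (S a + 2) ^ k₃ :=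
    (((PB.fst.add (PB.const 2)).pow k₁).add ((hA.mul (((hS.add (PB.const 2)).pow k₂).add
      (PB.const 3))).add (PB.const 3))).add ((hS.add (PB.const 2)).pow k₃)
  obtain ⟨k, hk⟩ := hT.exists_mul_pow
  refine ⟨(p₁.seq p₂.whileCons).seq p₃, k, fun {n} R => ?_⟩
  have c₁ := h₁ R.describe.reverse
  rw [startPoints_describe] at c₁
  have hA' : esize (R.pointState 0) ≤ A (esize R.describe.reverse, R.weight) := c₁.size_le
  have hS' : ∀ i ≤ 3 * R.queryComplexity,
      esize (R.pointState i) ≤ S (esize R.describe.reverse, R.weight) := fun i hi => by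
    refine (R.esize_pointState_le i hi).trans ?_
    change _ ≤ A _ + (A _ * R.weight * (A _ * (A _ + 5) + 2) + 1)
    gcongr
  have c₂ := Prog.computes_whileCons (p := p₂) (step := stepPoints)
    (t := (S (esize R.describe.reverse, R.weight) + 2) ^ k₂) (3 * R.queryComplexity)
    (R.pointState 0)
    (fun i hi => by
      rw [iterate_succ_apply', iterate_stepPoints]
      exact (h₂ _).mono (Nat.pow_le_pow_left (Nat.add_le_add_right (hS' i hi.le) 2) _))
    (fun i hi => by
      rw [iterate_stepPoints, pointState]
      simp only [ne_eq, List.replicate_eq_nil_iff]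
      omega)
    (by rw [iterate_stepPoints]; simp [pointState])
  rw [iterate_stepPoints] at c₂
  have c₃ := (h₃ (R.pointState (3 * R.queryComplexity))).mono
    (Nat.pow_le_pow_left (Nat.add_le_add_right (hS' _ le_rfl) 2) _)
  refine ((c₁.seq (c₂.mono ?_)).seq c₃).mono (hk _ _ R.one_le_weight)
  exact Nat.add_le_add_right (Nat.mul_le_mul_right _ (R.queries_lt_esize_pointState.le.trans hA')) 3

/-- The program that performs the search. -/
theorem exists_prog_search : ∃ (p : Prog) (k : ℕ), ∀ {n : ℕ} {R : RDT n}
    {f : (Fin n → Bool) → Bool}, R.ComputesWithBoundedError f → ∃ D : RDT n,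
      D.ComputesExactly f ∧ D.queryComplexity = minDeterministicQueries f ∧
      p.Computes (enc (R.loopState 0)) (enc D.describe.reverse)
        (((esize (R.loopState 0) + 2) * R.weight) ^ k) := by
  obtain ⟨p₁, k₁, h₁⟩ : PT fun x : LoopState => x.2.1 := by fun_prop
  obtain ⟨p₂, k₂, h₂⟩ := PT.searchStep
  obtain ⟨p₃, k₃, h₃⟩ := PT.finish
  let S : ℕ × ℕ → ℕ := fun a => a.1 + (a.1 * (a.2 * (a.1 * (a.1 + 5) + 2) + 2) + 1)
  let U : ℕ × ℕ → ℕ := fun a => (S a + 2) ^ k₁ + (S a + 2) ^ k₂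
  have hS : PB S := PB.fst.add ((PB.fst.mul ((PB.snd.mul ((PB.fst.mul (PB.fst.add
    (PB.const 5))).add (PB.const 2))).add (PB.const 2))).add (PB.const 1))
  have hU : PB U := ((hS.add (PB.const 2)).pow k₁).add ((hS.add (PB.const 2)).pow k₂)
  have hT : PB fun a => (a.1 * (U a + 3) + 3) + (S a + U a + 2) ^ k₃ :=
    ((PB.fst.mul (hU.add (PB.const 3))).add (PB.const 3)).add
      (((hS.add hU).add (PB.const 2)).pow k₃)
  obtain ⟨k, hk⟩ := hT.exists_mul_pow
  refine ⟨(p₁.seq p₂).whileCons.seq p₃, k, fun {n R f} h => ?_⟩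
  obtain ⟨d, D, hD, hmin, hd, hlt, hd₀, hd₁, hd₂⟩ := h.exists_first_search
  refine ⟨D, hD, hmin, ?_⟩
  have hS' : ∀ i ≤ d, esize (R.loopState i) ≤ S (esize (R.loopState 0), R.weight) := fun i hi =>
    R.esize_loopState_le i (hi.trans hd₁) (hi.trans hd₂)
  have hstep : ∀ i ≤ d, (p₁.seq p₂).Computes (enc (R.loopState i))
      (enc (stepSearch (R.loopState i))) (U (esize (R.loopState 0), R.weight)) := fun i hi => by
    -- The visited states satisfy the invariant, and the subtype shares their encoding, so the
    -- program for `SearchState` applies after the projection `p₁`.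
    let s : SearchState := ⟨(R.loopState i).2.1, i, rfl, fun hn => by have := hd₀ hn; omega⟩
    have hs : esize s ≤ esize (R.loopState i) := by
      rw [esize_subtype, esize_prod (R.loopState i), esize_prod (R.loopState i).2]
      dsimp only [s]
      omega
    refine ((h₁ (R.loopState i)).seq (h₂ s)).mono (Nat.add_le_add ?_ ?_)
    · exact Nat.pow_le_pow_left (Nat.add_le_add_right (hS' i hi) 2) _
    · exact Nat.pow_le_pow_left (Nat.add_le_add_right (hs.trans (hS' i hi)) 2) _
  have hiter := iterate_stepSearch hlt
  -- There are `d + 1` rounds: the depths below `d` fail and depth `d` succeeds.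
  have hlast : stepSearch^[d + 1] (R.loopState 0) =
      ([], (R.env, levelsBelow (namesOf R.tokens) (d + 1)), [D.describe]) := by
    rw [iterate_succ_apply', hiter d le_rfl, stepSearch_of_success hd]
  have c₁ := Prog.computes_whileCons (p := p₁.seq p₂) (step := stepSearch)
    (t := U (esize (R.loopState 0), R.weight)) (d + 1) (R.loopState 0)
    (fun i hi => by
      rw [iterate_succ_apply', hiter i (by omega)]
      exact hstep i (by omega))
    (fun i hi => by
      rw [hiter i (by omega)]
      exact List.cons_ne_nil _ _)
    (by rw [hlast])
  have hsize := (hstep d le_rfl).size_le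
  rw [stepSearch_of_success hd, ← hlast] at hsize
  have c₂ := h₃ (stepSearch^[d + 1] (R.loopState 0))
  rw [hlast] at c₁ c₂ hsize
  refine ((c₁.mono ?_).seq (c₂.mono ?_)).mono (hk _ _ R.one_le_weight)
  · exact Nat.add_le_add_right (Nat.mul_le_mul_right _
      (lt_of_le_of_lt hd₂ R.card_lt_esize_loopState)) 3
  · exact Nat.pow_le_pow_left (Nat.add_le_add_right
      (hsize.trans (Nat.add_le_add_right (hS' d le_rfl) _)) 2) _

end RDT

theorem mainTheorem6 :
    ∃ (A : Turing.TM2ComputableAux TreeSymbol TreeSymbol) (p : Polynomial ℕ) (C : ℕ),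
      ∀ (n : ℕ) (R : RDT n) (f : (Fin n → Bool) → Bool), R.ComputesWithBoundedError f →
        ∃ D : RDT n, D.ComputesExactly f ∧ D.queryComplexity = minDeterministicQueries f ∧
          Nonempty (Turing.TM2OutputsInTime A.tm
            (R.describe.map A.inputAlphabet.symm)
            (some (D.describe.map A.outputAlphabet.symm))
            (p.eval R.describe.length * n ^ (C * R.queryComplexity ^ 3))) := by
  obtain ⟨p₁, k₁, h₁⟩ := RDT.exists_prog_points
  obtain ⟨p₂, k₂, h₂⟩ := RDT.exists_prog_search
  -- Here `S` bounds the encoded input and `T₁` the time of the first program, so `S + T₁` bounds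
  -- the input of the second, whose time is at most `T₂`.
  let S : ℕ × ℕ → ℕ := fun a => 14 * a.1 + 1
  let T₁ : ℕ × ℕ → ℕ := fun a => ((S a + 2) * a.2) ^ k₁
  let T₂ : ℕ × ℕ → ℕ := fun a => ((S a + T₁ a + 2) * a.2) ^ k₂
  have hS : PB S := ((PB.const 14).mul PB.fst).add (PB.const 1)
  have hT₁ : PB T₁ := ((hS.add (PB.const 2)).mul PB.snd).pow k₁
  have hT₂ : PB T₂ := (((hS.add hT₁).add (PB.const 2)).mul PB.snd).pow k₂
  have hT : PB fun a => 23 * a.1 + (T₁ a + T₂ a) + 23 * (S a + (T₁ a + T₂ a)) + 5 :=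
    ((((PB.const 23).mul PB.fst).add (hT₁.add hT₂)).add
      ((PB.const 23).mul (hS.add (hT₁.add hT₂)))).add (PB.const 5)
  obtain ⟨k, hk⟩ := hT.exists_mul_pow
  refine ⟨⟨(Prog.input.seq ((p₁.seq p₂).seq Prog.output)).machine, Equiv.refl _, Equiv.refl _⟩,
    -- Both constants come from the `k`-th power of the weight: its factor 2 gives `2 ^ k` and its
    -- exponent gives `57 * k`.
    .C (2 ^ k) * (.X + .C 2) ^ k, 57 * k, fun n R f h => ?_⟩
  obtain ⟨D, hD, hmin, c₂⟩ := h₂ h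
  refine ⟨D, hD, hmin, ?_⟩
  have c₁ := h₁ R
  have hs : esize R.describe.reverse ≤ S (R.describe.length, R.weight) := by
    rw [esize_reverse]
    exact esize_symbols_le _
  have c₁' := c₁.mono (t' := T₁ (R.describe.length, R.weight))
    (Nat.pow_le_pow_left (Nat.mul_le_mul_right _ (Nat.add_le_add_right hs 2)) _)
  have hs' := c₁'.size_le.trans (Nat.add_le_add_right hs _)
  have c₂' := c₂.mono (t' := T₂ (R.describe.length, R.weight))
    (Nat.pow_le_pow_left (Nat.mul_le_mul_right _ (Nat.add_le_add_right hs' 2)) _)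
  have c := c₁'.seq c₂'
  -- The output cannot be longer than the input size plus the number of steps that produced it.
  have ho : D.describe.length ≤ S (R.describe.length, R.weight) +
      (T₁ (R.describe.length, R.weight) + T₂ (R.describe.length, R.weight)) := by
    have := length_lt_esize D.describe.reverse
    rw [List.length_reverse] at this
    exact this.le.trans (c.size_le.trans (Nat.add_le_add_right hs _))
  have htime : 23 * R.describe.length + (T₁ (R.describe.length, R.weight) +
      T₂ (R.describe.length, R.weight)) + 23 * D.describe.length + 5 ≤
      (Polynomial.C (2 ^ k) * (.X + .C 2) ^ k : Polynomial ℕ).eval R.describe.length *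
        n ^ (57 * k * R.queryComplexity ^ 3) := by
    refine (Nat.add_le_add_right (Nat.add_le_add_left (Nat.mul_le_mul_left 23 ho) _) 5).trans
      ((hk R.describe.length R.weight R.one_le_weight).trans ?_)
    rw [mul_pow]
    refine (Nat.mul_le_mul_left _ (R.weight_pow_le k)).trans_eq ?_
    simp only [Polynomial.eval_mul, Polynomial.eval_C, Polynomial.eval_pow, Polynomial.eval_add,
      Polynomial.eval_X]
    ring
  have hmap : ∀ l : List TreeSymbol, l.map (Equiv.refl TreeSymbol).symm = l := fun l => by simp
  have := c.outputsInTime htime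
  exact (congrArg₂ (fun i o => Nonempty (TM2OutputsInTime
    (Prog.input.seq ((p₁.seq p₂).seq Prog.output)).machine i (some o) _))
    (hmap R.describe) (hmap D.describe)).mpr this
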